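/- **Setting.** Let $L_{\mathrm{TC}^0}$ be the first-order language with $\le$ and function symbols for all $\mathrm{TC}^0$ functions on binary natural numbers: Buss's functions $0,S,+,\cdot,\lfloor x/2\rfloor,|x|,\#$, the functions $x\mathbin{\dot-}y$ and $\lfloor x/2^u\rfloor$, closed under composition, bit comprehension on lengths (from $h$ form the function $w(a,\vec z)$ with $|w|\le|a|$ whose $u$-th bit, for $u<|a|$, is $1$ iff $h(u,\vec z)\ne0$), and search on lengths (from $h$ form the least $u<|a|$ with $h(u,\vec z)\ne0$, or $|a|$ if there is none). Let $B$ be the universal theory consisting of Buss's $\mathrm{BASIC}$ and the defining axioms of these functions. $\hat\Sigma^b_0=\hat\Pi^b_0$ is the class of sharply bounded formulas (quantifiers $Qv\le|t|$ only); for $i>0$, $\hat\Sigma^b_i$ ($\hat\Pi^b_i$) is the class of formulas consisting of $i$ alternating, possibly empty, blocks of bounded quantifiers, the first block existential (universal), followed by a sharply bounded formula. A rule is a set of instances $\varphi_1,\dots,\varphi_n\,/\,\varphi_0$ with $\varphi_0,\dots,\varphi_n$ sentences (outermost universal quantifiers are omitted below); an axiom scheme is a rule with $n=0$ in all instances. For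 a theory $T\supseteq B$ in $L_{\mathrm{TC}^0}$, $[T,R]$ is the theory axiomatized by $T$ and the conclusions of all instances of $R$ whose premises are provable in $T$. Write $R\le S$ if $[T,R]\subseteq[T,S]$ for every theory $T\supseteq B$, and $R\equiv S$ if $R\le S$ and $S\le R$. For a class $\Gamma$ of formulas consider the following schemes and rules for all $\varphi(x,y)\in\Gamma$, where $y$ is a tuple of parameters: - $\Gamma$-$\mathrm{IND}$: $\varphi(0,y)\land\forall x(\varphi(x,y)\to\varphi(x+1,y))\to\forall x\,\varphi(x,y)$ - $\Gamma$-$\mathrm{PIND}$: $\varphi(0,y)\land\forall x(\varphi(\lfloor x/2\rfloor,y)\to\varphi(x,y))\to\forall x\,\varphi(x,y)$ - $\Gamma$-$\mathrm{LIND}$: $\varphi(0,y)\land\forall x(\varphi(x,y)\to\varphi(x+1,y))\to\forall x\,\varphi(|x|,y)$ - $\Gamma$-$\mathrm{IND}_<$: $\forall x(\forall x'<x\,\varphi(x',y)\to\varphi(x,y))\to\forall x\,\varphi(x,y)$ - $\Gamma$-$\mathrm{LIND}_<$: $\forall x(\forall x'<x\,\varphi(x',y)\to\varphi(x,y))\to\forall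 x\,\varphi(|x|,y)$ - $\Gamma$-$\mathrm{PIND}_<$: $\forall x(\forall x'(|x'|<|x|\to\varphi(x',y))\to\varphi(x,y))\to\forall x\,\varphi(x,y)$ - $\Gamma$-$\mathrm{PIND}_{\mathrm{res}}$: $\forall x(\forall u\le|x|(u>0\to\varphi(\lfloor x/2^u\rfloor,y))\to\varphi(x,y))\to\forall x\,\varphi(x,y)$ - $\Gamma$-$\mathrm{MIN}$: $\exists x\,\varphi(x,y)\to\exists x(\varphi(x,y)\land\forall x'<x\,\neg\varphi(x',y))$ - $\Gamma$-$\mathrm{LMIN}$: $\exists x\,\varphi(x,y)\to\exists x(\varphi(x,y)\land\forall x'(|x'|<|x|\to\neg\varphi(x',y)))$ - $\Gamma$-$\mathrm{IND}^R$, $\Gamma$-$\mathrm{PIND}^R$: from $\varphi(0,y)$ and $\varphi(x,y)\to\varphi(x+1,y)$ (respectively $\varphi(\lfloor x/2\rfloor,y)\to\varphi(x,y)$) infer $\varphi(x,y)$ - $\Gamma$-$\mathrm{LIND}^R$: from $\varphi(0,y)$ and $\varphi(x,y)\to\varphi(x+1,y)$ infer $\varphi(|x|,y)$ - $\Gamma$-$\mathrm{IND}^R_0$,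 $\Gamma$-$\mathrm{PIND}^R_0$, $\Gamma$-$\mathrm{LIND}^R_0$: from $\varphi(x,y)\to\varphi(x+1,y)$ (respectively $\varphi(\lfloor x/2\rfloor,y)\to\varphi(x,y)$; $\varphi(x,y)\to\varphi(x+1,y)$) infer $\varphi(0,y)\to\varphi(x,y)$ (respectively $\varphi(0,y)\to\varphi(x,y)$; $\varphi(0,y)\to\varphi(|x|,y)$) - $\Gamma$-$\mathrm{IND}^R_<$, $\Gamma$-$\mathrm{LIND}^R_<$, $\Gamma$-$\mathrm{PIND}^R_<$, $\Gamma$-$\mathrm{PIND}^R_{\mathrm{res}}$, $\Gamma$-$\mathrm{MIN}^R$, $\Gamma$-$\mathrm{LMIN}^R$: from the antecedent of the corresponding scheme infer its succedent. A superscript $^-$ denotes the parameter-free version, in which $\varphi$ has no free variable other than $x$. **Proposition 4.2.** Let $i\ge0$, let $\Gamma$ be $\hat\Sigma^b_i$ or $\hat\Pi^b_i$, and let $\overline\Gamma$ be the other of these two classes. Then: 1. $\Gamma\text{-}\mathrm{IND}^{R-}\equiv\Gamma\text{-}\mathrm{IND}^{R-}_0\equiv\Gamma\text{-}\mathrm{IND}^R$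 and $\Gamma\text{-}\mathrm{PIND}^{R-}\equiv\Gamma\text{-}\mathrm{PIND}^{R-}_0\equiv\Gamma\text{-}\mathrm{PIND}^R$. 2. $\Gamma\text{-}\mathrm{LIND}\equiv\Gamma\text{-}\mathrm{LIND}_<\equiv\Gamma\text{-}\mathrm{PIND}$ and $\Gamma\text{-}\mathrm{LIND}^R\equiv\Gamma\text{-}\mathrm{LIND}^R_<\equiv\Gamma\text{-}\mathrm{PIND}^R$. 3. For $\Delta\in\{\hat\Sigma^b_i,\hat\Pi^b_{i+1}\}$, $\Delta\text{-}\mathrm{IND}_<\equiv\hat\Pi^b_{i+1}\text{-}\mathrm{IND}$ and $\Delta\text{-}\mathrm{PIND}_<\equiv\hat\Pi^b_{i+1}\text{-}\mathrm{PIND}$. The same equivalences hold with $^-$ on both sides, with $^R$ on both sides, and with $^{R-}$ on both sides. 4. $\Gamma\text{-}\mathrm{PIND}_{\mathrm{res}}\equiv\Gamma\text{-}\mathrm{PIND}$, and likewise with $^-$, with $^R$, and with $^{R-}$ on both sides. 5. $\Gamma\text{-}\mathrm{IND}^R_0\equiv\hat\Sigma^b_i\text{-}\mathrm{IND}^R$,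 $\Gamma\text{-}\mathrm{PIND}^R_0\equiv\hat\Sigma^b_i\text{-}\mathrm{PIND}^R$, and $\Gamma\text{-}\mathrm{LIND}^R_0\equiv\hat\Sigma^b_i\text{-}\mathrm{PIND}^R$. 6. $\Gamma\text{-}\mathrm{MIN}\equiv\overline\Gamma\text{-}\mathrm{IND}_<$ and $\Gamma\text{-}\mathrm{LMIN}\equiv\overline\Gamma\text{-}\mathrm{PIND}_<$, and likewise with $^-$ on both sides. 7. $\Gamma\text{-}\mathrm{MIN}^R\equiv\Gamma\text{-}\mathrm{MIN}$ and $\Gamma\text{-}\mathrm{LMIN}^R\equiv\Gamma\text{-}\mathrm{LMIN}$. -/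

import Mathlib

open FirstOrder FirstOrder.Language

namespace BoundedArithmetic

/-! ### The language of `TC⁰` functions -/

/-- Function symbols for the `TC⁰` functions on binary natural numbers: the closure of Buss's
functions `0, S, +, ·, ⌊x/2⌋, |x|, #` together with `∸` and `msp (x, i) = ⌊x / 2 ^ i⌋` under
composition, bit comprehension on lengths, and search on lengths.

* `bits h (a, x) ` is the number `w` with `|w| ≤ |a|` whose `u`-th bit, for `u < |a|`,
  is `1` iff `h (u, x) ≠ 0`;
* `search h (a, x)` is the least `u < |a|` with `h (u, x) ≠ 0`, and `|a|` if there is none. -/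
inductive TCFun : ℕ → Type
  | zero : TCFun 0
  | succ : TCFun 1
  | add : TCFun 2
  | mul : TCFun 2
  | half : TCFun 1
  | len : TCFun 1
  | smash : TCFun 2
  | sub : TCFun 2
  | msp : TCFun 2
  | proj {n : ℕ} (i : Fin n) : TCFun n
  | comp {n k : ℕ} (f : TCFun k) (g : Fin k → TCFun n) : TCFun n
  | bits {n : ℕ} (h : TCFun (n + 1)) : TCFun (n + 1)
  | search {n : ℕ} (h : TCFun (n + 1)) : TCFun (n + 1)

/-- The only relation symbol besides equality is `≤`. -/
inductive TCRel : ℕ → Type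
  | le : TCRel 2

/-- The first-order language `L_{TC⁰}`. -/
def LTC : FirstOrder.Language.{0, 0} := ⟨TCFun, TCRel⟩

section TermsAndFormulas

variable {α : Type} {n : ℕ}

/-- Application of a function symbol to a tuple of terms. -/
def app {k : ℕ} (f : TCFun k) (ts : Fin k → LTC.Term α) : LTC.Term α :=
  Term.func (L := LTC) f ts

def tZero : LTC.Term α := app .zero ![]
def tSucc (t : LTC.Term α) : LTC.Term α := app .succ ![t]
def tHalf (t : LTC.Term α) : LTC.Term α := app .half ![t]
def tLen (t : LTC.Term α) : LTC.Term α := app .len ![t]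
def tSmash (s t : LTC.Term α) : LTC.Term α := app .smash ![s, t]
def tMsp (s t : LTC.Term α) : LTC.Term α := app .msp ![s, t]

instance : Zero (LTC.Term α) := ⟨tZero⟩
instance : One (LTC.Term α) := ⟨tSucc tZero⟩
instance : Add (LTC.Term α) := ⟨fun s t => app .add ![s, t]⟩
instance : Mul (LTC.Term α) := ⟨fun s t => app .mul ![s, t]⟩
instance : Sub (LTC.Term α) := ⟨fun s t => app .sub ![s, t]⟩

/-- The term `2 · t`. -/
def tDouble (t : LTC.Term α) : LTC.Term α := tSucc (tSucc 0) * t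

/-- The formula `s ≤ t`. -/
def fLe (s t : LTC.Term (α ⊕ Fin n)) : LTC.BoundedFormula α n :=
  BoundedFormula.rel (L := LTC) (n := n) (R := TCRel.le) ![s, t]

/-- The formula `s < t`, as `¬ t ≤ s`. -/
def fLt (s t : LTC.Term (α ⊕ Fin n)) : LTC.BoundedFormula α n := ∼(fLe t s)

/-- Weakening of a term by one new bound variable. -/
def weaken (t : LTC.Term (α ⊕ Fin n)) : LTC.Term (α ⊕ Fin (n + 1)) :=
  t.relabel (Sum.map id Fin.castSucc)

/-- The bounded quantification `∀ v ≤ t, φ`, where `v` does not occur in `t`. -/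
def ballLe (t : LTC.Term (α ⊕ Fin n)) (φ : LTC.BoundedFormula α (n + 1)) :
    LTC.BoundedFormula α n :=
  ∀' (fLe (&(Fin.last n)) (weaken t) ⟹ φ)

/-- The bounded quantification `∃ v ≤ t, φ`, where `v` does not occur in `t`. -/
def bexLe (t : LTC.Term (α ⊕ Fin n)) (φ : LTC.BoundedFormula α (n + 1)) :
    LTC.BoundedFormula α n :=
  ∃' (fLe (&(Fin.last n)) (weaken t) ⊓ φ)

end TermsAndFormulas

/-- Formulas whose free variables are `&0, …, &(n-1)`. -/
abbrev Fm (n : ℕ) := LTC.BoundedFormula Empty n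

/-- Terms in the variables `&0, …, &(n-1)`. -/
abbrev Tm (n : ℕ) := LTC.Term (Empty ⊕ Fin n)

/-! ### The base theory -/

/-- Buss's theory `BASIC`, written in the variables `x, y, z`. -/
def basicAxioms : List (Fm 3) :=
  let x : Tm 3 := &0
  let y : Tm 3 := &1
  let z : Tm 3 := &2
  [ fLe y x ⟹ fLe y (tSucc x),
    ∼(x =' tSucc x),
    fLe 0 x,
    (fLe x y ⊓ ∼(x =' y)) ⇔ fLe (tSucc x) y,
    ∼(x =' 0) ⟹ ∼(tDouble x =' 0),
    fLe y x ⊔ fLe x y,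
    (fLe x y ⊓ fLe y x) ⟹ x =' y,
    (fLe x y ⊓ fLe y z) ⟹ fLe x z,
    tLen 0 =' (0 : Tm 3),
    ∼(x =' 0) ⟹
      (tLen (tDouble x) =' tSucc (tLen x) ⊓ tLen (tSucc (tDouble x)) =' tSucc (tLen x)),
    tLen 1 =' (1 : Tm 3),
    fLe x y ⟹ fLe (tLen x) (tLen y),
    tLen (tSmash x y) =' tSucc (tLen x * tLen y),
    tSmash 0 y =' 1,
    ∼(x =' 0) ⟹
      (tSmash 1 (tDouble x) =' tDouble (tSmash 1 x) ⊓
        tSmash 1 (tSucc (tDouble x)) =' tDouble (tSmash 1 x)),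
    tSmash x y =' tSmash y x,
    tLen x =' tLen y ⟹ tSmash x z =' tSmash y z ]

/-- The axiom `|x| = |u| + |v| → x # y = (u # y) · (v # y)` of `BASIC`. -/
def basicSmashMul : Fm 4 :=
  let x : Tm 4 := &0
  let u : Tm 4 := &1
  let v : Tm 4 := &2
  let y : Tm 4 := &3
  tLen x =' (tLen u + tLen v) ⟹ tSmash x y =' (tSmash u y * tSmash v y)

/-- The remaining axioms of `BASIC`. -/
def basicAxioms' : List (Fm 3) :=
  let x : Tm 3 := &0
  let y : Tm 3 := &1
  let z : Tm 3 := &2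
  [ fLe x (x + y),
    (fLe x y ⊓ ∼(x =' y)) ⟹
      (fLe (tSucc (tDouble x)) (tDouble y) ⊓ ∼(tSucc (tDouble x) =' tDouble y)),
    (x + y) =' (y + x),
    (x + 0) =' x,
    (x + tSucc y) =' tSucc (x + y),
    ((x + y) + z) =' (x + (y + z)),
    fLe (x + y) (x + z) ⇔ fLe y z,
    (x * 0) =' 0,
    (x * tSucc y) =' (x * y + x),
    (x * y) =' (y * x),
    (x * (y + z)) =' (x * y + x * z),
    fLe 1 x ⟹ (fLe (x * y) (x * z) ⇔ fLe y z),
    ∼(x =' 0) ⟹ tLen x =' tSucc (tLen (tHalf x)),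
    x =' tHalf y ⇔ (tDouble x =' y ⊔ tSucc (tDouble x) =' y) ]

/-- Defining axioms of `x ∸ y` and of `msp (x, i) = ⌊x / 2 ^ i⌋`. -/
def subMspAxioms : List (Fm 2) :=
  let x : Tm 2 := &0
  let y : Tm 2 := &1
  [ fLe x y ⟹ (x - y) =' 0,
    fLe y x ⟹ ((x - y) + y) =' x,
    tMsp x 0 =' x,
    tMsp x (tSucc y) =' tHalf (tMsp x y),
    tLen (tMsp x y) =' (tLen x - y) ]

/-- The formula "the `u`-th binary digit of `w` is `1`", i.e. `⌊w / 2 ^ u⌋` is odd. -/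
def fBit {n : ℕ} (u w : Tm n) : Fm n :=
  tMsp w u =' tSucc (tDouble (tHalf (tMsp w u)))

/-- Defining axiom of a projection. -/
def projAxiom {n : ℕ} (i : Fin n) : LTC.Sentence :=
  (app (.proj i) (fun j => (&j : Tm n)) =' &i).alls

/-- Defining axiom of a composition. -/
def compAxiom {n k : ℕ} (f : TCFun k) (g : Fin k → TCFun n) : LTC.Sentence :=
  (app (.comp f g) (fun j => (&j : Tm n)) =' app f (fun i => app (g i) (fun j => &j))).alls

/-- Defining axioms of `w = bits h (a, x)`: `|w| ≤ |a|`, and for all `u < |a|`, the `u`-th bit of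
`w` is `1` iff `h (u, x) ≠ 0`. -/
def bitsAxiom {n : ℕ} (h : TCFun (n + 1)) : LTC.Sentence :=
  let x : Fin n → Tm (n + 2) := fun j => &(j.castAdd 2)
  let a : Tm (n + 2) := &(Fin.last n).castSucc
  let u : Tm (n + 2) := &(Fin.last (n + 1))
  let w : Tm (n + 2) := app (.bits h) (Fin.cons a x)
  (fLe (tLen w) (tLen a) ⊓
    (fLt u (tLen a) ⟹ (fBit u w ⇔ ∼(app h (Fin.cons u x) =' 0)))).alls

/-- Defining axioms of `m = search h (a, x)`: `m ≤ |a|`; if `m < |a|` then `h (m, x) ≠ 0`; and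
`h (u, x) = 0` for all `u < m`. -/
def searchAxiom {n : ℕ} (h : TCFun (n + 1)) : LTC.Sentence :=
  let x : Fin n → Tm (n + 2) := fun j => &(j.castAdd 2)
  let a : Tm (n + 2) := &(Fin.last n).castSucc
  let u : Tm (n + 2) := &(Fin.last (n + 1))
  let m : Tm (n + 2) := app (.search h) (Fin.cons a x)
  (fLe m (tLen a) ⊓
    ((fLt m (tLen a) ⟹ ∼(app h (Fin.cons m x) =' 0)) ⊓
      (fLt u m ⟹ app h (Fin.cons u x) =' 0))).alls

/-- The base theory `BTC⁰`: the universal theory consisting of `BASIC` and of the defining axioms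
of all function symbols. Since every quantifier-free formula has a characteristic function among
the function symbols, the axioms for `bits` and `search` give comprehension (on lengths) and the
least number principle on lengths, equivalently length induction, for all quantifier-free, hence
for all sharply bounded, formulas. -/
def BTC : LTC.Theory :=
  {σ | (∃ φ ∈ basicAxioms, σ = φ.alls) ∨ σ = basicSmashMul.alls ∨
    (∃ φ ∈ basicAxioms', σ = φ.alls) ∨ (∃ φ ∈ subMspAxioms, σ = φ.alls) ∨
    (∃ (n : ℕ) (i : Fin n), σ = projAxiom i) ∨
    (∃ (n k : ℕ) (f : TCFun k) (g : Fin k → TCFun n), σ = compAxiom f g) ∨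
    (∃ (n : ℕ) (h : TCFun (n + 1)), σ = bitsAxiom h) ∨
    (∃ (n : ℕ) (h : TCFun (n + 1)), σ = searchAxiom h)}

/-! ### Formula classes -/

/-- Sharply bounded formulas: the closure of atomic formulas under Boolean connectives (here
generated by `⊥` and `→`) and quantifiers `∀ v ≤ |t|`, `∃ v ≤ |t|`. -/
inductive IsSharplyBounded {α : Type} : ∀ {n : ℕ}, LTC.BoundedFormula α n → Prop
  | falsum {n : ℕ} : IsSharplyBounded (⊥ : LTC.BoundedFormula α n)
  | atomic {n : ℕ} {φ : LTC.BoundedFormula α n} (h : φ.IsAtomic) : IsSharplyBounded φ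
  | imp {n : ℕ} {φ ψ : LTC.BoundedFormula α n} (hφ : IsSharplyBounded φ)
      (hψ : IsSharplyBounded ψ) : IsSharplyBounded (φ ⟹ ψ)
  | ball {n : ℕ} (t : LTC.Term (α ⊕ Fin n)) {φ : LTC.BoundedFormula α (n + 1)}
      (hφ : IsSharplyBounded φ) : IsSharplyBounded (ballLe (tLen t) φ)
  | bex {n : ℕ} (t : LTC.Term (α ⊕ Fin n)) {φ : LTC.BoundedFormula α (n + 1)}
      (hφ : IsSharplyBounded φ) : IsSharplyBounded (bexLe (tLen t) φ)

/-- The two kinds of classes in the hierarchy of strict bounded formulas. -/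
inductive Side
  | sigma
  | pi

/-- The other kind. -/
def Side.dual : Side → Side
  | .sigma => .pi
  | .pi => .sigma

/-- `IsStrict .sigma i φ` and `IsStrict .pi i φ` say that `φ` is a strict `Σᵇᵢ` (`Πᵇᵢ`) formula:
`i` alternating, possibly empty, blocks of bounded quantifiers, the first one existential
(universal), followed by a sharply bounded formula. -/
inductive IsStrict {α : Type} : Side → ℕ → ∀ {n : ℕ}, LTC.BoundedFormula α n → Prop
  | base (s : Side) {n : ℕ} {φ : LTC.BoundedFormula α n} (h : IsSharplyBounded φ) :
      IsStrict s 0 φ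
  | next (s : Side) {i n : ℕ} {φ : LTC.BoundedFormula α n} (h : IsStrict s.dual i φ) :
      IsStrict s (i + 1) φ
  | bex {i n : ℕ} (t : LTC.Term (α ⊕ Fin n)) {φ : LTC.BoundedFormula α (n + 1)}
      (h : IsStrict .sigma (i + 1) φ) : IsStrict .sigma (i + 1) (bexLe t φ)
  | ball {i n : ℕ} (t : LTC.Term (α ⊕ Fin n)) {φ : LTC.BoundedFormula α (n + 1)}
      (h : IsStrict .pi (i + 1) φ) : IsStrict .pi (i + 1) (ballLe t φ)

/-- Formulas `φ(x, y₁, …, yₖ)` with induction variable `x` (the variable `none`) and a tuple of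
parameters `y₁, …, yₖ` (the variables `some j`), and no other free variables. -/
abbrev IndFm (k : ℕ) := LTC.Formula (Option (Fin k))

/-- A class of formulas `φ(x, y₁, …, yₖ)`. -/
abbrev FmClass := ∀ k : ℕ, Set (IndFm k)

/-- The class of strict `Σᵇᵢ` (for `s = .sigma`) or strict `Πᵇᵢ` (for `s = .pi`) formulas. -/
def hat (s : Side) (i : ℕ) : FmClass := fun _ => {φ | IsStrict s i φ}

/-! ### Rules and reducibility -/

/-- A rule is a set of instances, pairs of a finite list of premises and a conclusion, all of
them sentences. Axiom schemes are rules without premises. -/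
abbrev Rule := Set (List LTC.Sentence × LTC.Sentence)

/-- The deductive closure `[T, R]` of `T` under unnested applications of the rule `R`. -/
def unnested (T : LTC.Theory) (R : Rule) : LTC.Theory :=
  {σ | (T ∪ {τ | ∃ Δ : List LTC.Sentence, (Δ, τ) ∈ R ∧ ∀ δ ∈ Δ, T ⊨ᵇ δ}) ⊨ᵇ σ}

/-- `R` is reducible to `S`: `[T, R] ⊆ [T, S]` for every theory `T` extending the base theory. -/
def Reducible (R S : Rule) : Prop :=
  ∀ T : LTC.Theory, BTC ⊆ T → unnested T R ⊆ unnested T S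

/-- Equivalence of rules. -/
def RuleEquiv (R S : Rule) : Prop := Reducible R S ∧ Reducible S R

infix:50 " ≡ᵣ " => RuleEquiv

/-! ### Schemes and rules -/

/-- A scheme assigns an instance to every formula `φ(x, y₁, …, yₖ)`. -/
abbrev Scheme := ∀ k : ℕ, IndFm k → List LTC.Sentence × LTC.Sentence

/-- The rule consisting of the instances of `S` for formulas in `Γ`, with parameters. -/
def FmClass.rule (Γ : FmClass) (S : Scheme) : Rule :=
  {r | ∃ (k : ℕ) (φ : IndFm k), φ ∈ Γ k ∧ r = S k φ}

/-- The parameter-free version: only formulas `φ(x)` are allowed. -/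
def FmClass.ruleFree (Γ : FmClass) (S : Scheme) : Rule :=
  {r | ∃ φ : IndFm 0, φ ∈ Γ 0 ∧ r = S 0 φ}

section Schemes

variable {k : ℕ}

/-- The formula `φ(t, y)`, where the parameters `y` are the variables `&0, …, &(k-1)`. -/
def IndFm.inst (φ : IndFm k) (m : ℕ) (t : Tm (k + m)) : Fm (k + m) :=
  BoundedFormula.relabel (k := 0) id
    (BoundedFormula.subst φ fun v => v.elim t fun j => &(j.castAdd m))

/-- The formula `φ(0, y)`. -/
def IndFm.atZero (φ : IndFm k) : Fm k := φ.inst 0 0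

/-- The induction variable `x` directly after the parameters. -/
def vX : Tm (k + 1) := &(Fin.last k)

/-- The induction variable `x` in the presence of a further bound variable. -/
def vX' : Tm (k + 2) := &(Fin.last k).castSucc

/-- The further bound variable (`x'` or `u`). -/
def vU : Tm (k + 2) := &(Fin.last (k + 1))

/-- `φ(t(x), y)`. -/
def IndFm.at1 (φ : IndFm k) (t : Tm (k + 1)) : Fm (k + 1) := φ.inst 1 t

/-- `φ(x, y) → φ(x + 1, y)`. -/
def stepInd (φ : IndFm k) : Fm (k + 1) := φ.at1 vX ⟹ φ.at1 (vX + 1)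

/-- `φ(⌊x/2⌋, y) → φ(x, y)`. -/
def stepPind (φ : IndFm k) : Fm (k + 1) := φ.at1 (tHalf vX) ⟹ φ.at1 vX

/-- `∀ x' < x φ(x', y) → φ(x, y)`. -/
def stepLt (φ : IndFm k) : Fm (k + 1) :=
  (∀' (fLt vU vX' ⟹ φ.inst 2 vU)) ⟹ φ.at1 vX

/-- `∀ x' (|x'| < |x| → φ(x', y)) → φ(x, y)`. -/
def stepLenLt (φ : IndFm k) : Fm (k + 1) :=
  (∀' (fLt (tLen vU) (tLen vX') ⟹ φ.inst 2 vU)) ⟹ φ.at1 vX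

/-- `∀ u ≤ |x| (u > 0 → φ(⌊x / 2 ^ u⌋, y)) → φ(x, y)`. -/
def stepRes (φ : IndFm k) : Fm (k + 1) :=
  (∀' (fLe vU (tLen vX') ⟹ (fLt 0 vU ⟹ φ.inst 2 (tMsp vX' vU)))) ⟹ φ.at1 vX

/-- `φ(x, y) ∧ ∀ x' < x ¬ φ(x', y)`. -/
def isMin (φ : IndFm k) : Fm (k + 1) :=
  φ.at1 vX ⊓ ∀' (fLt vU vX' ⟹ ∼(φ.inst 2 vU))

/-- `φ(x, y) ∧ ∀ x' (|x'| < |x| → ¬ φ(x', y))`. -/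
def isLenMin (φ : IndFm k) : Fm (k + 1) :=
  φ.at1 vX ⊓ ∀' (fLt (tLen vU) (tLen vX') ⟹ ∼(φ.inst 2 vU))

end Schemes

/-- `φ(0,y) ∧ ∀x (φ(x,y) → φ(x+1,y)) → ∀x φ(x,y)`. -/
def IND : Scheme := fun _ φ =>
  ([], ((φ.atZero ⊓ ∀' stepInd φ) ⟹ ∀' φ.at1 vX).alls)

/-- `φ(0,y) ∧ ∀x (φ(⌊x/2⌋,y) → φ(x,y)) → ∀x φ(x,y)`. -/
def PIND : Scheme := fun _ φ =>
  ([], ((φ.atZero ⊓ ∀' stepPind φ) ⟹ ∀' φ.at1 vX).alls)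

/-- `φ(0,y) ∧ ∀x (φ(x,y) → φ(x+1,y)) → ∀x φ(|x|,y)`. -/
def LIND : Scheme := fun _ φ =>
  ([], ((φ.atZero ⊓ ∀' stepInd φ) ⟹ ∀' φ.at1 (tLen vX)).alls)

/-- `∀x (∀x'<x φ(x',y) → φ(x,y)) → ∀x φ(x,y)`. -/
def INDlt : Scheme := fun _ φ => ([], ((∀' stepLt φ) ⟹ ∀' φ.at1 vX).alls)

/-- `∀x (∀x'<x φ(x',y) → φ(x,y)) → ∀x φ(|x|,y)`. -/
def LINDlt : Scheme := fun _ φ => ([], ((∀' stepLt φ) ⟹ ∀' φ.at1 (tLen vX)).alls)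

/-- `∀x (∀x' (|x'|<|x| → φ(x',y)) → φ(x,y)) → ∀x φ(x,y)`. -/
def PINDlt : Scheme := fun _ φ => ([], ((∀' stepLenLt φ) ⟹ ∀' φ.at1 vX).alls)

/-- `∀x (∀u≤|x| (u>0 → φ(⌊x/2^u⌋,y)) → φ(x,y)) → ∀x φ(x,y)`. -/
def PINDres : Scheme := fun _ φ => ([], ((∀' stepRes φ) ⟹ ∀' φ.at1 vX).alls)

/-- `∃x φ(x,y) → ∃x (φ(x,y) ∧ ∀x'<x ¬φ(x',y))`. -/
def MIN : Scheme := fun _ φ => ([], ((∃' φ.at1 vX) ⟹ ∃' isMin φ).alls)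

/-- `∃x φ(x,y) → ∃x (φ(x,y) ∧ ∀x' (|x'|<|x| → ¬φ(x',y)))`. -/
def LMIN : Scheme := fun _ φ => ([], ((∃' φ.at1 vX) ⟹ ∃' isLenMin φ).alls)

/-- `φ(0,y), φ(x,y) → φ(x+1,y) / φ(x,y)`. -/
def INDR : Scheme := fun _ φ => ([φ.atZero.alls, (stepInd φ).alls], (φ.at1 vX).alls)

/-- `φ(0,y), φ(⌊x/2⌋,y) → φ(x,y) / φ(x,y)`. -/
def PINDR : Scheme := fun _ φ => ([φ.atZero.alls, (stepPind φ).alls], (φ.at1 vX).alls)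

/-- `φ(0,y), φ(x,y) → φ(x+1,y) / φ(|x|,y)`. -/
def LINDR : Scheme := fun _ φ =>
  ([φ.atZero.alls, (stepInd φ).alls], (φ.at1 (tLen vX)).alls)

/-- `φ(x,y) → φ(x+1,y) / φ(0,y) → φ(x,y)`. -/
def IND0R : Scheme := fun _ φ => ([(stepInd φ).alls], (φ.at1 0 ⟹ φ.at1 vX).alls)

/-- `φ(⌊x/2⌋,y) → φ(x,y) / φ(0,y) → φ(x,y)`. -/
def PIND0R : Scheme := fun _ φ => ([(stepPind φ).alls], (φ.at1 0 ⟹ φ.at1 vX).alls)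

/-- `φ(x,y) → φ(x+1,y) / φ(0,y) → φ(|x|,y)`. -/
def LIND0R : Scheme := fun _ φ => ([(stepInd φ).alls], (φ.at1 0 ⟹ φ.at1 (tLen vX)).alls)

/-- `∀x'<x φ(x',y) → φ(x,y) / φ(x,y)`. -/
def INDltR : Scheme := fun _ φ => ([(stepLt φ).alls], (φ.at1 vX).alls)

/-- `∀x'<x φ(x',y) → φ(x,y) / φ(|x|,y)`. -/
def LINDltR : Scheme := fun _ φ => ([(stepLt φ).alls], (φ.at1 (tLen vX)).alls)

/-- `∀x' (|x'|<|x| → φ(x',y)) → φ(x,y) / φ(x,y)`. -/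
def PINDltR : Scheme := fun _ φ => ([(stepLenLt φ).alls], (φ.at1 vX).alls)

/-- `∀u≤|x| (u>0 → φ(⌊x/2^u⌋,y)) → φ(x,y) / φ(x,y)`. -/
def PINDresR : Scheme := fun _ φ => ([(stepRes φ).alls], (φ.at1 vX).alls)

/-- `∃x φ(x,y) / ∃x (φ(x,y) ∧ ∀x'<x ¬φ(x',y))`. -/
def MINR : Scheme := fun _ φ => ([(∃' φ.at1 vX).alls], (∃' isMin φ).alls)

/-- `∃x φ(x,y) / ∃x (φ(x,y) ∧ ∀x' (|x'|<|x| → ¬φ(x',y)))`. -/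
def LMINR : Scheme := fun _ φ => ([(∃' φ.at1 vX).alls], (∃' isLenMin φ).alls)

end BoundedArithmetic

namespace BoundedArithmetic

/-! ### Evaluation of function symbols -/

/-! All reductions are proved in models. By `reducible_of`, a rule R reduces to S as soon as each
formula φ allowed in R is matched with a formula ψ allowed in S such that, over the base theory, the
premises for φ imply those for ψ, and, given the premises for φ, the conclusion for ψ implies the
conclusion for φ. `Reduces` and `StrictlyReduces` state such a match separately for each tuple of
parameters, so that one match serves the axiom scheme and the rule alike, and the parameter-free
versions as well when no parameter is added.

Matching formulas requires closure properties of the strict classes. They are replaced by `Sem`: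
predicates uniform in all models, with one function symbol as matrix and one quantifier per block.
`IsStrict.sem` and `Sem.exists_isStrict` translate back and forth. Search makes sharply bounded
formulas open (`Sem.sharp_ball`), and like quantifiers merge by pairing (`Sem.exists_exists`), which
needs open induction, an ordered semiring, powers of two with small exponents, and length bounds for
all function symbols (`TCFun.exists_lenBound`).

The matches themselves are as follows. Length and polynomial induction are exchanged by φ(|x|) and
φ(⌊z/2^(|z|-x)⌋). Order induction for Π becomes ordinary induction for ∀u≤x φ(u), or for |u|≤|x| in
the polynomial case. Conversely, if φ(x) is ∀u≤t(x) θ(x,u), order induction is applied to "if w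
codes (x,u) then θ(x,u)", with codes that increase with x (`hypLt_pairCode`, `hypLenLt_pairCode`): a
quantifier is saved. Restricted induction uses the statement that φ holds at all initial segments of
x. For Σ one number collects the witnesses in blocks (`hypPind_collected`). A parameter and the
induction variable are coded in one number whose final digits are the induction variable, so that
adding 1 or halving changes only the latter, or else the base case applies (`hypInd_code`,
`hypPind_code`). A base case φ(0) in the conclusion is made a premise by taking its witness z as a
parameter and inducting on R(z)→φ(x). Running the induction backwards exchanges Σ and Π
(`ind0_dual`, `pind0_dual`). Without parameters φ(0) is a bounded sentence, hence true in all models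
or in none (`Sem.absolute`), and the two cases are treated separately. Minimization is the
contrapositive of order induction. The rule recovers the scheme via φ(x) ∨ x=z, which has a solution
outright. -/

/-- The value of a function symbol in a structure. -/
def TCFun.ev {M : Type} [LTC.Structure M] {n : ℕ} (f : TCFun n) (v : Fin n → M) : M :=
  Structure.funMap (L := LTC) f v

section Realize

variable {M : Type} [LTC.Structure M]

theorem realize_app {α : Type} {k : ℕ} (f : TCFun k) (ts : Fin k → LTC.Term α) (v : α → M) :
    (app f ts).realize v = f.ev fun i => (ts i).realize v := rfl

theorem vec_one {X : Type} (f : Fin 1 → X) : f = ![f 0] := by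
  funext i; fin_cases i; rfl

theorem vec_two {X : Type} (f : Fin 2 → X) : f = ![f 0, f 1] := by
  funext i; fin_cases i <;> rfl

/-- The interpretation of `x ≤ y`. -/
def tcRel (v : Fin 2 → M) : Prop := Structure.RelMap (L := LTC) (n := 2) TCRel.le v

/-- The order on a structure. -/
def tcLe (a b : M) : Prop := tcRel ![a, b]

theorem realize_fLe {α : Type} {n : ℕ} (s t : LTC.Term (α ⊕ Fin n)) (v : α → M) (xs : Fin n → M) :
    (fLe s t).Realize v xs ↔
      tcLe (s.realize (Sum.elim v xs)) (t.realize (Sum.elim v xs)) := by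
  change tcRel (fun i => Term.realize (Sum.elim v xs) (![s, t] i)) ↔ _
  rw [vec_two fun i => Term.realize (Sum.elim v xs) (![s, t] i)]
  rfl

theorem ev_app_one {α : Type} (f : TCFun 1) (t : LTC.Term α) (v : α → M) :
    (app f ![t]).realize v = f.ev ![t.realize v] := by
  rw [realize_app, vec_one fun i => Term.realize v (![t] i)]; rfl

theorem ev_app_two {α : Type} (f : TCFun 2) (s t : LTC.Term α) (v : α → M) :
    (app f ![s, t]).realize v = f.ev ![s.realize v, t.realize v] := by
  rw [realize_app, vec_two fun i => Term.realize v (![s, t] i)]; rfl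

end Realize

/-! ### Ordered semiring structure of models -/

/-- A model of the base theory. -/
class TCModel (M : Type) extends LTC.Structure M where
  models : M ⊨ BTC

section Ops

variable {M : Type} [TCModel M]

instance : Zero M := ⟨TCFun.zero.ev ![]⟩
instance : One M := ⟨TCFun.succ.ev ![(0 : M)]⟩
instance : Add M := ⟨fun a b => TCFun.add.ev ![a, b]⟩
instance : Mul M := ⟨fun a b => TCFun.mul.ev ![a, b]⟩
instance : Sub M := ⟨fun a b => TCFun.sub.ev ![a, b]⟩
instance : LE M := ⟨tcLe⟩

def half (a : M) : M := TCFun.half.ev ![a]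
def len (a : M) : M := TCFun.len.ev ![a]
def smash (a b : M) : M := TCFun.smash.ev ![a, b]
def msp (a b : M) : M := TCFun.msp.ev ![a, b]
def succ (a : M) : M := TCFun.succ.ev ![a]

variable {α : Type} (s t : LTC.Term α) (v : α → M)

theorem realize_tZero : (0 : LTC.Term α).realize v = (0 : M) := by
  change (app .zero ![]).realize v = _
  rw [realize_app]
  exact congrArg _ (Subsingleton.elim _ _)

theorem realize_tSucc : (tSucc t).realize v = succ (t.realize v) := ev_app_one ..
theorem realize_tOne : (1 : LTC.Term α).realize v = (1 : M) := by
  change (tSucc 0).realize v = _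
  rw [realize_tSucc, realize_tZero]; rfl
theorem realize_tHalf : (tHalf t).realize v = half (t.realize v) := ev_app_one ..
theorem realize_tLen : (tLen t).realize v = len (t.realize v) := ev_app_one ..
theorem realize_tSmash : (tSmash s t).realize v = smash (s.realize v) (t.realize v) :=
  ev_app_two ..
theorem realize_tMsp : (tMsp s t).realize v = msp (s.realize v) (t.realize v) :=
  ev_app_two ..
theorem realize_tAdd : (s + t).realize v = s.realize v + t.realize v := ev_app_two ..
theorem realize_tMul : (s * t).realize v = s.realize v * t.realize v := ev_app_two ..
theorem realize_tSub : (s - t).realize v = s.realize v - t.realize v := ev_app_two ..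
theorem realize_tDouble : (tDouble t).realize v = succ (succ 0) * t.realize v := by
  rw [tDouble, realize_tMul, realize_tSucc, realize_tSucc, realize_tZero]

theorem realize_fLe' {n : ℕ} (s t : LTC.Term (α ⊕ Fin n)) (v : α → M) (xs : Fin n → M) :
    (fLe s t).Realize v xs ↔
      s.realize (Sum.elim v xs) ≤ t.realize (Sum.elim v xs) := realize_fLe ..

theorem models_alls {n : ℕ} {φ : Fm n} (h : φ.alls ∈ BTC) (xs : Fin n → M) :
    φ.Realize default xs := by
  have := TCModel.models (M := M)
  exact BoundedFormula.realize_alls.1 (Theory.realize_sentence_of_mem (M := M) BTC h) xs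

theorem basic_ax {φ : Fm 3} (h : φ ∈ basicAxioms) (x y z : M) :
    φ.Realize default ![x, y, z] := models_alls (Or.inl ⟨φ, h, rfl⟩) _

theorem basic_ax' {φ : Fm 3} (h : φ ∈ basicAxioms') (x y z : M) :
    φ.Realize default ![x, y, z] := models_alls (Or.inr (Or.inr (Or.inl ⟨φ, h, rfl⟩))) _

theorem subMsp_ax {φ : Fm 2} (h : φ ∈ subMspAxioms) (x y : M) :
    φ.Realize default ![x, y] := models_alls (Or.inr (Or.inr (Or.inr (Or.inl ⟨φ, h, rfl⟩)))) _

end Ops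

/-! ### The axioms of the base theory, read in a model -/

section Axioms

variable {M : Type} [TCModel M]

theorem basicAxioms_realize (x y z : M) :
    (y ≤ x → y ≤ succ x) ∧ (x ≠ succ x) ∧ (0 ≤ x) ∧ ((x ≤ y ∧ x ≠ y) ↔ succ x ≤ y) ∧
    (x ≠ 0 → succ (succ 0) * x ≠ 0) ∧ (y ≤ x ∨ x ≤ y) ∧ (x ≤ y ∧ y ≤ x → x = y) ∧
    (x ≤ y ∧ y ≤ z → x ≤ z) ∧ (len 0 = (0 : M)) ∧
    (x ≠ 0 → len (succ (succ 0) * x) = succ (len x) ∧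
      len (succ (succ (succ 0) * x)) = succ (len x)) ∧
    (len 1 = (1 : M)) ∧ (x ≤ y → len x ≤ len y) ∧
    (len (smash x y) = succ (len x * len y)) ∧ (smash 0 y = 1) ∧
    (x ≠ 0 → smash 1 (succ (succ 0) * x) = succ (succ 0) * smash 1 x ∧
      smash 1 (succ (succ (succ 0) * x)) = succ (succ 0) * smash 1 x) ∧
    (smash x y = smash y x) ∧ (len x = len y → smash x z = smash y z) := by
  have key := fun (φ : Fm 3) (h : φ ∈ basicAxioms) => basic_ax h x y z
  simpa [basicAxioms, realize_fLe', realize_tSucc, realize_tZero, realize_tOne, realize_tDouble,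
    realize_tLen, realize_tSmash, realize_tMul, Term.realize, BoundedFormula.realize_iff] using key

theorem basicAxioms'_realize (x y z : M) :
    (x ≤ x + y) ∧
    (x ≤ y ∧ x ≠ y → succ (succ (succ 0) * x) ≤ succ (succ 0) * y ∧
      succ (succ (succ 0) * x) ≠ succ (succ 0) * y) ∧
    (x + y = y + x) ∧ (x + 0 = x) ∧ (x + succ y = succ (x + y)) ∧
    (x + y + z = x + (y + z)) ∧ (x + y ≤ x + z ↔ y ≤ z) ∧ (x * 0 = 0) ∧
    (x * succ y = x * y + x) ∧ (x * y = y * x) ∧ (x * (y + z) = x * y + x * z) ∧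
    (1 ≤ x → (x * y ≤ x * z ↔ y ≤ z)) ∧ (x ≠ 0 → len x = succ (len (half x))) ∧
    (x = half y ↔ (succ (succ 0) * x = y ∨ succ (succ (succ 0) * x) = y)) := by
  have key := fun (φ : Fm 3) (h : φ ∈ basicAxioms') => basic_ax' h x y z
  simpa [basicAxioms', realize_fLe', realize_tSucc, realize_tZero, realize_tOne, realize_tDouble,
    realize_tLen, realize_tHalf, realize_tMul, realize_tAdd, Term.realize,
    BoundedFormula.realize_iff] using key

theorem smash_mul_of_len {x u v : M} (y : M) (h : len x = len u + len v) :
    smash x y = smash u y * smash v y := by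
  have key := models_alls (M := M) (φ := basicSmashMul) (Or.inr (Or.inl rfl)) ![x, u, v, y]
  have : len x = len u + len v → smash x y = smash u y * smash v y := by
    simpa [basicSmashMul, realize_tLen, realize_tSmash, realize_tAdd, realize_tMul,
      Term.realize] using key
  exact this h

theorem subMspAxioms_realize (x y : M) :
    (x ≤ y → x - y = 0) ∧ (y ≤ x → x - y + y = x) ∧ (msp x 0 = x) ∧
    (msp x (succ y) = half (msp x y)) ∧ (len (msp x y) = len x - y) := by
  have key := fun (φ : Fm 2) (h : φ ∈ subMspAxioms) => subMsp_ax h x y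
  simpa [subMspAxioms, realize_fLe', realize_tSucc, realize_tZero, realize_tLen, realize_tHalf,
    realize_tAdd, realize_tSub, realize_tMsp, Term.realize] using key

theorem ev_proj {n : ℕ} (i : Fin n) (v : Fin n → M) : (TCFun.proj i).ev v = v i := by
  have key := models_alls (M := M) (φ := (app (.proj i) (fun j => (&j : Tm n)) =' &i))
    (Or.inr (Or.inr (Or.inr (Or.inr (Or.inl ⟨n, i, rfl⟩))))) v
  simpa [realize_app, Term.realize] using key

theorem ev_comp {n k : ℕ} (f : TCFun k) (g : Fin k → TCFun n) (v : Fin n → M) :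
    (TCFun.comp f g).ev v = f.ev fun i => (g i).ev v := by
  have key := models_alls (M := M)
    (φ := (app (.comp f g) (fun j => (&j : Tm n)) =' app f (fun i => app (g i) (fun j => &j))))
    (Or.inr (Or.inr (Or.inr (Or.inr (Or.inr (Or.inl ⟨n, k, f, g, rfl⟩)))))) v
  simpa [realize_app, Term.realize] using key

/-- Reconciles two orders of variables: the axioms for `bits` and `search` quantify over x, a, u in
this order, while the function symbols take a or u as first argument. -/
theorem realize_cons_vars {n : ℕ} (a : M) (x : Fin n → M) (u : M) (t : Tm (n + 2)) :
    (fun j => Term.realize (Sum.elim default (Fin.snoc (Fin.snoc x a) u : Fin (n + 2) → M))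
      ((Fin.cons t (fun j : Fin n => (Term.var (Sum.inr (j.castAdd 2)) : Tm (n + 2))) :
        Fin (n + 1) → Tm (n + 2)) j)) =
      (Fin.cons (t.realize (Sum.elim default (Fin.snoc (Fin.snoc x a) u : Fin (n + 2) → M))) x :
        Fin (n + 1) → M) := by
  funext j
  refine Fin.cases ?_ (fun j => ?_) j
  · rfl
  · change (Fin.snoc (Fin.snoc x a) u : Fin (n + 2) → M) (j.castAdd 2) = _
    have : (j.castAdd 2 : Fin (n + 2)) = j.castSucc.castSucc := rfl
    rw [this, Fin.snoc_castSucc, Fin.snoc_castSucc, Fin.cons_succ]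

theorem ev_bits {n : ℕ} (h : TCFun (n + 1)) (a : M) (x : Fin n → M) :
    len ((TCFun.bits h).ev (Fin.cons a x)) ≤ len a ∧ ∀ u, ¬ len a ≤ u →
      ((msp ((TCFun.bits h).ev (Fin.cons a x)) u =
        succ (succ (succ 0) * half (msp ((TCFun.bits h).ev (Fin.cons a x)) u))) ↔
        h.ev (Fin.cons u x) ≠ 0) := by
  have h1 := realize_cons_vars a x
  have key := fun u => models_alls (M := M) (φ := _)
    (Or.inr (Or.inr (Or.inr (Or.inr (Or.inr (Or.inr (Or.inl ⟨n, h, rfl⟩)))))))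
    (Fin.snoc (Fin.snoc x a) u)
  simp [realize_app, realize_fLe', fLt, fBit, h1, realize_tLen, realize_tMsp, realize_tHalf,
    realize_tSucc, realize_tDouble, realize_tZero,
    BoundedFormula.realize_iff] at key
  exact ⟨(key 0).1, fun u hu => (key u).2 hu⟩

theorem ev_search {n : ℕ} (h : TCFun (n + 1)) (a : M) (x : Fin n → M) :
    (TCFun.search h).ev (Fin.cons a x) ≤ len a ∧
    (¬ len a ≤ (TCFun.search h).ev (Fin.cons a x) →
      h.ev (Fin.cons ((TCFun.search h).ev (Fin.cons a x)) x) ≠ 0) ∧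
    ∀ u, ¬ (TCFun.search h).ev (Fin.cons a x) ≤ u → h.ev (Fin.cons u x) = 0 := by
  have h1 := realize_cons_vars a x
  have key := fun u => models_alls (M := M) (φ := _)
    (Or.inr (Or.inr (Or.inr (Or.inr (Or.inr (Or.inr (Or.inr ⟨n, h, rfl⟩)))))))
    (Fin.snoc (Fin.snoc x a) u)
  simp [realize_app, realize_fLe', fLt, h1, realize_tLen, realize_tZero] at key
  exact ⟨(key 0).1, (key 0).2.1, fun u hu => (key u).2.2 hu⟩

end Axioms

/-! ### Ordered semiring laws; lengths, halves and quotients -/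

section Algebra

variable {M : Type} [TCModel M]

theorem succ_eq (a : M) : succ a = a + 1 := by
  have h := (basicAxioms'_realize a 0 0).2.2.2.2.1
  rw [(basicAxioms'_realize a 0 0).2.2.2.1] at h
  exact h.symm

theorem le_total' (a b : M) : a ≤ b ∨ b ≤ a := (basicAxioms_realize b a 0).2.2.2.2.2.1

noncomputable instance : LinearOrder M where
  le_refl a := (le_total' a a).elim id id
  le_trans a b c h h' := (basicAxioms_realize a b c).2.2.2.2.2.2.2.1 ⟨h, h'⟩
  le_antisymm a b h h' := (basicAxioms_realize a b 0).2.2.2.2.2.2.1 ⟨h, h'⟩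
  le_total := le_total'
  toDecidableLE := Classical.decRel _

theorem add_comm' (a b : M) : a + b = b + a := (basicAxioms'_realize a b 0).2.2.1
theorem mul_comm' (a b : M) : a * b = b * a := (basicAxioms'_realize a b 0).2.2.2.2.2.2.2.2.2.1
theorem add_zero' (a : M) : a + 0 = a := (basicAxioms'_realize a 0 0).2.2.2.1
theorem mul_zero' (a : M) : a * 0 = 0 := (basicAxioms'_realize a 0 0).2.2.2.2.2.2.2.1
theorem mul_add' (a b c : M) : a * (b + c) = a * b + a * c :=
  (basicAxioms'_realize a b c).2.2.2.2.2.2.2.2.2.2.1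
theorem mul_one' (a : M) : a * 1 = a := by
  have h := (basicAxioms'_realize a 0 0).2.2.2.2.2.2.2.2.1
  rw [mul_zero', add_comm', add_zero'] at h
  exact h

/-- Associativity of multiplication is not among the axioms. It has to wait for open induction, see
`mul_assoc'`. -/
instance : NonAssocSemiring M where
  add_assoc a b c := (basicAxioms'_realize a b c).2.2.2.2.2.1
  zero_add a := by rw [add_comm', add_zero']
  add_zero := add_zero'
  add_comm := add_comm'
  nsmul := nsmulRec
  left_distrib := mul_add'
  right_distrib a b c := by simp only [mul_comm' _ c, mul_add']
  zero_mul a := by rw [mul_comm', mul_zero']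
  mul_zero := mul_zero'
  one_mul a := by rw [mul_comm', mul_one']
  mul_one := mul_one'

theorem two_eq : succ (succ 0) = (2 : M) := by
  rw [succ_eq, succ_eq, zero_add, one_add_one_eq_two]

instance : IsOrderedCancelAddMonoid M where
  add_le_add_left a b h c := by
    simp only [add_comm _ c]; exact (basicAxioms'_realize c a b).2.2.2.2.2.2.1.2 h
  le_of_add_le_add_left a b c h := (basicAxioms'_realize a b c).2.2.2.2.2.2.1.1 h

theorem sub_add_self' {a b : M} (h : b ≤ a) : a - b + b = a := (subMspAxioms_realize a b).2.1 h
theorem sub_eq_zero' {a b : M} (h : a ≤ b) : a - b = 0 := (subMspAxioms_realize a b).1 h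

instance : CanonicallyOrderedAdd M where
  exists_add_of_le {a b} h := ⟨b - a, by rw [add_comm, sub_add_self' h]⟩
  le_self_add a b := (basicAxioms'_realize a b 0).1
  le_add_self a b := by rw [add_comm]; exact (basicAxioms'_realize a b 0).1

instance : OrderedSub M where
  tsub_le_iff_right a b c := by
    rcases le_total a b with h | h
    · rw [sub_eq_zero' h]
      exact ⟨fun _ => h.trans (le_add_self), fun _ => zero_le⟩
    · conv_rhs => rw [← sub_add_self' h]
      rw [add_le_add_iff_right]

theorem add_one_le_iff' {a b : M} : a + 1 ≤ b ↔ a < b := by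
  rw [← succ_eq, ← (basicAxioms_realize a b 0).2.2.2.1, lt_iff_le_and_ne]

theorem zero_ne_one' : (0 : M) ≠ 1 := by
  have := (basicAxioms_realize (0 : M) 0 0).2.1
  rwa [succ_eq, zero_add] at this

instance : Nontrivial M := ⟨0, 1, zero_ne_one'⟩

theorem lt_add_one_iff' {a b : M} : a < b + 1 ↔ a ≤ b := by
  rw [← add_one_le_iff', add_le_add_iff_right]

theorem pos_iff_one_le {a : M} : 0 < a ↔ 1 ≤ a := by rw [← add_one_le_iff', zero_add]

theorem eq_zero_or_succ (a : M) : a = 0 ∨ ∃ b, a = b + 1 := by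
  rcases eq_or_ne a 0 with h | h
  · exact Or.inl h
  · exact Or.inr ⟨a - 1, (tsub_add_cancel_of_le (pos_iff_one_le.1 (pos_iff_ne_zero.2 h))).symm⟩

theorem mul_le_mul_left_iff' {a b c : M} (h : 1 ≤ a) : a * b ≤ a * c ↔ b ≤ c :=
  (basicAxioms'_realize a b c).2.2.2.2.2.2.2.2.2.2.2.1 h

theorem mul_eq_zero_iff' {a b : M} : a * b = 0 ↔ a = 0 ∨ b = 0 := by
  constructor
  · intro h
    rcases eq_or_ne a 0 with ha | ha
    · exact Or.inl ha
    · refine Or.inr (nonpos_iff_eq_zero.1 ((mul_le_mul_left_iff' (pos_iff_one_le.1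
        (pos_iff_ne_zero.2 ha))).1 ?_))
      rw [h, mul_zero]
  · rintro (h | h) <;> simp [h]

theorem len_zero : len (0 : M) = 0 := (basicAxioms_realize (0 : M) 0 0).2.2.2.2.2.2.2.2.1
theorem len_one : len (1 : M) = 1 := (basicAxioms_realize (0 : M) 0 0).2.2.2.2.2.2.2.2.2.2.1
theorem len_mono {a b : M} (h : a ≤ b) : len a ≤ len b :=
  (basicAxioms_realize a b 0).2.2.2.2.2.2.2.2.2.2.2.1 h
theorem len_two_mul {a : M} (h : a ≠ 0) : len (2 * a) = len a + 1 := by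
  have := ((basicAxioms_realize a 0 0).2.2.2.2.2.2.2.2.2.1 h).1
  rwa [two_eq, succ_eq] at this
theorem len_two_mul_add_one (a : M) : len (2 * a + 1) = len a + 1 := by
  rcases eq_or_ne a 0 with rfl | h
  · rw [mul_zero, zero_add, len_one, len_zero, zero_add]
  · have := ((basicAxioms_realize a 0 0).2.2.2.2.2.2.2.2.2.1 h).2
    rwa [two_eq, succ_eq, succ_eq] at this
theorem len_smash (a b : M) : len (smash a b) = len a * len b + 1 := by
  rw [← succ_eq]; exact (basicAxioms_realize a b 0).2.2.2.2.2.2.2.2.2.2.2.2.1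
theorem smash_comm (a b : M) : smash a b = smash b a :=
  (basicAxioms_realize a b 0).2.2.2.2.2.2.2.2.2.2.2.2.2.2.2.1
theorem smash_congr {a b : M} (h : len a = len b) (c : M) : smash a c = smash b c :=
  (basicAxioms_realize a b c).2.2.2.2.2.2.2.2.2.2.2.2.2.2.2.2 h
theorem zero_smash (a : M) : smash 0 a = 1 :=
  (basicAxioms_realize 0 a 0).2.2.2.2.2.2.2.2.2.2.2.2.2.1
theorem smash_one_two_mul {a : M} (h : a ≠ 0) : smash 1 (2 * a) = 2 * smash 1 a := by
  have := ((basicAxioms_realize a 0 0).2.2.2.2.2.2.2.2.2.2.2.2.2.2.1 h).1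
  rwa [two_eq] at this
theorem smash_one_two_mul_add_one {a : M} (h : a ≠ 0) :
    smash 1 (2 * a + 1) = 2 * smash 1 a := by
  have := ((basicAxioms_realize a 0 0).2.2.2.2.2.2.2.2.2.2.2.2.2.2.1 h).2
  rwa [two_eq, succ_eq] at this
theorem len_half {a : M} (h : a ≠ 0) : len a = len (half a) + 1 := by
  rw [← succ_eq]; exact (basicAxioms'_realize a 0 0).2.2.2.2.2.2.2.2.2.2.2.2.1 h
theorem eq_half_iff {a b : M} : a = half b ↔ 2 * a = b ∨ 2 * a + 1 = b := by
  have := (basicAxioms'_realize a b 0).2.2.2.2.2.2.2.2.2.2.2.2.2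
  rwa [two_eq, succ_eq] at this
theorem half_spec (a : M) : a = 2 * half a ∨ a = 2 * half a + 1 := by
  rcases eq_half_iff.1 (rfl : half a = half a) with h | h
  · exact Or.inl h.symm
  · exact Or.inr h.symm
theorem half_two_mul (a : M) : half (2 * a) = a := (eq_half_iff.2 (Or.inl rfl)).symm
theorem half_two_mul_add_one (a : M) : half (2 * a + 1) = a := (eq_half_iff.2 (Or.inr rfl)).symm
theorem half_zero : half (0 : M) = 0 := (eq_half_iff.2 (Or.inl (mul_zero 2))).symm
theorem msp_zero (a : M) : msp a 0 = a := (subMspAxioms_realize a 0).2.2.1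
theorem msp_add_one (a b : M) : msp a (b + 1) = half (msp a b) := by
  rw [← succ_eq]; exact (subMspAxioms_realize a b).2.2.2.1
theorem len_msp (a b : M) : len (msp a b) = len a - b := (subMspAxioms_realize a b).2.2.2.2
theorem len_eq_zero {a : M} : len a = 0 ↔ a = 0 := by
  refine ⟨fun h => by_contra fun ha => ?_, fun h => by rw [h, len_zero]⟩
  rw [len_half ha] at h
  simp at h
theorem msp_len (a : M) : msp a (len a) = 0 := by
  rw [← len_eq_zero, len_msp, tsub_self]

end Algebra

/-! ### Function symbols as an algebra -/

namespace TCFun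

variable {n : ℕ}

instance : Zero (TCFun n) := ⟨.comp .zero Fin.elim0⟩
instance : One (TCFun n) := ⟨.comp .succ ![0]⟩
instance : Add (TCFun n) := ⟨fun f g => .comp .add ![f, g]⟩
instance : Mul (TCFun n) := ⟨fun f g => .comp .mul ![f, g]⟩
instance : Sub (TCFun n) := ⟨fun f g => .comp .sub ![f, g]⟩

def half' (f : TCFun n) : TCFun n := .comp .half ![f]
def len' (f : TCFun n) : TCFun n := .comp .len ![f]
def smash' (f g : TCFun n) : TCFun n := .comp .smash ![f, g]
def msp' (f g : TCFun n) : TCFun n := .comp .msp ![f, g]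

/-- The truth value of `¬ f`; a function is true where it does not vanish. -/
def not' (f : TCFun n) : TCFun n := 1 - f
/-- The truth value of `f ≤ g`. -/
def le' (f g : TCFun n) : TCFun n := (g + 1) - f
/-- The truth value of `f = g`. -/
def eq' (f g : TCFun n) : TCFun n := le' f g * le' g f
/-- The truth value of `f < g`. -/
def lt' (f g : TCFun n) : TCFun n := g - f

variable {M : Type} [TCModel M] (f g : TCFun n) (v : Fin n → M)

@[simp] theorem ev_proj' (i : Fin n) : (TCFun.proj i).ev v = v i := ev_proj i v

@[simp] theorem ev_comp' {k : ℕ} (f : TCFun k) (g : Fin k → TCFun n) :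
    (TCFun.comp f g).ev v = f.ev fun i => (g i).ev v := ev_comp f g v

theorem ev_comp_one (f : TCFun 1) (g : TCFun n) :
    (TCFun.comp f ![g]).ev v = f.ev ![g.ev v] := by
  rw [ev_comp, vec_one fun i => ev (![g] i) v]; rfl

theorem ev_comp_two (f : TCFun 2) (g h : TCFun n) :
    (TCFun.comp f ![g, h]).ev v = f.ev ![g.ev v, h.ev v] := by
  rw [ev_comp, vec_two fun i => ev (![g, h] i) v]; rfl

@[simp] theorem ev_zero : (0 : TCFun n).ev v = 0 := by
  change (TCFun.comp .zero Fin.elim0).ev v = _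
  rw [ev_comp]; exact congrArg _ (Subsingleton.elim _ _)
@[simp] theorem ev_one : (1 : TCFun n).ev v = 1 := by
  change (TCFun.comp .succ ![0]).ev v = _
  rw [ev_comp_one, ev_zero]; rfl
@[simp] theorem ev_add : (f + g).ev v = f.ev v + g.ev v := ev_comp_two v .add f g
@[simp] theorem ev_mul : (f * g).ev v = f.ev v * g.ev v := ev_comp_two v .mul f g
@[simp] theorem ev_sub : (f - g).ev v = f.ev v - g.ev v := ev_comp_two v .sub f g
@[simp] theorem ev_half' : (half' f).ev v = BoundedArithmetic.half (f.ev v) := ev_comp_one v .half f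
@[simp] theorem ev_len' : (len' f).ev v = BoundedArithmetic.len (f.ev v) := ev_comp_one v .len f
@[simp] theorem ev_smash' : (smash' f g).ev v = BoundedArithmetic.smash (f.ev v) (g.ev v) :=
  ev_comp_two v .smash f g
@[simp] theorem ev_msp' : (msp' f g).ev v =
    BoundedArithmetic.msp (f.ev v) (g.ev v) := ev_comp_two v .msp f g

/-- `f` is true at `v`. -/
def Holds : Prop := f.ev v ≠ 0

@[simp] theorem holds_not' : (not' f).Holds v ↔ ¬ f.Holds v := by
  simp only [Holds, not', ev_sub, ev_one, ne_eq, tsub_eq_zero_iff_le, not_not,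
    ← pos_iff_one_le, not_lt, nonpos_iff_eq_zero]
@[simp] theorem holds_mul : (f * g).Holds v ↔ f.Holds v ∧ g.Holds v := by
  simp only [Holds, ev_mul, ne_eq, mul_eq_zero_iff', not_or]
@[simp] theorem holds_add : (f + g).Holds v ↔ f.Holds v ∨ g.Holds v := by
  simp only [Holds, ev_add, ne_eq, add_eq_zero, not_and_or]
@[simp] theorem holds_le' : (le' f g).Holds v ↔ f.ev v ≤ g.ev v := by
  simp only [Holds, le', ev_sub, ev_add, ev_one, ne_eq, tsub_eq_zero_iff_le, not_le,
    lt_add_one_iff']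
@[simp] theorem holds_lt' : (lt' f g).Holds v ↔ f.ev v < g.ev v := by
  simp only [Holds, lt', ev_sub, ne_eq, tsub_eq_zero_iff_le, not_le]
@[simp] theorem holds_eq' : (eq' f g).Holds v ↔ f.ev v = g.ev v := by
  simp only [eq', holds_mul, holds_le', le_antisymm_iff]
@[simp] theorem holds_comp {k : ℕ} (f : TCFun k) (g : Fin k → TCFun n) :
    (TCFun.comp f g).Holds v ↔ f.Holds fun i => (g i).ev v := by
  simp only [Holds, ev_comp']

end TCFun

/-! ### Induction for open formulas, and associativity of multiplication -/

section OpenInduction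

variable {M : Type} [TCModel M]

/-- Length induction for open formulas. -/
theorem open_lind {n : ℕ} (h : TCFun (n + 1)) (x : Fin n → M) (a : M)
    (h0 : h.Holds (Fin.cons 0 x : Fin (n + 1) → M))
    (hs : ∀ u < len a, h.Holds (Fin.cons u x : Fin (n + 1) → M) →
      h.Holds (Fin.cons (u + 1) x : Fin (n + 1) → M)) :
    h.Holds (Fin.cons (len a) x : Fin (n + 1) → M) := by
  -- Let m be the first failure below |a|, if there is one. It can be neither 0 nor the successor of
  -- a point where the formula holds, so the search must have returned |a|.
  obtain ⟨h1, h2, h3⟩ := ev_search (TCFun.not' h) a x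
  set m := (TCFun.search (TCFun.not' h)).ev (Fin.cons a x) with hm
  have h3' : ∀ u < m, h.Holds (Fin.cons u x : Fin (n + 1) → M) := fun u hu => by
    have := mt (TCFun.holds_not' h (Fin.cons u x)).2 (not_not.2 (h3 u (not_le.2 hu)))
    exact not_not.1 this
  have key : m = len a ∨ ¬ h.Holds (Fin.cons m x : Fin (n + 1) → M) := by
    rcases h1.eq_or_lt with h | h
    · exact Or.inl h
    · exact Or.inr ((TCFun.holds_not' _ _).1 (h2 (not_le.2 h)))
  have hm : h.Holds (Fin.cons m x : Fin (n + 1) → M) := by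
    rcases eq_zero_or_succ m with h | ⟨b, hb⟩
    · rw [h]; exact h0
    · have hb' : b < m := by rw [hb, lt_add_one_iff']
      rw [hb]
      exact hs b (hb'.trans_le h1) (h3' b hb')
  rcases key with h | h
  · rwa [h] at hm
  · exact absurd hm h

/-- A predicate on a model defined by a function symbol with parameters. -/
def OpenDef (P : M → Prop) : Prop :=
  ∃ (n : ℕ) (h : TCFun (n + 1)) (x : Fin n → M), ∀ z, P z ↔ h.Holds (Fin.cons z x : Fin (n + 1) → M)

theorem OpenDef.lind {P : M → Prop} (hP : OpenDef P) (a : M) (h0 : P 0)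
    (hs : ∀ u < len a, P u → P (u + 1)) : P (len a) := by
  obtain ⟨n, h, x, hh⟩ := hP
  simp only [hh] at *
  exact open_lind h x a h0 hs

/-- Length induction on u along the initial segments of z: the segment with u digits is the half of
the one with u+1 digits. -/
theorem OpenDef.pind {P : M → Prop} (hP : OpenDef P) (h0 : P 0)
    (hs : ∀ z, P (half z) → P z) (z : M) : P z := by
  obtain ⟨n, h, x, hh⟩ := hP
  have key : OpenDef fun u => P (msp z (len z - u)) := by
    refine ⟨n + 1, .comp h (Fin.cons (.msp' (.proj 1) (.len' (.proj 1) - .proj 0))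
      fun j => .proj j.succ.succ), Fin.cons z x, fun u => ?_⟩
    beta_reduce
    rw [hh, TCFun.holds_comp]
    have : (Fin.cons (msp z (len z - u)) x : Fin (n + 1) → M) = fun i =>
        ((Fin.cons (.msp' (.proj 1) (.len' (.proj 1) - .proj 0)) fun j => .proj j.succ.succ :
          Fin (n + 1) → TCFun (n + 1 + 1)) i).ev (Fin.cons u (Fin.cons z x) : Fin (n + 2) → M) := by
      funext i
      refine Fin.cases ?_ (fun i => ?_) i
      · simp only [Fin.cons_zero, TCFun.ev_msp', TCFun.ev_sub, TCFun.ev_len', TCFun.ev_proj']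
        rfl
      · simp only [Fin.cons_succ, TCFun.ev_proj']
    rw [this]
  have := key.lind z (by rwa [tsub_zero, msp_len]) fun u hu hu' => by
    refine hs _ ?_
    rw [← msp_add_one]
    have : len z - u = len z - (u + 1) + 1 := by
      rw [← tsub_tsub, tsub_add_cancel_of_le]
      rw [← pos_iff_one_le]; exact tsub_pos_of_lt hu
    rwa [← this]
  simpa [msp_zero] using this

theorem two_mul' (a : M) : 2 * a = a + a := by rw [← one_add_one_eq_two, add_mul, one_mul]

/-- Induction on the binary digits of z needs distributivity only, because doubling is addition of a
number to itself. -/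
theorem mul_assoc' (x y z : M) : x * y * z = x * (y * z) := by
  refine OpenDef.pind (P := fun z => x * y * z = x * (y * z))
    ⟨2, .eq' (.proj 1 * .proj 2 * .proj 0) (.proj 1 * (.proj 2 * .proj 0)), ![x, y], fun z => ?_⟩
    (by simp) (fun z hz => ?_) z
  · rw [TCFun.holds_eq']
    simp only [TCFun.ev_mul, TCFun.ev_proj']
    rfl
  · have h2 : x * y * (2 * half z) = x * (y * (2 * half z)) := by
      rw [two_mul', mul_add, mul_add, mul_add, hz]
    rcases half_spec z with h | h <;> rw [h]
    · exact h2
    · rw [mul_add, mul_add, mul_add, h2]; simp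

instance : CommSemiring M where
  mul_assoc := mul_assoc'
  mul_comm := mul_comm'

instance : IsStrictOrderedRing M where
  mul_lt_mul_of_pos_left a ha b c h := by
    have h1 : (1 : M) ≤ a := pos_iff_one_le.1 ha
    exact not_le.1 fun h2 => not_le.2 h ((mul_le_mul_left_iff' h1).1 h2)
  mul_lt_mul_of_pos_right a ha b c h := by
    have h1 : (1 : M) ≤ a := pos_iff_one_le.1 ha
    rw [mul_comm' b, mul_comm' c]
    exact not_le.1 fun h2 => not_le.2 h ((mul_le_mul_left_iff' h1).1 h2)

end OpenInduction

section Arithmetic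

variable {M : Type} [TCModel M]

theorem lt_of_len_lt {a b : M} (h : len a < len b) : a < b :=
  not_le.1 fun h' => not_le.2 h (len_mono h')

/-! ### Powers of two -/

/-- The doubling axioms for 1 # x exclude x = 0 and so do not give the value at 1. It comes from
computing 2 # 1 in two ways, as (1 # 1)(1 # 1) and as 2(1 # 1), and cancelling. -/
theorem smash_one_one : smash 1 1 = (2 : M) := by
  have h2 : len (2 : M) = len 1 + len 1 := by
    conv_lhs => rw [← mul_one (2 : M)]
    rw [len_two_mul one_ne_zero, len_one]
  have h := smash_mul_of_len (1 : M) h2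
  have h3 := smash_one_two_mul (one_ne_zero (α := M))
  rw [mul_one, smash_comm, h] at h3
  refine mul_right_cancel₀ (fun h0 => ?_) h3
  have := len_smash (1 : M) 1
  rw [h0, len_zero] at this
  exact (this.trans_ne (by simp)) rfl

/-- `pw a` is `2 ^ |a|`. -/
def pw (a : M) : M := smash 1 a

theorem pw_congr {a b : M} (h : len a = len b) : pw a = pw b := by
  rw [pw, pw, smash_comm, smash_congr h, smash_comm]

theorem pw_zero : pw (0 : M) = 1 := by rw [pw, smash_comm, zero_smash]

theorem pw_half {a : M} (h : a ≠ 0) : pw a = 2 * pw (half a) := by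
  have key : ∀ b : M, pw (2 * b + 1) = 2 * pw b := fun b => by
    rcases eq_or_ne b 0 with rfl | hb
    · rw [mul_zero, zero_add, pw, smash_one_one, pw_zero, mul_one]
    · exact smash_one_two_mul_add_one hb
  rcases half_spec a with h' | h'
  · have h0 : half a ≠ 0 := by rintro h0; rw [h0, mul_zero] at h'; exact h h'
    conv_lhs => rw [h']
    exact smash_one_two_mul h0
  · conv_lhs => rw [h']
    exact key _

theorem len_pw (a : M) : len (pw a) = len a + 1 := by
  rw [pw, len_smash, len_one, one_mul]

theorem pw_add {a b c : M} (h : len a = len b + len c) : pw a = pw b * pw c := by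
  have := smash_mul_of_len (1 : M) h
  rwa [smash_comm, smash_comm b, smash_comm c] at this

theorem le_two_mul_half_add_one (a : M) : a ≤ 2 * half a + 1 := by
  rcases half_spec a with h | h
  · exact h.le.trans le_self_add
  · exact h.le

theorem two_mul_half_le (a : M) : 2 * half a ≤ a := by
  rcases half_spec a with h | h
  · exact h.ge
  · exact le_self_add.trans h.ge

theorem pw_le {a : M} (ha : a ≠ 0) : pw a ≤ 2 * a := by
  -- The disjunct z = 0 is needed for the base case, since `pw 0` is 1.
  have := OpenDef.pind (P := fun z : M => z = 0 ∨ pw z ≤ 2 * z)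
    ⟨0, .eq' (.proj 0) 0 + .le' (.smash' 1 (.proj 0)) ((1 + 1) * .proj 0), Fin.elim0,
      fun z => ?_⟩ (Or.inl rfl) (fun z hz => ?_) a
  · exact this.resolve_left ha
  · simp only [TCFun.holds_add, TCFun.holds_eq', TCFun.holds_le', TCFun.ev_proj',
      TCFun.ev_smash', TCFun.ev_one, TCFun.ev_mul, TCFun.ev_add, TCFun.ev_zero,
      one_add_one_eq_two]
    rfl
  · rcases eq_or_ne z 0 with h | h
    · exact Or.inl h
    · right
      rw [pw_half h]
      rcases hz with hz | hz
      · rw [hz, pw_zero]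
        have : (1 : M) ≤ z := pos_iff_one_le.1 (pos_iff_ne_zero.2 h)
        gcongr
      · have := two_mul_half_le z
        exact mul_le_mul_of_nonneg_left (hz.trans this) zero_le

/-- `n` is bounded by a length. -/
def IsLog (n : M) : Prop := ∃ a : M, n ≤ len a

theorem IsLog.exists_len {n : M} (h : IsLog n) : ∃ a : M, len a = n := by
  obtain ⟨a, ha⟩ := h
  exact ⟨msp a (len a - n), by rw [len_msp, tsub_tsub_cancel_of_le ha]⟩

theorem isLog_len (a : M) : IsLog (len a) := ⟨a, le_rfl⟩
theorem IsLog.mono {m n : M} (h : IsLog n) (hmn : m ≤ n) : IsLog m :=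
  let ⟨a, ha⟩ := h; ⟨a, hmn.trans ha⟩
theorem IsLog.mul {m n : M} (hm : IsLog m) (hn : IsLog n) : IsLog (m * n) := by
  obtain ⟨a, rfl⟩ := hm.exists_len
  obtain ⟨b, rfl⟩ := hn.exists_len
  exact ⟨smash a b, by rw [len_smash]; exact le_self_add⟩
theorem IsLog.add_one {m : M} (hm : IsLog m) : IsLog (m + 1) := by
  obtain ⟨a, rfl⟩ := hm.exists_len
  exact ⟨pw a, by rw [len_pw]⟩
theorem isLog_zero : IsLog (0 : M) := ⟨0, zero_le⟩
theorem isLog_one : IsLog (1 : M) := ⟨1, len_one.ge⟩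
theorem isLog_two : IsLog (2 : M) := by rw [← one_add_one_eq_two]; exact isLog_one.add_one
theorem IsLog.add {m n : M} (hm : IsLog m) (hn : IsLog n) : IsLog (m + n) := by
  rcases le_total m n with h | h
  · exact (isLog_two.mul hn).mono (by rw [two_mul]; gcongr)
  · exact (isLog_two.mul hm).mono (by rw [two_mul]; gcongr)

open Classical in
/-- `E n` is `2 ^ n`, for `n` bounded by a length. -/
noncomputable def E (n : M) : M := if h : ∃ a : M, len a = n then pw h.choose else 0

theorem E_len (a : M) : E (len a) = pw a := by
  have h : ∃ b : M, len b = len a := ⟨a, rfl⟩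
  rw [E, dif_pos h]
  exact pw_congr h.choose_spec

theorem E_zero : E (0 : M) = 1 := by rw [← len_zero, E_len, pw_zero]

theorem E_add {m n : M} (hm : IsLog m) (hn : IsLog n) : E (m + n) = E m * E n := by
  obtain ⟨c, hc⟩ := (hm.add hn).exists_len
  obtain ⟨a, rfl⟩ := hm.exists_len
  obtain ⟨b, rfl⟩ := hn.exists_len
  rw [← hc, E_len, E_len, E_len, pw_add hc]

theorem E_one : E (1 : M) = 2 := by
  have : E (len (1 : M)) = 2 := by rw [E_len, pw, smash_one_one]
  rwa [len_one] at this

theorem E_add_one {m : M} (hm : IsLog m) : E (m + 1) = 2 * E m := by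
  rw [E_add hm isLog_one, E_one, mul_comm]

theorem len_E {n : M} (h : IsLog n) : len (E n) = n + 1 := by
  obtain ⟨a, rfl⟩ := h.exists_len
  rw [E_len, len_pw]

theorem E_pos {n : M} (h : IsLog n) : 0 < E n := by
  rw [pos_iff_ne_zero, ne_eq, ← len_eq_zero, len_E h]
  simp

/-- Division with remainder by `2 ^ n`. -/
theorem msp_spec (x : M) {n : M} (hn : IsLog n) :
    msp x n * E n ≤ x ∧ x < (msp x n + 1) * E n := by
  obtain ⟨a, rfl⟩ := hn.exists_len
  -- For n ≤ |a| the power 2^n is expressed by function symbols, through the initial segment of a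
  -- with n digits; this makes the induction formula open.
  have key := OpenDef.lind (P := fun n => msp x n * pw (msp a (len a - n)) ≤ x ∧
    x < (msp x n + 1) * pw (msp a (len a - n))) ⟨2,
      .le' (.msp' (.proj 1) (.proj 0) *
        .smash' 1 (.msp' (.proj 2) (.len' (.proj 2) - .proj 0))) (.proj 1) *
      .lt' (.proj 1) ((.msp' (.proj 1) (.proj 0) + 1) *
        .smash' 1 (.msp' (.proj 2) (.len' (.proj 2) - .proj 0))), ![x, a], fun n => ?_⟩ a ?_ ?_
  · have h := key
    simp only [tsub_self, msp_zero] at h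
    rwa [E_len]
  · simp only [TCFun.holds_mul, TCFun.holds_le', TCFun.holds_lt', TCFun.ev_mul, TCFun.ev_msp',
      TCFun.ev_proj', TCFun.ev_smash', TCFun.ev_one, TCFun.ev_sub, TCFun.ev_len', TCFun.ev_add]
    rfl
  · simp only [tsub_zero, msp_len, pw_zero, msp_zero, mul_one, le_refl, true_and]
    exact lt_add_one_iff'.2 le_rfl
  · intro u hu hP
    have h1 : pw (msp a (len a - (u + 1))) = 2 * pw (msp a (len a - u)) := by
      rw [← E_len, ← E_len, len_msp, len_msp, tsub_tsub_cancel_of_le hu.le,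
        tsub_tsub_cancel_of_le (add_one_le_iff'.2 hu), E_add_one ((isLog_len a).mono hu.le)]
    rw [h1, msp_add_one]
    obtain ⟨h2, h3⟩ := hP
    constructor
    · refine le_trans ?_ h2
      rw [← mul_assoc, mul_comm _ 2]
      gcongr
      exact two_mul_half_le _
    · refine lt_of_lt_of_le h3 ?_
      rw [← mul_assoc]
      gcongr
      have := le_two_mul_half_add_one (msp x u)
      calc msp x u + 1 ≤ 2 * half (msp x u) + 1 + 1 := by gcongr
        _ = (half (msp x u) + 1) * 2 := by ring

theorem msp_le (x : M) {n : M} (hn : IsLog n) : msp x n ≤ x := by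
  refine le_trans ?_ (msp_spec x hn).1
  exact le_mul_of_one_le_right zero_le (pos_iff_one_le.1 (E_pos hn))

/-- If |b| > |a|, the initial segment c of b with |a|+1 digits satisfies 2·2^|a| = 2^|c| ≤ 2c, hence
2^|a| ≤ c ≤ b. Conversely, 2^|a| has |a|+1 digits and so exceeds every b with |b| ≤ |a|. -/
theorem lt_pw_iff {a b : M} : b < pw a ↔ len b ≤ len a := by
  constructor
  · intro h
    by_contra h'
    rw [not_le] at h'
    have h1 := add_one_le_iff'.2 h'
    have hlog : IsLog (len b - (len a + 1)) := (isLog_len b).mono tsub_le_self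
    set c := msp b (len b - (len a + 1)) with hc
    have h2 : len c = len a + 1 := by rw [hc, len_msp, tsub_tsub_cancel_of_le h1]
    have h3 : c ≠ 0 := by
      rw [ne_eq, ← len_eq_zero, h2]; simp
    have h4 : pw c = 2 * pw a := by
      rw [pw_half h3, pw_congr (a := half c) (b := a)]
      have := len_half h3
      rw [h2] at this
      exact (add_right_cancel this).symm
    have h5 := pw_le h3
    rw [h4] at h5
    exact not_le.2 h ((le_of_mul_le_mul_left h5 two_pos).trans (msp_le b hlog))
  · intro h
    refine lt_of_len_lt ?_
    rw [len_pw]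
    exact lt_add_one_iff'.2 h

theorem lt_E_iff {a n : M} (hn : IsLog n) : a < E n ↔ len a ≤ n := by
  obtain ⟨b, rfl⟩ := hn.exists_len
  rw [E_len, lt_pw_iff]

/-! ### Division by powers of two -/

/-- The remainder of `x` modulo `2 ^ n`. -/
def low (x n : M) : M := x - msp x n * pw (msp x (len x - n))

/-- When n > |x| the power written in `low` need not be 2^n, but then its coefficient, the quotient,
is zero. -/
theorem low_eq (x n : M) : low x n = x - msp x n * E n := by
  rw [low]
  rcases le_total n (len x) with h | h
  · rw [← E_len, len_msp, tsub_tsub_cancel_of_le h]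
  · have : msp x n = 0 := by rw [← len_eq_zero, len_msp, tsub_eq_zero_of_le h]
    rw [this, zero_mul, zero_mul]

theorem msp_add_low (x : M) {n : M} (hn : IsLog n) : x = msp x n * E n + low x n := by
  rw [low_eq x n, add_tsub_cancel_of_le (msp_spec x hn).1]

theorem low_lt (x : M) {n : M} (hn : IsLog n) : low x n < E n := by
  have h1 := msp_add_low x hn
  have h2 := (msp_spec x hn).2
  rw [add_mul, one_mul] at h2
  conv_lhs at h2 => rw [h1]
  exact lt_of_add_lt_add_left h2

theorem div_unique {a b e r s : M} (hr : r < e) (hs : s < e) (h : a * e + r = b * e + s) :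
    a = b ∧ r = s := by
  have key : ∀ {a b r s : M}, s < e → a * e + r = b * e + s → ¬ b < a := by
    intro a b r s hs h hab
    have h1 : (b + 1) * e ≤ a * e := by gcongr; exact add_one_le_iff'.2 hab
    have h2 : a * e ≤ b * e + s := h ▸ le_self_add
    have h3 : b * e + s < b * e + e := by gcongr
    rw [add_mul, one_mul] at h1
    exact not_le.2 h3 (h1.trans h2)
  have hab : a = b := le_antisymm (not_lt.1 (key hs h)) (not_lt.1 (key hr h.symm))
  exact ⟨hab, by rw [hab] at h; exact add_left_cancel h⟩

theorem msp_mul_add (q : M) {n r : M} (hn : IsLog n) (hr : r < E n) : msp (q * E n + r) n = q :=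
  (div_unique (low_lt _ hn) hr (msp_add_low _ hn).symm).1

theorem low_mul_add (q : M) {n r : M} (hn : IsLog n) (hr : r < E n) : low (q * E n + r) n = r :=
  (div_unique (low_lt _ hn) hr (msp_add_low _ hn).symm).2

theorem msp_eq_zero {x n : M} (h : len x ≤ n) : msp x n = 0 := by
  rw [← len_eq_zero, len_msp, tsub_eq_zero_of_le h]

/-- The k digits from position n on lie below position N, where the added multiple of 2^N starts.
Thus the blocks already written in w survive when a further block is put on top. -/
theorem low_low_msp_add (u : M) {w n k N : M} (hN : IsLog N) (h : n + k ≤ N) :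
    low (msp (w + u * E N) n) k = low (msp w n) k := by
  have hn : IsLog n := hN.mono (le_self_add.trans h)
  have hk : IsLog k := hN.mono (le_add_self.trans h)
  obtain ⟨d, rfl⟩ := exists_add_of_le h
  have hd : IsLog d := hN.mono le_add_self
  have h1 := msp_add_low w hn
  have h2 := msp_add_low (msp w n) hk
  have h3 : w + u * E (n + k + d) =
      ((u * E d + msp (msp w n) k) * E k + low (msp w n) k) * E n + low w n := by
    rw [E_add (hn.add hk) hd, E_add hn hk]
    conv_lhs => rw [h1, h2]
    ring
  rw [h3, msp_mul_add _ hn (low_lt w hn), low_mul_add _ hk (low_lt _ hk)]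

theorem low_eq_self {x n : M} (h : len x ≤ n) : low x n = x := by
  rw [low_eq x n, msp_eq_zero h, zero_mul, tsub_zero]

theorem len_mul_E_add {a n r : M} (hn : IsLog n) (ha : a ≠ 0) (hr : r < E n) :
    len (a * E n + r) = len a + n := by
  have h := len_msp (a * E n + r) n
  rw [msp_mul_add a hn hr] at h
  have h0 : 0 < len a := pos_iff_ne_zero.2 (mt len_eq_zero.1 ha)
  rw [h] at h0 ⊢
  exact (tsub_add_cancel_of_le (tsub_pos_iff_lt.1 h0).le).symm

theorem msp_msp (x : M) {m n : M} (hm : IsLog m) (hn : IsLog n) :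
    msp (msp x m) n = msp x (m + n) := by
  have h1 := msp_add_low x hm
  have h2 := msp_add_low (msp x m) hn
  have h3 : low (msp x m) n * E m + low x m < E (m + n) := by
    rw [E_add hm hn]
    have := add_one_le_iff'.2 (low_lt (msp x m) hn)
    calc _ < low (msp x m) n * E m + E m := by gcongr; exact low_lt x hm
      _ = (low (msp x m) n + 1) * E m := by ring
      _ ≤ E n * E m := by gcongr
      _ = _ := mul_comm _ _
  have h4 : x = msp (msp x m) n * E (m + n) + (low (msp x m) n * E m + low x m) := by
    rw [E_add hm hn]
    conv_lhs => rw [h1, h2]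
    ring
  conv_rhs => rw [h4]
  rw [msp_mul_add _ (hm.add hn) h3]

/-! ### Removing the leading bit -/

/-- `x` without its leading binary digit. -/
def drop (x : M) : M := x - pw (half x)

theorem E_add_drop {k R : M} (hk : IsLog k) (hR : R < E k) :
    len (E k + R) = k + 1 ∧ drop (E k + R) = R := by
  have h1 : len (E k + R) = k + 1 := by
    have := len_mul_E_add hk one_ne_zero hR
    rwa [one_mul, len_one, add_comm 1] at this
  refine ⟨h1, ?_⟩
  have h0 : E k + R ≠ 0 := by
    rw [ne_eq, ← len_eq_zero, h1]; simp
  have h2 := len_half h0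
  rw [h1] at h2
  rw [drop, ← E_len, ← add_right_cancel h2, add_tsub_cancel_left]

theorem eq_E_add_drop {x k : M} (h : len x = k + 1) : x = E k + drop x ∧ drop x < E k := by
  have h0 : x ≠ 0 := by
    rw [ne_eq, ← len_eq_zero, h]; simp
  have hk : IsLog k := (isLog_len x).mono (h ▸ le_self_add)
  have h2 := len_half h0
  rw [h] at h2
  have h3 : pw (half x) = E k := by rw [← E_len, ← add_right_cancel h2]
  have h4 : E k ≤ x := by
    rw [← not_lt, lt_E_iff hk, h, not_le]; exact lt_add_one_iff'.2 le_rfl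
  have h5 : x = E k + drop x := by rw [drop, h3, add_tsub_cancel_of_le h4]
  refine ⟨h5, ?_⟩
  have h6 : x < 2 * E k := by
    rw [← E_add_one hk, lt_E_iff (h ▸ isLog_len x), h]
  rw [two_mul] at h6
  conv_lhs at h6 => rw [h5]
  exact lt_of_add_lt_add_left h6

/-! ### Coding of pairs -/

/-- The code `1 0 ⋯ 0 1 X u` of the pair `(X, u)`, where `X` is written with `m` digits and `u` with
`q` digits, and there are `m` zeros. -/
noncomputable def code (m X q u : M) : M := E (q + 2 * m + 1) + (E (q + m) + (X * E q + u))

/-- The number of digits of the first component of a code. -/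
def codeM (w : M) : M := len w - 1 - len (drop w)
/-- The number of digits of the second component of a code. -/
def codeQ (w : M) : M := len w - (2 * codeM w + 2)
/-- The first component of a code. -/
def codeX (w : M) : M := msp (drop (drop w)) (codeQ w)
/-- The second component of a code. -/
def codeU (w : M) : M := low (drop (drop w)) (codeQ w)

section

variable {m X q u : M}

theorem code_rest_lt (hm : IsLog m) (hq : IsLog q) (hX : X < E m) (hu : u < E q) :
    X * E q + u < E (q + m) := by
  rw [E_add hq hm]
  calc _ < X * E q + E q := by gcongr
    _ = (X + 1) * E q := by ring
    _ ≤ E m * E q := by gcongr; exact add_one_le_iff'.2 hX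
    _ = _ := mul_comm _ _

/-- Each of the two leading ones stands above a remainder smaller than its own power of two, so
`drop` removes them one after the other. -/
theorem code_spec (hm : IsLog m) (hq : IsLog q) (hX : X < E m) (hu : u < E q) :
    len (code m X q u) = q + 2 * m + 2 ∧ drop (code m X q u) = E (q + m) + (X * E q + u) ∧
      len (drop (code m X q u)) = q + m + 1 ∧ drop (drop (code m X q u)) = X * E q + u := by
  have h1 := E_add_drop (hq.add hm) (code_rest_lt hm hq hX hu)
  have hl : IsLog (q + 2 * m + 1) := (hq.add (isLog_two.mul hm)).add_one
  have hlt : E (q + m) + (X * E q + u) < E (q + 2 * m + 1) := by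
    rw [lt_E_iff hl, h1.1]
    gcongr
    rw [two_mul]; exact le_self_add
  have h2 := E_add_drop hl hlt
  refine ⟨?_, h2.2, ?_, ?_⟩
  · rw [code, h2.1]; ring
  · rw [code, h2.2, h1.1]
  · rw [code, h2.2, h1.2]

/-- Removing the leading one also removes the m zeros after it, so the length drops by m+1. Writing
m in unary is what makes the code self-delimiting. -/
theorem codeM_code (hm : IsLog m) (hq : IsLog q) (hX : X < E m) (hu : u < E q) :
    codeM (code m X q u) = m := by
  obtain ⟨h1, -, h3, -⟩ := code_spec hm hq hX hu
  rw [codeM, h1, h3, tsub_tsub, show q + 2 * m + 2 = m + (1 + (q + m + 1)) by ring,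
    add_tsub_cancel_right]

theorem codeQ_code (hm : IsLog m) (hq : IsLog q) (hX : X < E m) (hu : u < E q) :
    codeQ (code m X q u) = q := by
  obtain ⟨h1, -, -, -⟩ := code_spec hm hq hX hu
  rw [codeQ, codeM_code hm hq hX hu, h1, add_assoc, add_tsub_cancel_right]

theorem codeX_code (hm : IsLog m) (hq : IsLog q) (hX : X < E m) (hu : u < E q) :
    codeX (code m X q u) = X := by
  obtain ⟨-, -, -, h4⟩ := code_spec hm hq hX hu
  rw [codeX, h4, codeQ_code hm hq hX hu, msp_mul_add X hq hu]

theorem codeU_code (hm : IsLog m) (hq : IsLog q) (hX : X < E m) (hu : u < E q) :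
    codeU (code m X q u) = u := by
  obtain ⟨-, -, -, h4⟩ := code_spec hm hq hX hu
  rw [codeU, h4, codeQ_code hm hq hX hu, low_mul_add X hq hu]

/-- Every number with a nonzero second component is a code. -/
theorem eq_code {w : M} (h : codeQ w ≠ 0) :
    IsLog (codeM w) ∧ IsLog (codeQ w) ∧ codeX w < E (codeM w) ∧ codeU w < E (codeQ w) ∧
      w = code (codeM w) (codeX w) (codeQ w) (codeU w) := by
  set m := codeM w with hm
  set q := codeQ w with hq
  -- Subtraction is truncated, and only q ≠ 0 guarantees that |w| has room for 2m+2 digits.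
  have hlw : len w = q + (2 * m + 2) := by
    rw [hq, codeQ, tsub_add_cancel_of_le]
    exact (tsub_pos_iff_lt.1 (pos_iff_ne_zero.2 h)).le
  have hlm : IsLog m := (isLog_len w).mono (by
    rw [hlw]
    calc m ≤ m + (q + (m + 2)) := le_self_add
      _ = _ := by ring)
  have hlq : IsLog q := (isLog_len w).mono (by rw [hlw]; exact le_self_add)
  obtain ⟨h1, h2⟩ := eq_E_add_drop (x := w) (k := q + 2 * m + 1) (by rw [hlw]; ring)
  have h3 : len (drop w) = q + m + 1 := by
    have hle : len (drop w) ≤ len w - 1 := by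
      rw [lt_E_iff ((hlq.add (isLog_two.mul hlm)).add_one)] at h2
      refine h2.trans (le_of_eq ?_)
      rw [hlw, show q + (2 * m + 2) = q + 2 * m + 1 + 1 by ring, add_tsub_cancel_right]
    have h4 : len w - 1 = m + len (drop w) := by
      rw [hm, codeM, tsub_add_cancel_of_le hle]
    rw [hlw, show q + (2 * m + 2) = m + (q + m + 1) + 1 by ring, add_tsub_cancel_right] at h4
    exact (add_left_cancel h4).symm
  obtain ⟨h5, h6⟩ := eq_E_add_drop h3
  have h7 : drop (drop w) = codeX w * E q + codeU w := msp_add_low _ hlq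
  have h8 : codeX w < E m := by
    rw [lt_E_iff hlm, codeX, len_msp, ← hq, tsub_le_iff_right, add_comm, ← lt_E_iff (hlq.add hlm)]
    exact h6
  refine ⟨hlm, hlq, h8, low_lt _ hlq, ?_⟩
  rw [code, ← h7, ← h5, ← h1]

end

end Arithmetic

/-! ### Polynomial bounds on lengths -/

section

variable {M : Type} [TCModel M]

theorem len_le_self (a : M) : len a ≤ a := by
  refine OpenDef.pind (P := fun z : M => len z ≤ z)
    ⟨0, .le' (.len' (.proj 0)) (.proj 0), Fin.elim0, fun z => ?_⟩ ?_ (fun z hz => ?_) a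
  · rw [TCFun.holds_le', TCFun.ev_len', TCFun.ev_proj']; rfl
  · rw [len_zero]
  · rcases eq_or_ne z 0 with h | h
    · rw [h, len_zero]
    · rw [len_half h]
      refine (add_le_add_left hz 1).trans ?_
      rcases eq_or_ne (half z) 0 with h0 | h0
      · rw [h0, zero_add]; exact pos_iff_one_le.1 (pos_iff_ne_zero.2 h)
      · refine le_trans ?_ (two_mul_half_le z)
        rw [two_mul]
        gcongr
        exact pos_iff_one_le.1 (pos_iff_ne_zero.2 h0)

theorem len_pw_mul_pw (a b : M) : len (pw a * pw b) = len a + len b + 1 := by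
  have hab := (isLog_len a).add (isLog_len b)
  rw [← E_len, ← E_len, ← E_add (isLog_len a) (isLog_len b), len_E hab]

theorem half_le (a : M) : half a ≤ a :=
  le_trans (by rw [two_mul]; exact le_self_add) (two_mul_half_le a)

end

namespace TCFun

/-- A function whose length exceeds the sum of the lengths of given functions. -/
def big {n : ℕ} : ∀ {k : ℕ}, (Fin k → TCFun n) → TCFun n
  | 0, _ => 0
  | _ + 1, g => smash' 1 (g 0) * smash' 1 (big fun j => g j.succ)

theorem len_big_succ {M : Type} [TCModel M] {n k : ℕ} (g : Fin (k + 1) → TCFun n)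
    (v : Fin n → M) : BoundedArithmetic.len ((big g).ev v) =
      BoundedArithmetic.len ((g 0).ev v) +
        BoundedArithmetic.len ((big fun j => g j.succ).ev v) + 1 := by
  rw [big, ev_mul, ev_smash', ev_smash', ev_one]
  exact len_pw_mul_pw _ _

theorem len_le_big {M : Type} [TCModel M] {n : ℕ} : ∀ {k : ℕ} (g : Fin k → TCFun n)
    (v : Fin n → M) (j : Fin k),
    BoundedArithmetic.len ((g j).ev v) ≤ BoundedArithmetic.len ((big g).ev v)
  | 0, _, _, j => j.elim0
  | k + 1, g, v, j => by
    rw [len_big_succ]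
    refine Fin.cases ?_ (fun j => ?_) j
    · rw [add_assoc]; exact le_self_add
    · exact (len_le_big (fun j => g j.succ) v j).trans (le_add_self.trans le_self_add)

theorem len_big_mono {M : Type} [TCModel M] {n n' : ℕ} : ∀ {k : ℕ} (g : Fin k → TCFun n)
    (g' : Fin k → TCFun n') (v : Fin n → M) (w : Fin n' → M),
    (∀ j, BoundedArithmetic.len ((g j).ev v) ≤ BoundedArithmetic.len ((g' j).ev w)) →
    BoundedArithmetic.len ((big g).ev v) ≤ BoundedArithmetic.len ((big g').ev w)
  | 0, _, _, _, _, _ => by simp [big]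
  | k + 1, g, g', v, w, h => by
    rw [len_big_succ, len_big_succ]
    gcongr
    · exact h 0
    · exact len_big_mono _ _ v w fun j => h j.succ

/-- `B` is monotone in lengths and bounds the length of `f`. -/
def LenBound {n : ℕ} (f : TCFun n) (B : TCFun 1) : Prop :=
  ∀ (M : Type) [TCModel M],
    (∀ a b : M, BoundedArithmetic.len a ≤ BoundedArithmetic.len b →
      BoundedArithmetic.len (B.ev ![a]) ≤ BoundedArithmetic.len (B.ev ![b])) ∧
    ∀ (v : Fin n → M) (a : M), (∀ j, BoundedArithmetic.len (v j) ≤ BoundedArithmetic.len a) →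
      BoundedArithmetic.len (f.ev v) ≤ BoundedArithmetic.len (B.ev ![a])

theorem lenBound_of_le {n : ℕ} {f : TCFun n} (i : Fin n)
    (h : ∀ (M : Type) [TCModel M] (v : Fin n → M),
      BoundedArithmetic.len (f.ev v) ≤ BoundedArithmetic.len (v i)) : f.LenBound (.proj 0) := by
  intro M _
  simp only [ev_proj', Matrix.cons_val_zero]
  exact ⟨fun _ _ h => h, fun v a ha => (h M v).trans (ha i)⟩

/-- Induction on the function symbol. Composition is the reason for asking that bounds be monotone
in lengths and unary: the bounds for the inner functions are gathered by `big` into one argument of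
the outer bound. -/
theorem exists_lenBound {n : ℕ} (f : TCFun n) : ∃ B, f.LenBound B := by
  have hpw : ∀ {M : Type} [TCModel M] (a : M),
      BoundedArithmetic.len ((smash' 1 (.proj 0) : TCFun 1).ev ![a]) =
        BoundedArithmetic.len a + 1 := by
    intro M _ a
    rw [ev_smash', ev_one, ev_proj']
    exact len_pw a
  have hpp : ∀ {M : Type} [TCModel M] (a : M),
      BoundedArithmetic.len ((smash' 1 (.proj 0) * smash' 1 (.proj 0) : TCFun 1).ev ![a]) =
        BoundedArithmetic.len a + BoundedArithmetic.len a + 1 := by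
    intro M _ a
    rw [ev_mul, ev_smash', ev_one, ev_proj']
    exact len_pw_mul_pw a a
  induction f with
  | zero => exact ⟨0, fun M _ => ⟨by simp, fun v a _ => by
      rw [Subsingleton.elim v (![] : Fin 0 → M)]
      exact (len_zero (M := M)).le.trans zero_le⟩⟩
  | succ =>
    refine ⟨smash' 1 (.proj 0), fun M _ => ⟨fun a b h => ?_, fun v a h => ?_⟩⟩
    · rw [hpw, hpw]; gcongr
    · rw [hpw, vec_one v]
      change BoundedArithmetic.len (BoundedArithmetic.succ (v 0)) ≤ _
      rw [succ_eq, ← len_E (isLog_len a)]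
      exact len_mono (add_one_le_iff'.2 ((lt_E_iff (isLog_len a)).2 (h 0)))
  | add =>
    refine ⟨smash' 1 (.proj 0), fun M _ => ⟨fun a b h => ?_, fun v a h => ?_⟩⟩
    · rw [hpw, hpw]; gcongr
    · rw [hpw, vec_two v]
      change BoundedArithmetic.len (v 0 + v 1) ≤ _
      rw [← lt_E_iff (isLog_len a).add_one, E_add_one (isLog_len a), two_mul]
      exact add_lt_add ((lt_E_iff (isLog_len a)).2 (h 0)) ((lt_E_iff (isLog_len a)).2 (h 1))
  | mul =>
    refine ⟨smash' 1 (.proj 0) * smash' 1 (.proj 0), fun M _ => ⟨fun a b h => ?_, fun v a h => ?_⟩⟩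
    · rw [hpp, hpp]; gcongr
    · rw [hpp, vec_two v]
      change BoundedArithmetic.len (v 0 * v 1) ≤ _
      have hl := isLog_len a
      rw [← len_E (hl.add hl), E_add hl hl]
      exact len_mono (mul_le_mul ((lt_E_iff hl).2 (h 0)).le ((lt_E_iff hl).2 (h 1)).le
        zero_le zero_le)
  | half => exact ⟨_, lenBound_of_le 0 fun M _ v => by
      rw [vec_one v]; exact len_mono (half_le (v 0))⟩
  | len => exact ⟨_, lenBound_of_le 0 fun M _ v => by
      rw [vec_one v]; exact len_mono (len_le_self (v 0))⟩
  | smash =>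
    have hss : ∀ {M : Type} [TCModel M] (a : M),
        BoundedArithmetic.len ((smash' (.proj 0) (.proj 0) : TCFun 1).ev ![a]) =
          BoundedArithmetic.len a * BoundedArithmetic.len a + 1 := by
      intro M _ a
      rw [ev_smash', ev_proj']
      exact len_smash a a
    refine ⟨smash' (.proj 0) (.proj 0), fun M _ => ⟨fun a b h => ?_, fun v a h => ?_⟩⟩
    · rw [hss, hss]; gcongr
    · rw [hss, vec_two v]
      refine (len_smash (v 0) (v 1)).le.trans ?_
      gcongr
      · exact h 0
      · exact h 1
  | sub => exact ⟨_, lenBound_of_le 0 fun M _ v => by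
      rw [vec_two v]; exact len_mono (tsub_le_self (a := v 0) (b := v 1))⟩
  | msp => exact ⟨_, lenBound_of_le 0 fun M _ v => by
      rw [vec_two v]; exact (len_msp (v 0) (v 1)).le.trans tsub_le_self⟩
  | proj i => exact ⟨_, lenBound_of_le i fun M _ v => by rw [ev_proj']⟩
  | comp f g ihf ihg =>
    obtain ⟨B, hB⟩ := ihf
    choose C hC using ihg
    refine ⟨.comp B ![big C], fun M _ => ⟨fun a b h => ?_, fun v a h => ?_⟩⟩
    · rw [ev_comp_one, ev_comp_one]
      exact (hB M).1 _ _ (len_big_mono _ _ _ _ fun j => (hC j M).1 a b h)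
    · rw [ev_comp_one, ev_comp']
      exact (hB M).2 _ _ fun j => ((hC j M).2 v a h).trans (len_le_big C _ j)
  | bits h _ => exact ⟨_, lenBound_of_le 0 fun M _ v => by
      rw [← Fin.cons_self_tail v]; exact (ev_bits h _ _).1⟩
  | search h _ => exact ⟨_, lenBound_of_le 0 fun M _ v => by
      rw [← Fin.cons_self_tail v]
      exact len_mono ((ev_search h _ _).1.trans (len_le_self _))⟩

/-! ### Function symbols for coding -/

section

variable {n : ℕ}

def low' (f g : TCFun n) : TCFun n := f - msp' f g * smash' 1 (msp' f (len' f - g))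
def drop' (f : TCFun n) : TCFun n := f - smash' 1 (half' f)
def codeM' (f : TCFun n) : TCFun n := len' f - 1 - len' (drop' f)
def codeQ' (f : TCFun n) : TCFun n := len' f - ((1 + 1) * codeM' f + (1 + 1))
def codeX' (f : TCFun n) : TCFun n := msp' (drop' (drop' f)) (codeQ' f)
def codeU' (f : TCFun n) : TCFun n := low' (drop' (drop' f)) (codeQ' f)

variable {M : Type} [TCModel M] (f g : TCFun n) (v : Fin n → M)

@[simp] theorem ev_low' : (low' f g).ev v = low (f.ev v) (g.ev v) := by simp [low', low, pw]
@[simp] theorem ev_drop' : (drop' f).ev v = drop (f.ev v) := by simp [drop', drop, pw]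
@[simp] theorem ev_codeM' : (codeM' f).ev v = codeM (f.ev v) := by simp [codeM', codeM]
@[simp] theorem ev_codeQ' : (codeQ' f).ev v = codeQ (f.ev v) := by
  simp [codeQ', codeQ, one_add_one_eq_two]
@[simp] theorem ev_codeX' : (codeX' f).ev v = codeX (f.ev v) := by simp [codeX', codeX]
@[simp] theorem ev_codeU' : (codeU' f).ev v = codeU (f.ev v) := by simp [codeU', codeU]

end

/-! ### Substitution -/

/-- `f` with an unused first argument. -/
def shift {n : ℕ} (f : TCFun n) : TCFun (n + 1) := .comp f fun j => .proj j.succ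

@[simp] theorem ev_shift {M : Type} [TCModel M] {n : ℕ} (f : TCFun n) (v : Fin (n + 1) → M) :
    (shift f).ev v = f.ev (Fin.tail v) := by
  simp only [shift, ev_comp', ev_proj']; rfl

/-- A substitution acting identically on a new first variable. -/
def lift {n k : ℕ} (g : Fin k → TCFun n) : Fin (k + 1) → TCFun (n + 1) :=
  Fin.cons (.proj 0) fun j => shift (g j)

theorem ev_lift {M : Type} [TCModel M] {n k : ℕ} (g : Fin k → TCFun n) (u : M) (v : Fin n → M) :
    (fun j => (lift g j).ev (Fin.cons u v : Fin (n + 1) → M)) =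
      (Fin.cons u fun j => (g j).ev v : Fin (k + 1) → M) := by
  funext j
  refine Fin.cases ?_ (fun j => ?_) j
  · simp [lift]
  · simp [lift]

end TCFun

/-! ### Definable predicates -/

/-- A predicate defined uniformly in all models of the base theory. -/
abbrev UPred (n : ℕ) := ∀ (M : Type) [TCModel M], (Fin n → M) → Prop

/-- Semantic counterpart of the classes of strict formulas, with open matrix and with a single
quantifier in each block. -/
def Sem : Side → ∀ (_ : ℕ) {n : ℕ}, UPred n → Prop
  | _, 0, _, P => ∃ f : TCFun _, ∀ (M : Type) [TCModel M] v, P M v ↔ f.Holds v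
  | .sigma, i + 1, n, P => ∃ (t : TCFun n) (Q : UPred (n + 1)), Sem .pi i Q ∧
      ∀ (M : Type) [TCModel M] (v : Fin n → M), P M v ↔ ∃ u ≤ t.ev v, Q M (Fin.cons u v)
  | .pi, i + 1, n, P => ∃ (t : TCFun n) (Q : UPred (n + 1)), Sem .sigma i Q ∧
      ∀ (M : Type) [TCModel M] (v : Fin n → M), P M v ↔ ∀ u ≤ t.ev v, Q M (Fin.cons u v)

@[simp] theorem Side.dual_dual (s : Side) : s.dual.dual = s := by cases s <;> rfl

theorem sem_zero {s : Side} {n : ℕ} {P : UPred n} :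
    Sem s 0 P ↔ ∃ f : TCFun n, ∀ (M : Type) [TCModel M] v, P M v ↔ f.Holds v := by
  cases s <;> exact Iff.rfl

theorem sem_sigma {i n : ℕ} {P : UPred n} :
    Sem .sigma (i + 1) P ↔ ∃ (t : TCFun n) (Q : UPred (n + 1)), Sem .pi i Q ∧
      ∀ (M : Type) [TCModel M] (v : Fin n → M), P M v ↔ ∃ u ≤ t.ev v, Q M (Fin.cons u v) :=
  Iff.rfl

theorem sem_pi {i n : ℕ} {P : UPred n} :
    Sem .pi (i + 1) P ↔ ∃ (t : TCFun n) (Q : UPred (n + 1)), Sem .sigma i Q ∧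
      ∀ (M : Type) [TCModel M] (v : Fin n → M), P M v ↔ ∀ u ≤ t.ev v, Q M (Fin.cons u v) :=
  Iff.rfl

namespace Sem

variable {s : Side} {i n : ℕ} {P P' : UPred n}

theorem congr (h : Sem s i P) (h' : ∀ (M : Type) [TCModel M] v, P' M v ↔ P M v) : Sem s i P' := by
  have : P' = P := by funext M _ v; exact propext (h' M v)
  rwa [this]

/-- Substitution costs nothing, since function symbols are closed under composition and bounds and
matrix are function symbols. -/
theorem comp (h : Sem s i P) {k : ℕ} (g : Fin n → TCFun k) :
    Sem s i (fun M _ v => P M fun j => (g j).ev v) := by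
  induction i generalizing s n k with
  | zero =>
    obtain ⟨f, hf⟩ := sem_zero.1 h
    exact sem_zero.2 ⟨.comp f g, fun M _ v => by simp only [hf, TCFun.holds_comp]⟩
  | succ i ih =>
    cases s with
    | sigma =>
      obtain ⟨t, Q, hQ, hf⟩ := sem_sigma.1 h
      exact sem_sigma.2 ⟨.comp t g, _, ih hQ (TCFun.lift g), fun M _ v => by
        simp only [hf, TCFun.ev_comp', TCFun.ev_lift]⟩
    | pi =>
      obtain ⟨t, Q, hQ, hf⟩ := sem_pi.1 h
      exact sem_pi.2 ⟨.comp t g, _, ih hQ (TCFun.lift g), fun M _ v => by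
        simp only [hf, TCFun.ev_comp', TCFun.ev_lift]⟩

theorem not (h : Sem s i P) : Sem s.dual i (fun M _ v => ¬ P M v) := by
  induction i generalizing s n with
  | zero =>
    obtain ⟨f, hf⟩ := sem_zero.1 h
    exact sem_zero.2 ⟨.not' f, fun M _ v => by simp only [hf, TCFun.holds_not']⟩
  | succ i ih =>
    cases s with
    | sigma =>
      obtain ⟨t, Q, hQ, hf⟩ := sem_sigma.1 h
      exact sem_pi.2 ⟨t, _, ih hQ, fun M _ v => by simp only [hf]; push Not; rfl⟩
    | pi =>
      obtain ⟨t, Q, hQ, hf⟩ := sem_pi.1 h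
      exact sem_sigma.2 ⟨t, _, ih hQ, fun M _ v => by simp only [hf]; push Not; rfl⟩

theorem of_not (h : Sem s.dual i (fun M _ v => ¬ P M v)) : Sem s i P := by
  have := h.not
  rw [Side.dual_dual] at this
  exact this.congr fun M _ v => not_not.symm

theorem next (h : Sem s.dual i P) : Sem s (i + 1) P := by
  cases s with
  | sigma => exact sem_sigma.2 ⟨0, _, h.comp fun j => .proj j.succ, fun M _ v => by simp⟩
  | pi => exact sem_pi.2 ⟨0, _, h.comp fun j => .proj j.succ, fun M _ v => by simp⟩

/-- The dummy quantifier goes innermost, next to the open matrix, which belongs to both sides. -/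
theorem same_succ (h : Sem s i P) : Sem s (i + 1) P := by
  induction i generalizing s n with
  | zero => exact next (sem_zero.2 (sem_zero.1 h))
  | succ i ih =>
    cases s with
    | sigma =>
      obtain ⟨t, Q, hQ, hf⟩ := sem_sigma.1 h
      exact sem_sigma.2 ⟨t, Q, ih hQ, hf⟩
    | pi =>
      obtain ⟨t, Q, hQ, hf⟩ := sem_pi.1 h
      exact sem_pi.2 ⟨t, Q, ih hQ, hf⟩

theorem ofOpen (f : TCFun n) : Sem s i (fun _ _ v => f.Holds v) := by
  induction i with
  | zero => exact sem_zero.2 ⟨f, fun _ _ v => Iff.rfl⟩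
  | succ i ih => exact ih.same_succ

/-- The class is closed under conjunction. -/
def AndClosed (i : ℕ) : Prop := ∀ (s : Side) {n : ℕ} {P Q : UPred n}, Sem s i P → Sem s i Q →
  Sem s i (fun M _ v => P M v ∧ Q M v)

theorem AndClosed.or (h : AndClosed i) {P Q : UPred n} (hP : Sem s i P) (hQ : Sem s i Q) :
    Sem s i (fun M _ v => P M v ∨ Q M v) :=
  of_not ((h _ hP.not hQ.not).congr fun _ _ _ => not_or)

/-- Both witnesses are packed into w = u'·2^|t| + u, from which they are read off as quotient and
remainder. The two bounds become an open conjunct of the matrix, whence the assumption on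
conjunctions one level below. -/
theorem exists_exists (h : AndClosed i) {Q : UPred (n + 2)} (hQ : Sem .pi i Q) (t : TCFun n)
    (t' : TCFun (n + 1)) : Sem .sigma (i + 1) (fun M _ v => ∃ u ≤ t.ev v,
      ∃ u' ≤ t'.ev (Fin.cons u v : Fin (n + 1) → M), Q M (Fin.cons u' (Fin.cons u v))) := by
  obtain ⟨B, hB⟩ := t'.exists_lenBound
  let lo : TCFun (n + 1) := .low' (.proj 0) (.len' t.shift)
  let hi : TCFun (n + 1) := .msp' (.proj 0) (.len' t.shift)
  have hlo : ∀ {M : Type} [TCModel M] (w : M) (v : Fin n → M),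
      lo.ev (Fin.cons w v : Fin (n + 1) → M) = low w (len (t.ev v)) := by
    intro M _ w v; simp [lo]
  have hhi : ∀ {M : Type} [TCModel M] (w : M) (v : Fin n → M),
      hi.ev (Fin.cons w v : Fin (n + 1) → M) = msp w (len (t.ev v)) := by
    intro M _ w v; simp [hi]
  -- The bound on u' depends on u, but its length is controlled by those of t and of the variables;
  -- so u' is below the first factor and u below the second.
  let W : TCFun n := .smash' 1 (.comp B ![.big (Fin.cons t .proj)]) * .smash' 1 t
  refine sem_sigma.2 ⟨W, _, h _ (ofOpen (.le' lo t.shift *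
    .le' hi (.comp t' (Fin.cons lo fun j => .proj j.succ))))
    (hQ.comp (Fin.cons hi (Fin.cons lo fun j => .proj j.succ))), fun M _ v => ?_⟩
  have e1 : ∀ w : M, (fun j => ((Fin.cons lo fun j => .proj j.succ :
      Fin (n + 1) → TCFun (n + 1)) j).ev (Fin.cons w v : Fin (n + 1) → M)) =
      (Fin.cons (low w (len (t.ev v))) v : Fin (n + 1) → M) := by
    intro w; funext j
    refine Fin.cases ?_ (fun j => ?_) j
    · rw [Fin.cons_zero, hlo, Fin.cons_zero]
    · simp
  have e2 : ∀ w : M, (fun j => ((Fin.cons hi (Fin.cons lo fun j => .proj j.succ) :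
      Fin (n + 2) → TCFun (n + 1)) j).ev (Fin.cons w v : Fin (n + 1) → M)) =
      (Fin.cons (msp w (len (t.ev v))) (Fin.cons (low w (len (t.ev v))) v) :
        Fin (n + 2) → M) := by
    intro w; funext j
    refine Fin.cases ?_ (fun j => ?_) j
    · rw [Fin.cons_zero, hhi, Fin.cons_zero]
    · rw [Fin.cons_succ, Fin.cons_succ, ← e1 w]
  simp only [TCFun.holds_mul, TCFun.holds_le', TCFun.ev_comp', e1, e2, hlo, hhi, TCFun.ev_shift,
    Fin.tail_cons]
  have hlt := isLog_len (t.ev v)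
  constructor
  · rintro ⟨u, hu, u', hu', hQ⟩
    have hu1 : u < E (len (t.ev v)) := (lt_E_iff hlt).2 (len_mono hu)
    refine ⟨u' * E (len (t.ev v)) + u, ?_, ?_⟩
    · have h1 : len u' ≤ len (B.ev ![(TCFun.big (Fin.cons t .proj)).ev v]) := by
        refine (len_mono hu').trans ((hB M).2 _ _ fun j => ?_)
        refine Fin.cases ?_ (fun j => ?_) j
        · exact (len_mono hu).trans (TCFun.len_le_big (Fin.cons t .proj) v 0)
        · have := TCFun.len_le_big (Fin.cons t .proj) v j.succ
          simpa using this
      simp only [W, TCFun.ev_mul, TCFun.ev_smash', TCFun.ev_one, TCFun.ev_comp_one]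
      change _ ≤ pw _ * pw _
      rw [← E_len, ← E_len, ← lt_add_one_iff']
      have h2 := (lt_E_iff (isLog_len _)).2 h1
      refine lt_add_one_iff'.2 ?_
      calc _ ≤ u' * E (len (t.ev v)) + E (len (t.ev v)) := by gcongr
        _ = (u' + 1) * E (len (t.ev v)) := by ring
        _ ≤ _ := by gcongr; exact add_one_le_iff'.2 h2
    · rw [low_mul_add _ hlt hu1, msp_mul_add _ hlt hu1]
      exact ⟨⟨hu, hu'⟩, hQ⟩
  · rintro ⟨w, -, ⟨h1, h2⟩, h3⟩
    exact ⟨_, h1, _, h2, h3⟩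

/-- On the Σ side the two existential quantifiers are pulled out and merged by `exists_exists`,
which uses closure at the previous level. -/
theorem andClosed (i : ℕ) : AndClosed i := by
  induction i with
  | zero =>
    intro s n P Q hP hQ
    obtain ⟨f, hf⟩ := sem_zero.1 hP
    obtain ⟨g, hg⟩ := sem_zero.1 hQ
    exact sem_zero.2 ⟨f * g, fun M _ v => by simp only [hf, hg, TCFun.holds_mul]⟩
  | succ i ih =>
    intro s n P P' hP hP'
    cases s with
    | sigma =>
      obtain ⟨t, Q, hQ, hf⟩ := sem_sigma.1 hP
      obtain ⟨t', Q', hQ', hf'⟩ := sem_sigma.1 hP'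
      refine (exists_exists ih (ih _ (hQ.comp fun j => .proj j.succ)
        (hQ'.comp (Fin.cons (.proj 0) fun j => .proj j.succ.succ))) t t'.shift).congr
        fun M _ v => ?_
      have e1 : ∀ u u' : M, (fun j : Fin (n + 1) => (TCFun.proj j.succ).ev
          (Fin.cons u' (Fin.cons u v) : Fin (n + 2) → M)) = Fin.cons u v := by
        intro u u'; funext j; simp
      have e2 : ∀ u u' : M, (fun j => ((Fin.cons (.proj 0) fun j => .proj j.succ.succ :
          Fin (n + 1) → TCFun (n + 2)) j).ev
          (Fin.cons u' (Fin.cons u v) : Fin (n + 2) → M)) = Fin.cons u' v := by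
        intro u u'; funext j
        refine Fin.cases ?_ (fun j => ?_) j <;> simp
      simp only [hf, hf', e1, e2, TCFun.ev_shift, Fin.tail_cons]
      constructor
      · rintro ⟨⟨u, hu, h⟩, u', hu', h'⟩
        exact ⟨u, hu, u', hu', h, h'⟩
      · rintro ⟨u, hu, u', hu', h, h'⟩
        exact ⟨⟨u, hu, h⟩, u', hu', h'⟩
    | pi =>
      obtain ⟨t, Q, hQ, hf⟩ := sem_pi.1 hP
      obtain ⟨t', Q', hQ', hf'⟩ := sem_pi.1 hP'
      -- One universal variable up to t + t' serves both conjuncts, each guarded by its own bound;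
      -- no pairing is needed.
      refine sem_pi.2 ⟨t + t', _, ih _ (ih.or (ofOpen (.lt' t.shift (.proj 0))) hQ)
        (ih.or (ofOpen (.lt' t'.shift (.proj 0))) hQ'), fun M _ v => ?_⟩
      simp only [hf, hf', TCFun.holds_lt', TCFun.ev_shift, Fin.tail_cons, TCFun.ev_proj',
        Fin.cons_zero, TCFun.ev_add]
      constructor
      · rintro ⟨h, h'⟩ u -
        exact ⟨(lt_or_ge _ _).imp_right (h u), (lt_or_ge _ _).imp_right (h' u)⟩
      · intro h
        exact ⟨fun u hu => (h u (hu.trans le_self_add)).1.resolve_left (not_lt.2 hu),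
          fun u hu => (h u (hu.trans le_add_self)).2.resolve_left (not_lt.2 hu)⟩

theorem and {P Q : UPred n} (hP : Sem s i P) (hQ : Sem s i Q) :
    Sem s i (fun M _ v => P M v ∧ Q M v) := andClosed i s hP hQ

theorem or {P Q : UPred n} (hP : Sem s i P) (hQ : Sem s i Q) :
    Sem s i (fun M _ v => P M v ∨ Q M v) := (andClosed i).or hP hQ

theorem imp {P Q : UPred n} (hP : Sem s.dual i P) (hQ : Sem s i Q) :
    Sem s i (fun M _ v => P M v → Q M v) := by
  have h := hP.not
  rw [Side.dual_dual] at h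
  exact (h.or hQ).congr fun M _ v => imp_iff_not_or

theorem bex {Q : UPred (n + 1)} (hQ : Sem .sigma (i + 1) Q) (t : TCFun n) :
    Sem .sigma (i + 1) (fun M _ v => ∃ u ≤ t.ev v, Q M (Fin.cons u v)) := by
  obtain ⟨t', R, hR, hf⟩ := sem_sigma.1 hQ
  exact (exists_exists (andClosed i) hR t t').congr fun M _ v => by simp only [hf]

theorem ball {Q : UPred (n + 1)} (hQ : Sem .pi (i + 1) Q) (t : TCFun n) :
    Sem .pi (i + 1) (fun M _ v => ∀ u ≤ t.ev v, Q M (Fin.cons u v)) :=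
  of_not ((bex hQ.not t).congr fun M _ v => by push Not; rfl)

/-- Above level 0 the quantifier joins the leading universal one. At level 0 it is decided by
searching for a counterexample. -/
theorem sharp_ball {Q : UPred (n + 1)} (hQ : Sem .pi i Q) (t : TCFun n) :
    Sem .pi i (fun M _ v => ∀ u ≤ len (t.ev v), Q M (Fin.cons u v)) := by
  cases i with
  | succ i => exact (ball hQ (.len' t)).congr fun M _ v => by simp only [TCFun.ev_len']
  | zero =>
    obtain ⟨f, hf⟩ := sem_zero.1 hQ
    -- Search inspects u < |a|, while u = |t| must be included; a = 2^|t| has length |t|+1. No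
    -- counterexample means that the value found exceeds |t|.
    refine sem_zero.2 ⟨.lt' (.len' t) (.comp (.search (.not' f)) (Fin.cons (.smash' 1 t) .proj)),
      fun M _ v => ?_⟩
    have e : (fun j => ((Fin.cons (.smash' 1 t) .proj : Fin (n + 1) → TCFun n) j).ev v) =
        (Fin.cons (pw (t.ev v)) v : Fin (n + 1) → M) := by
      funext j
      refine Fin.cases ?_ (fun j => ?_) j <;> simp [pw]
    simp only [hf, TCFun.holds_lt', TCFun.ev_len', TCFun.ev_comp', e]
    obtain ⟨h1, h2, h3⟩ := ev_search (TCFun.not' f) (pw (t.ev v)) v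
    rw [len_pw] at h1 h2
    constructor
    · intro h
      by_contra hlt
      have hle := not_lt.1 hlt
      exact (TCFun.holds_not' _ _).1 (h2 (not_le.2 (lt_add_one_iff'.2 hle))) (h _ hle)
    · intro h u hu
      have := h3 u (not_le.2 (hu.trans_lt h))
      by_contra hn
      exact (TCFun.holds_not' f (Fin.cons u v)).2 hn this

end Sem

/-! ### Strict formulas define exactly the predicates of the semantic classes -/

section Formulas

variable {α : Type} {n N : ℕ}

/-- The arguments of a formula in the scope of one more quantifier. -/
def extVars (e : α ⊕ Fin n → Fin N) : α ⊕ Fin (n + 1) → Fin (N + 1) :=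
  Sum.elim (fun a => (e (.inl a)).succ) (Fin.snoc (fun j => (e (.inr j)).succ) 0)

/-- The predicate defined by a formula. -/
def predOf (φ : LTC.BoundedFormula α n) (e : α ⊕ Fin n → Fin N) : UPred N :=
  fun _ _ v => φ.Realize (fun a => v (e (.inl a))) (fun j => v (e (.inr j)))

/-- A formula adds its new bound variable at the end, `Sem` adds it at the front; `extVars`
mediates. -/
theorem predOf_extVars (φ : LTC.BoundedFormula α (n + 1)) (e : α ⊕ Fin n → Fin N)
    {M : Type} [TCModel M] (u : M) (v : Fin N → M) :
    predOf φ (extVars e) M (Fin.cons u v) ↔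
      φ.Realize (fun a => v (e (.inl a))) (Fin.snoc (fun j => v (e (.inr j))) u) := by
  have h1 : (fun a => (Fin.cons u v : Fin (N + 1) → M) (extVars e (.inl a))) =
      fun a => v (e (.inl a)) := by
    funext a; simp [extVars]
  have h2 : (fun j => (Fin.cons u v : Fin (N + 1) → M) (extVars e (.inr j))) =
      (Fin.snoc (fun j => v (e (.inr j))) u : Fin (n + 1) → M) := by
    funext j
    refine Fin.lastCases ?_ (fun j => ?_) j <;> simp [extVars]
  rw [predOf, h1, h2]

theorem realize_weaken {M : Type} [TCModel M] (t : LTC.Term (α ⊕ Fin n)) (v : α → M)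
    (xs : Fin n → M) (a : M) :
    (weaken t).realize (Sum.elim v (Fin.snoc xs a : Fin (n + 1) → M)) =
      t.realize (Sum.elim v xs) := by
  rw [weaken, Term.realize_relabel]
  congr 1
  funext b
  rcases b with b | b <;> simp

theorem realize_ballLe {M : Type} [TCModel M] (t : LTC.Term (α ⊕ Fin n))
    (φ : LTC.BoundedFormula α (n + 1)) (v : α → M) (xs : Fin n → M) :
    (ballLe t φ).Realize v xs ↔
      ∀ u ≤ t.realize (Sum.elim v xs), φ.Realize v (Fin.snoc xs u) := by
  simp [ballLe, realize_fLe', realize_weaken, Term.realize]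

theorem realize_bexLe {M : Type} [TCModel M] (t : LTC.Term (α ⊕ Fin n))
    (φ : LTC.BoundedFormula α (n + 1)) (v : α → M) (xs : Fin n → M) :
    (bexLe t φ).Realize v xs ↔
      ∃ u ≤ t.realize (Sum.elim v xs), φ.Realize v (Fin.snoc xs u) := by
  simp [bexLe, realize_fLe', realize_weaken, Term.realize]

theorem exists_ev_eq_realize {β : Type} (t : LTC.Term β) (e : β → Fin N) :
    ∃ f : TCFun N, ∀ (M : Type) [TCModel M] (v : Fin N → M),
      t.realize (fun b => v (e b)) = f.ev v := by
  induction t with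
  | var b => exact ⟨.proj (e b), fun M _ v => by rw [TCFun.ev_proj']; rfl⟩
  | func f ts ih =>
    choose g hg using ih
    refine ⟨TCFun.comp f g, fun M _ v => Eq.trans ?_ (TCFun.ev_comp' v f g).symm⟩
    simp only [← hg]
    rfl

theorem exists_ev_eq_realize' (t : LTC.Term (α ⊕ Fin n)) (e : α ⊕ Fin n → Fin N) :
    ∃ f : TCFun N, ∀ (M : Type) [TCModel M] (v : Fin N → M),
      t.realize (Sum.elim (fun a => v (e (.inl a))) (fun j => v (e (.inr j)))) = f.ev v := by
  obtain ⟨f, hf⟩ := exists_ev_eq_realize t e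
  refine ⟨f, fun M _ v => ?_⟩
  rw [← hf]
  congr 1
  funext b
  rcases b with b | b <;> rfl

/-- Every sharply bounded formula has a characteristic function: connectives are arithmetic and
quantifiers are searches. At level 0 the two sides coincide, so the induction may change side
freely. -/
theorem IsSharplyBounded.sem {φ : LTC.BoundedFormula α n} (h : IsSharplyBounded φ) (s : Side)
    (e : α ⊕ Fin n → Fin N) : Sem s 0 (predOf φ e) := by
  induction h generalizing s N with
  | falsum =>
    exact (Sem.ofOpen 0).congr fun M _ v => by simp [predOf, TCFun.Holds]
  | atomic h =>
    cases h with
    | equal t₁ t₂ =>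
      obtain ⟨f, hf⟩ := exists_ev_eq_realize' t₁ e
      obtain ⟨g, hg⟩ := exists_ev_eq_realize' t₂ e
      exact (Sem.ofOpen (.eq' f g)).congr fun M _ v => by
        rw [predOf, TCFun.holds_eq', ← hf, ← hg]; simp
    | rel R ts =>
      revert ts
      refine (match R with | TCRel.le => ?_)
      intro ts
      obtain ⟨f, hf⟩ := exists_ev_eq_realize' (ts 0) e
      obtain ⟨g, hg⟩ := exists_ev_eq_realize' (ts 1) e
      refine (Sem.ofOpen (.le' f g)).congr fun M _ v => ?_
      rw [TCFun.holds_le', ← hf, ← hg]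
      have : BoundedFormula.rel (L := LTC) (R := TCRel.le) ts = fLe (ts 0) (ts 1) := by
        rw [fLe, ← vec_two ts]
      change (BoundedFormula.rel (L := LTC) (R := TCRel.le) ts).Realize _ _ ↔ _
      rw [this, realize_fLe']
  | imp _ _ ih₁ ih₂ => exact ((ih₁ s.dual e).imp (ih₂ s e)).congr fun M _ v => Iff.rfl
  | ball t _ ih =>
    obtain ⟨f, hf⟩ := exists_ev_eq_realize' t e
    refine sem_zero.2 (sem_zero.1 (((ih .pi (extVars e)).sharp_ball f).congr fun M _ v => ?_))
    rw [predOf, realize_ballLe, realize_tLen, hf]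
    simp only [predOf_extVars]
  | bex t _ ih =>
    obtain ⟨f, hf⟩ := exists_ev_eq_realize' t e
    refine sem_zero.2 (sem_zero.1 ((((ih .sigma (extVars e)).not).sharp_ball f).not.congr
      fun M _ v => ?_))
    rw [predOf, realize_bexLe, realize_tLen, hf]
    simp only [predOf_extVars]
    push Not; rfl

theorem IsStrict.sem {s : Side} {i : ℕ} {φ : LTC.BoundedFormula α n} (h : IsStrict s i φ)
    (e : α ⊕ Fin n → Fin N) : Sem s i (predOf φ e) := by
  induction h generalizing N with
  | base s h => exact h.sem s e
  | next s _ ih => exact (ih e).next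
  | bex t _ ih =>
    obtain ⟨f, hf⟩ := exists_ev_eq_realize' t e
    refine ((ih (extVars e)).bex f).congr fun M _ v => ?_
    rw [predOf, realize_bexLe, hf]
    simp only [predOf_extVars]
  | ball t _ ih =>
    obtain ⟨f, hf⟩ := exists_ev_eq_realize' t e
    refine ((ih (extVars e)).ball f).congr fun M _ v => ?_
    rw [predOf, realize_ballLe, hf]
    simp only [predOf_extVars]

/-- With this converse a new induction formula need only be described as a predicate; the formula
itself, with matrix ¬ f = 0, is never handled again. -/
theorem Sem.exists_isStrict {s : Side} {i : ℕ} {P : UPred N} (h : Sem s i P)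
    (τ : Fin N → α ⊕ Fin n) : ∃ φ : LTC.BoundedFormula α n, IsStrict s i φ ∧
      ∀ (M : Type) [TCModel M] (v : α → M) (xs : Fin n → M),
        φ.Realize v xs ↔ P M fun j => Sum.elim v xs (τ j) := by
  induction i generalizing s N n with
  | zero =>
    obtain ⟨f, hf⟩ := sem_zero.1 h
    refine ⟨∼((app f fun j => Term.var (τ j)) =' 0),
      .base _ (.imp (.atomic (.equal _ _)) .falsum), fun M _ v xs => ?_⟩
    rw [hf, TCFun.Holds, BoundedFormula.realize_not, BoundedFormula.realize_bdEqual, realize_app,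
      realize_tZero]
    rfl
  | succ i ih =>
    have key : ∀ (M : Type) [TCModel M] (v : α → M) (xs : Fin n → M) (u : M),
        (fun j => Sum.elim v (Fin.snoc xs u : Fin (n + 1) → M)
          ((Fin.cons (.inr (Fin.last n)) fun j => Sum.map id Fin.castSucc (τ j) :
            Fin (N + 1) → α ⊕ Fin (n + 1)) j)) =
        (Fin.cons u fun j => Sum.elim v xs (τ j) : Fin (N + 1) → M) := by
      intro M _ v xs u
      funext j
      refine Fin.cases ?_ (fun j => ?_) j
      · simp
      · rw [Fin.cons_succ, Fin.cons_succ]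
        rcases τ j with a | a <;> simp
    cases s with
    | sigma =>
      obtain ⟨t, Q, hQ, hf⟩ := sem_sigma.1 h
      obtain ⟨ψ, hψ, hr⟩ := ih hQ (Fin.cons (.inr (Fin.last n))
        fun j => Sum.map id Fin.castSucc (τ j))
      refine ⟨bexLe (app t fun j => Term.var (τ j)) ψ, .bex _ (.next _ hψ), fun M _ v xs => ?_⟩
      rw [realize_bexLe, hf, realize_app]
      simp only [hr, key]
      rfl
    | pi =>
      obtain ⟨t, Q, hQ, hf⟩ := sem_pi.1 h
      obtain ⟨ψ, hψ, hr⟩ := ih hQ (Fin.cons (.inr (Fin.last n))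
        fun j => Sum.map id Fin.castSucc (τ j))
      refine ⟨ballLe (app t fun j => Term.var (τ j)) ψ, .ball _ (.next _ hψ), fun M _ v xs => ?_⟩
      rw [realize_ballLe, hf, realize_app]
      simp only [hr, key]
      rfl

end Formulas

/-! ### Truth of the formulas in the schemes -/

section Instances

variable {k : ℕ}

/-- The predicate `φ(x, y)`. -/
def IndFm.holds (φ : IndFm k) (M : Type) [TCModel M] (y : Fin k → M) (x : M) : Prop :=
  φ.Realize fun o => o.elim x y

theorem IndFm.sem_of_mem {s : Side} {i : ℕ} {φ : IndFm k} (h : φ ∈ hat s i k) :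
    Sem s i (n := k + 1) (fun M _ v => φ.holds M (Fin.tail v) (v 0)) := by
  refine (IsStrict.sem h (N := k + 1)
    (Sum.elim (fun o => o.elim 0 Fin.succ) Fin.elim0)).congr fun M _ v => ?_
  rw [holds, predOf, Formula.Realize]
  refine iff_of_eq (congrArg₂ _ ?_ (Subsingleton.elim _ _))
  funext o
  cases o <;> rfl

theorem Sem.exists_mem {s : Side} {i : ℕ} {P : UPred (k + 1)} (h : Sem s i P) :
    ∃ φ ∈ hat s i k, ∀ (M : Type) [TCModel M] (y : Fin k → M) (x : M),
      φ.holds M y x ↔ P M (Fin.cons x y) := by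
  obtain ⟨φ, h1, h2⟩ := h.exists_isStrict (α := Option (Fin k)) (n := 0)
    (Fin.cons (.inl none) fun j => .inl (some j))
  refine ⟨φ, h1, fun M _ y x => ?_⟩
  rw [IndFm.holds, Formula.Realize, h2]
  refine iff_of_eq (congrArg _ ?_)
  funext j
  refine Fin.cases ?_ (fun j => ?_) j <;> rfl

variable {M : Type} [TCModel M] (φ : IndFm k)

theorem realize_inst (m : ℕ) (t : Tm (k + m)) (xs : Fin (k + m) → M) :
    (φ.inst m t).Realize default xs ↔
      φ.holds M (fun j => xs (j.castAdd m)) (t.realize (Sum.elim default xs)) := by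
  rw [IndFm.inst, BoundedFormula.realize_relabel, BoundedFormula.realize_subst, IndFm.holds,
    Formula.Realize]
  refine iff_of_eq (congrArg₂ _ ?_ (Subsingleton.elim _ _))
  have e : (Sum.elim default (xs ∘ Fin.castAdd 0) ∘ id : Empty ⊕ Fin (k + m) → M) =
      Sum.elim default xs := rfl
  rw [e]
  funext o
  cases o <;> rfl

theorem realize_at1 (t : Tm (k + 1)) (y : Fin k → M) (x : M) :
    (φ.at1 t).Realize default (Fin.snoc y x : Fin (k + 1) → M) ↔
      φ.holds M y (t.realize (Sum.elim default (Fin.snoc y x : Fin (k + 1) → M))) := by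
  rw [IndFm.at1, realize_inst]
  have : (fun j : Fin k => (Fin.snoc y x : Fin (k + 1) → M) (j.castAdd 1)) = y := by
    funext j; exact Fin.snoc_castSucc (α := fun _ => M) x y j
  rw [this]

theorem realize_inst_two (t : Tm (k + 2)) (y : Fin k → M) (x u : M) :
    (φ.inst 2 t).Realize default (Fin.snoc (Fin.snoc y x : Fin (k + 1) → M) u : Fin (k + 2) → M) ↔
      φ.holds M y (t.realize
        (Sum.elim default (Fin.snoc (Fin.snoc y x : Fin (k + 1) → M) u : Fin (k + 2) → M))) := by
  rw [realize_inst]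
  have : (fun j : Fin k => (Fin.snoc (Fin.snoc y x : Fin (k + 1) → M) u : Fin (k + 2) → M)
      (j.castAdd 2)) = y := by
    funext j
    exact (Fin.snoc_castSucc (α := fun _ => M) u _ j.castSucc).trans
      (Fin.snoc_castSucc (α := fun _ => M) x y j)
  rw [this]

theorem realize_atZero (y : Fin k → M) : φ.atZero.Realize default y ↔ φ.holds M y 0 := by
  have := realize_inst φ 0 0 y
  rw [realize_tZero] at this
  exact this

theorem realize_vX (y : Fin k → M) (x : M) :
    (vX : Tm (k + 1)).realize (Sum.elim default (Fin.snoc y x : Fin (k + 1) → M)) = x := by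
  simp [vX]
theorem realize_vX' (y : Fin k → M) (x u : M) :
    (vX' : Tm (k + 2)).realize (Sum.elim default
      (Fin.snoc (Fin.snoc y x : Fin (k + 1) → M) u : Fin (k + 2) → M)) = x := by
  simp [vX']
theorem realize_vU (y : Fin k → M) (x u : M) :
    (vU : Tm (k + 2)).realize (Sum.elim default
      (Fin.snoc (Fin.snoc y x : Fin (k + 1) → M) u : Fin (k + 2) → M)) = u := by
  simp [vU]

theorem realize_stepInd (y : Fin k → M) (x : M) :
    (stepInd φ).Realize default (Fin.snoc y x : Fin (k + 1) → M) ↔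
      (φ.holds M y x → φ.holds M y (x + 1)) := by
  simp only [stepInd, BoundedFormula.realize_imp, realize_at1, realize_vX, realize_tAdd,
    realize_tOne]

theorem realize_stepPind (y : Fin k → M) (x : M) :
    (stepPind φ).Realize default (Fin.snoc y x : Fin (k + 1) → M) ↔
      (φ.holds M y (half x) → φ.holds M y x) := by
  simp only [stepPind, BoundedFormula.realize_imp, realize_at1, realize_vX, realize_tHalf]

theorem realize_stepLt (y : Fin k → M) (x : M) :
    (stepLt φ).Realize default (Fin.snoc y x : Fin (k + 1) → M) ↔
      ((∀ u < x, φ.holds M y u) → φ.holds M y x) := by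
  simp only [stepLt, BoundedFormula.realize_imp, BoundedFormula.realize_all, realize_at1,
    realize_vX, realize_inst_two, realize_vU, fLt, BoundedFormula.realize_not, realize_fLe',
    realize_vX', not_le]

theorem realize_stepLenLt (y : Fin k → M) (x : M) :
    (stepLenLt φ).Realize default (Fin.snoc y x : Fin (k + 1) → M) ↔
      ((∀ u, len u < len x → φ.holds M y u) → φ.holds M y x) := by
  simp only [stepLenLt, BoundedFormula.realize_imp, BoundedFormula.realize_all, realize_at1,
    realize_vX, realize_inst_two, realize_vU, fLt, BoundedFormula.realize_not, realize_fLe',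
    realize_vX', not_le, realize_tLen]

theorem realize_stepRes (y : Fin k → M) (x : M) :
    (stepRes φ).Realize default (Fin.snoc y x : Fin (k + 1) → M) ↔
      ((∀ u ≤ len x, 0 < u → φ.holds M y (msp x u)) → φ.holds M y x) := by
  simp only [stepRes, BoundedFormula.realize_imp, BoundedFormula.realize_all, realize_at1,
    realize_vX, realize_inst_two, realize_vU, fLt, BoundedFormula.realize_not, realize_fLe',
    realize_vX', not_le, realize_tLen, realize_tMsp, realize_tZero]

theorem realize_isMin (y : Fin k → M) (x : M) :
    (isMin φ).Realize default (Fin.snoc y x : Fin (k + 1) → M) ↔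
      (φ.holds M y x ∧ ∀ u < x, ¬ φ.holds M y u) := by
  simp only [isMin, BoundedFormula.realize_imp, BoundedFormula.realize_all, realize_at1,
    realize_vX, realize_inst_two, realize_vU, fLt, BoundedFormula.realize_not, realize_fLe',
    realize_vX', not_le, BoundedFormula.realize_inf]

theorem realize_isLenMin (y : Fin k → M) (x : M) :
    (isLenMin φ).Realize default (Fin.snoc y x : Fin (k + 1) → M) ↔
      (φ.holds M y x ∧ ∀ u, len u < len x → ¬ φ.holds M y u) := by
  simp only [isLenMin, BoundedFormula.realize_imp, BoundedFormula.realize_all, realize_at1,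
    realize_vX, realize_inst_two, realize_vU, fLt, BoundedFormula.realize_not, realize_fLe',
    realize_vX', not_le, realize_tLen, BoundedFormula.realize_inf]

theorem realize_alls_iff {n : ℕ} (ψ : Fm n) :
    M ⊨ ψ.alls ↔ ∀ xs : Fin n → M, ψ.Realize default xs := BoundedFormula.realize_alls

end Instances

theorem forall_snoc {M : Type} {n : ℕ} {Q : (Fin (n + 1) → M) → Prop} :
    (∀ xs, Q xs) ↔ ∀ (y : Fin n → M) (x : M), Q (Fin.snoc y x) := by
  refine ⟨fun h y x => h _, fun h xs => ?_⟩
  rw [← Fin.snoc_init_self xs]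
  exact h _ _

/-! ### Schemes and rules in models -/

/-- A condition on subsets of models. -/
abbrev SetCond := ∀ (M : Type) [TCModel M], (M → Prop) → Prop

/-- The instance of `S` for `φ(x, y)` has the premise `∀ y, p (φ(·, y))` and the
conclusion `∀ y, c (φ(·, y))`. -/
def Represents (S : Scheme) (p c : SetCond) : Prop :=
  ∀ (k : ℕ) (φ : IndFm k) (M : Type) [TCModel M],
    ((∀ δ ∈ (S k φ).1, M ⊨ δ) ↔ ∀ y, p M (φ.holds M y)) ∧
      (M ⊨ (S k φ).2 ↔ ∀ y, c M (φ.holds M y))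

/-- The parameter-free formulas of a class. -/
def FmClass.free (Γ : FmClass) : FmClass := fun k => {φ | k = 0 ∧ φ ∈ Γ k}

theorem ruleFree_eq (Γ : FmClass) (S : Scheme) : Γ.ruleFree S = Γ.free.rule S := by
  ext r
  constructor
  · rintro ⟨φ, h, rfl⟩; exact ⟨0, φ, ⟨rfl, h⟩, rfl⟩
  · rintro ⟨k, φ, ⟨rfl, h⟩, rfl⟩; exact ⟨φ, h, rfl⟩

/-- The semantic criterion behind all nontrivial reductions. The premises for φ, being provable in
T, hold in all models of T; hence so do the premises for ψ, and the ψ-instance of the target rule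
may be used. -/
theorem reducible_of {Γ Γ' : FmClass} {S S' : Scheme} {p c p' c' : SetCond}
    (hS : Represents S p c) (hS' : Represents S' p' c')
    (h : ∀ (k : ℕ), ∀ φ ∈ Γ k, ∃ (k' : ℕ), ∃ ψ ∈ Γ' k', ∀ (M : Type) [TCModel M],
      (∀ y, p M (φ.holds M y)) → (∀ y, p' M (ψ.holds M y)) ∧
        ((∀ y, c' M (ψ.holds M y)) → ∀ y, c M (φ.holds M y))) :
    Reducible (Γ.rule S) (Γ'.rule S') := by
  intro T hT σ hσ
  refine Theory.models_sentence_iff.2 fun M => ?_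
  have hM := M.is_model
  rw [Theory.model_iff] at hM
  let hMT : TCModel M := { models := (Theory.model_iff _).2 fun φ hφ => hM φ (Or.inl (hT hφ)) }
  have : M ⊨ (T ∪ {τ | ∃ Δ : List LTC.Sentence, (Δ, τ) ∈ Γ.rule S ∧ ∀ δ ∈ Δ, T ⊨ᵇ δ}) := by
    rw [Theory.model_iff]
    rintro τ (hτ | ⟨Δ, ⟨k, φ, hφ, hr⟩, hΔ⟩)
    · exact hM τ (Or.inl hτ)
    obtain ⟨rfl, rfl⟩ := Prod.mk.injEq .. ▸ hr
    obtain ⟨k', ψ, hψ, hψ'⟩ := h k φ hφ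
    have hMT' : (M : Type) ⊨ T := (Theory.model_iff _).2 fun φ hφ => hM φ (Or.inl hφ)
    have prem : ∀ y, p M (φ.holds M y) := ((hS k φ M).1).1 fun δ hδ => (hΔ δ hδ).realize_sentence M
    refine ((hS k φ M).2).2 ((hψ' M prem).2 (((hS' k' ψ M).2).1 ?_))
    refine hM _ (Or.inr ⟨_, ⟨k', ψ, hψ, rfl⟩, fun δ hδ => ?_⟩)
    -- The premises for ψ must follow from T alone, so they are checked in an arbitrary model K of T
    -- and not just in M.
    refine Theory.models_sentence_iff.2 fun K => ?_
    have hK := K.is_model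
    let hKT : TCModel K := { models := hK.mono hT }
    refine ((hS' k' ψ K).1).2 ((hψ' K ?_).1) δ hδ
    exact ((hS k φ K).1).1 fun δ hδ => (hΔ δ hδ).realize_sentence K
  exact hσ.realize_sentence M

theorem Reducible.trans {R S U : Rule} (h : Reducible R S) (h' : Reducible S U) : Reducible R U :=
  fun T hT => (h T hT).trans (h' T hT)

theorem represents_IND : Represents IND (fun _ _ _ => True)
    fun _ _ P => P 0 ∧ (∀ x, P x → P (x + 1)) → ∀ x, P x := by
  intro k φ M _
  simp [IND, realize_alls_iff, realize_atZero, realize_stepInd, realize_at1, realize_vX]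

theorem represents_INDR : Represents INDR (fun _ _ P => P 0 ∧ (∀ x, P x → P (x + 1)))
    fun _ _ P => ∀ x, P x := by
  intro k φ M _
  simp [INDR, realize_alls_iff, forall_and, forall_snoc, realize_atZero, realize_stepInd, realize_at1, realize_vX]

theorem represents_IND0R : Represents IND0R (fun _ _ P => ∀ x, P x → P (x + 1))
    fun _ _ P => P 0 → ∀ x, P x := by
  intro k φ M _
  simp [IND0R, realize_alls_iff, forall_snoc, realize_stepInd, realize_at1, realize_vX, realize_tZero]
  exact forall_congr' fun _ => ⟨fun h a x => h x a, fun h x a => h a x⟩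

theorem represents_PIND : Represents PIND (fun _ _ _ => True)
    fun _ _ P => P 0 ∧ (∀ x, P (half x) → P x) → ∀ x, P x := by
  intro k φ M _
  simp [PIND, realize_alls_iff, realize_atZero, realize_stepPind, realize_at1, realize_vX]

theorem represents_PINDR : Represents PINDR (fun _ _ P => P 0 ∧ (∀ x, P (half x) → P x))
    fun _ _ P => ∀ x, P x := by
  intro k φ M _
  simp [PINDR, realize_alls_iff, forall_and, forall_snoc, realize_atZero, realize_stepPind, realize_at1, realize_vX]

theorem represents_PIND0R : Represents PIND0R (fun _ _ P => ∀ x, P (half x) → P x)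
    fun _ _ P => P 0 → ∀ x, P x := by
  intro k φ M _
  simp [PIND0R, realize_alls_iff, forall_snoc, realize_stepPind, realize_at1, realize_vX, realize_tZero]
  exact forall_congr' fun _ => ⟨fun h a x => h x a, fun h x a => h a x⟩

theorem represents_LIND : Represents LIND (fun _ _ _ => True)
    fun _ _ P => P 0 ∧ (∀ x, P x → P (x + 1)) → ∀ x, P (len x) := by
  intro k φ M _
  simp [LIND, realize_alls_iff, realize_atZero, realize_stepInd, realize_at1, realize_vX, realize_tLen]

theorem represents_LINDR : Represents LINDR (fun _ _ P => P 0 ∧ (∀ x, P x → P (x + 1)))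
    fun _ _ P => ∀ x, P (len x) := by
  intro k φ M _
  simp [LINDR, realize_alls_iff, forall_and, forall_snoc, realize_atZero, realize_stepInd, realize_at1, realize_vX, realize_tLen]

theorem represents_LIND0R : Represents LIND0R (fun _ _ P => ∀ x, P x → P (x + 1))
    fun _ _ P => P 0 → ∀ x, P (len x) := by
  intro k φ M _
  simp [LIND0R, realize_alls_iff, forall_snoc, realize_stepInd, realize_at1, realize_vX,
    realize_tZero, realize_tLen]
  exact forall_congr' fun _ => ⟨fun h a x => h x a, fun h x a => h a x⟩

theorem represents_INDlt : Represents INDlt (fun _ _ _ => True)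
    fun _ _ P => (∀ x, (∀ u < x, P u) → P x) → ∀ x, P x := by
  intro k φ M _
  simp [INDlt, realize_alls_iff, realize_stepLt, realize_at1, realize_vX]

theorem represents_INDltR : Represents INDltR (fun _ _ P => ∀ x, (∀ u < x, P u) → P x)
    fun _ _ P => ∀ x, P x := by
  intro k φ M _
  simp [INDltR, realize_alls_iff, forall_snoc, realize_stepLt, realize_at1, realize_vX]

theorem represents_LINDlt : Represents LINDlt (fun _ _ _ => True)
    fun _ _ P => (∀ x, (∀ u < x, P u) → P x) → ∀ x, P (len x) := by
  intro k φ M _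
  simp [LINDlt, realize_alls_iff, realize_stepLt, realize_at1, realize_vX, realize_tLen]

theorem represents_LINDltR : Represents LINDltR (fun _ _ P => ∀ x, (∀ u < x, P u) → P x)
    fun _ _ P => ∀ x, P (len x) := by
  intro k φ M _
  simp [LINDltR, realize_alls_iff, forall_snoc, realize_stepLt, realize_at1, realize_vX, realize_tLen]

theorem represents_PINDlt : Represents PINDlt (fun _ _ _ => True)
    fun _ _ P => (∀ x, (∀ u, len u < len x → P u) → P x) → ∀ x, P x := by
  intro k φ M _
  simp [PINDlt, realize_alls_iff, realize_stepLenLt, realize_at1, realize_vX]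

theorem represents_PINDltR : Represents PINDltR (fun _ _ P => ∀ x, (∀ u, len u < len x → P u) → P x)
    fun _ _ P => ∀ x, P x := by
  intro k φ M _
  simp [PINDltR, realize_alls_iff, forall_snoc, realize_stepLenLt, realize_at1, realize_vX]

theorem represents_PINDres : Represents PINDres (fun _ _ _ => True)
    fun _ _ P => (∀ x, (∀ u ≤ len x, 0 < u → P (msp x u)) → P x) → ∀ x, P x := by
  intro k φ M _
  simp [PINDres, realize_alls_iff, realize_stepRes, realize_at1, realize_vX]

theorem represents_PINDresR : Represents PINDresR (fun _ _ P => ∀ x, (∀ u ≤ len x, 0 < u → P (msp x u)) → P x)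
    fun _ _ P => ∀ x, P x := by
  intro k φ M _
  simp [PINDresR, realize_alls_iff, forall_snoc, realize_stepRes, realize_at1, realize_vX]

theorem represents_MIN : Represents MIN (fun _ _ _ => True)
    fun _ _ P => (∃ x, P x) → ∃ x, P x ∧ ∀ u < x, ¬ P u := by
  intro k φ M _
  simp [MIN, realize_alls_iff, realize_isMin, realize_at1, realize_vX]

theorem represents_MINR : Represents MINR (fun _ _ P => ∃ x, P x)
    fun _ _ P => ∃ x, P x ∧ ∀ u < x, ¬ P u := by
  intro k φ M _
  simp [MINR, realize_alls_iff, realize_isMin, realize_at1, realize_vX]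

theorem represents_LMIN : Represents LMIN (fun _ _ _ => True)
    fun _ _ P => (∃ x, P x) → ∃ x, P x ∧ ∀ u, len u < len x → ¬ P u := by
  intro k φ M _
  simp [LMIN, realize_alls_iff, realize_isLenMin, realize_at1, realize_vX]

theorem represents_LMINR : Represents LMINR (fun _ _ P => ∃ x, P x)
    fun _ _ P => ∃ x, P x ∧ ∀ u, len u < len x → ¬ P u := by
  intro k φ M _
  simp [LMINR, realize_alls_iff, realize_isLenMin, realize_at1, realize_vX]

/-! ### Reductions between schemes and between rules -/

section Reductions

variable {Γ Γ' : FmClass} {S S' SR SR' : Scheme} {p c p' c' : SetCond}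

/-- Every condition on a formula in `Γ` reduces to one on a formula in `Γ'`, possibly with more
parameters. -/
def Reduces (Γ Γ' : FmClass) (p c p' c' : SetCond) : Prop :=
  ∀ (k : ℕ), ∀ φ ∈ Γ k, ∃ (k' : ℕ) (π : Fin k → Fin k'), ∃ ψ ∈ Γ' k', ∀ (M : Type) [TCModel M],
    (∀ y' : Fin k' → M, p M (φ.holds M (y' ∘ π)) → p' M (ψ.holds M y')) ∧
    ∀ y, p M (φ.holds M y) → (∀ y' : Fin k' → M, y' ∘ π = y → c' M (ψ.holds M y')) →
      c M (φ.holds M y)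

/-- Every condition on a formula in `Γ` reduces to one on a formula in `Γ'` with the same
parameters. -/
def StrictlyReduces (Γ Γ' : FmClass) (p c p' c' : SetCond) : Prop :=
  ∀ (k : ℕ), ∀ φ ∈ Γ k, ∃ ψ ∈ Γ' k, ∀ (M : Type) [TCModel M] (y : Fin k → M),
    p M (φ.holds M y) → p' M (ψ.holds M y) ∧ (c' M (ψ.holds M y) → c M (φ.holds M y))

theorem StrictlyReduces.reduces (h : StrictlyReduces Γ Γ' p c p' c') : Reduces Γ Γ' p c p' c' := by
  intro k φ hφ
  obtain ⟨ψ, hψ, H⟩ := h k φ hφ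
  exact ⟨k, id, ψ, hψ, fun M _ => ⟨fun y hy => (H M y hy).1,
    fun y hy hc => (H M y hy).2 (hc y rfl)⟩⟩

theorem StrictlyReduces.free (h : StrictlyReduces Γ Γ' p c p' c') :
    StrictlyReduces Γ.free Γ'.free p c p' c' := by
  rintro k φ ⟨hk, hφ⟩
  obtain ⟨ψ, hψ, H⟩ := h k φ hφ
  exact ⟨ψ, ⟨hk, hψ⟩, H⟩

theorem Reduces.rules (h : Reduces Γ Γ' p c p' c') (hR : Represents SR p c)
    (hR' : Represents SR' p' c') : Reducible (Γ.rule SR) (Γ'.rule SR') := by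
  refine reducible_of hR hR' fun k φ hφ => ?_
  obtain ⟨k', π, ψ, hψ, H⟩ := h k φ hφ
  exact ⟨k', ψ, hψ, fun M _ hp => ⟨fun y' => (H M).1 y' (hp _),
    fun hc y => (H M).2 y (hp y) fun y' _ => hc y'⟩⟩

/-- A scheme has its hypothesis for a single y, so only the extensions y' of this y are available.
This is why `Reduces` transfers hypotheses separately for each tuple. -/
theorem Reduces.schemes (h : Reduces Γ Γ' p c p' c')
    (hS : Represents S (fun _ _ _ => True) fun M _ P => p M P → c M P)
    (hS' : Represents S' (fun _ _ _ => True) fun M _ P => p' M P → c' M P) :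
    Reducible (Γ.rule S) (Γ'.rule S') := by
  refine reducible_of hS hS' fun k φ hφ => ?_
  obtain ⟨k', π, ψ, hψ, H⟩ := h k φ hφ
  refine ⟨k', ψ, hψ, fun M _ hp => ⟨fun _ => trivial, fun hc y hy => (H M).2 y hy ?_⟩⟩
  rintro y' rfl
  exact hc y' ((H M).1 y' hy)

theorem StrictlyReduces.rules (h : StrictlyReduces Γ Γ' p c p' c') (hR : Represents SR p c)
    (hR' : Represents SR' p' c') :
    Reducible (Γ.rule SR) (Γ'.rule SR') ∧ Reducible (Γ.ruleFree SR) (Γ'.ruleFree SR') := by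
  rw [ruleFree_eq, ruleFree_eq]
  exact ⟨h.reduces.rules hR hR', h.free.reduces.rules hR hR'⟩

theorem StrictlyReduces.schemes (h : StrictlyReduces Γ Γ' p c p' c')
    (hS : Represents S (fun _ _ _ => True) fun M _ P => p M P → c M P)
    (hS' : Represents S' (fun _ _ _ => True) fun M _ P => p' M P → c' M P) :
    Reducible (Γ.rule S) (Γ'.rule S') ∧ Reducible (Γ.ruleFree S) (Γ'.ruleFree S') := by
  rw [ruleFree_eq, ruleFree_eq]
  exact ⟨h.reduces.schemes hS hS', h.free.reduces.schemes hS hS'⟩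

theorem StrictlyReduces.trans {Γ'' : FmClass} {p'' c'' : SetCond}
    (h : StrictlyReduces Γ Γ' p c p' c') (h' : StrictlyReduces Γ' Γ'' p' c' p'' c'') :
    StrictlyReduces Γ Γ'' p c p'' c'' := by
  intro k φ hφ
  obtain ⟨ψ, hψ, H⟩ := h k φ hφ
  obtain ⟨χ, hχ, H'⟩ := h' k ψ hψ
  refine ⟨χ, hχ, fun M _ y hy => ?_⟩
  obtain ⟨h1, h2⟩ := H M y hy
  obtain ⟨h3, h4⟩ := H' M y h1
  exact ⟨h3, h2 ∘ h4⟩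

/-- Reduction by an equivalence of formulas. -/
theorem strictlyReduces_of_subset (hΓ : ∀ k, Γ k ⊆ Γ' k)
    (h : ∀ (M : Type) [TCModel M] (P : M → Prop), p M P → p' M P ∧ (c' M P → c M P)) :
    StrictlyReduces Γ Γ' p c p' c' :=
  fun k φ hφ => ⟨φ, hΓ k hφ, fun M _ _ => h M _⟩

/-- Reduction by a transformation of the induction variable. -/
theorem strictlyReduces_of_sem {s s' : Side} {i i' : ℕ}
    (h : ∀ (k : ℕ), ∀ φ ∈ hat s i k, ∃ P : UPred (k + 1), Sem s' i' P ∧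
      ∀ (M : Type) [TCModel M] (y : Fin k → M), p M (φ.holds M y) →
        p' M (fun x => P M (Fin.cons x y)) ∧
          (c' M (fun x => P M (Fin.cons x y)) → c M (φ.holds M y))) :
    StrictlyReduces (hat s i) (hat s' i') p c p' c' := by
  intro k φ hφ
  obtain ⟨P, hP, H⟩ := h k φ hφ
  obtain ⟨ψ, hψ, H'⟩ := hP.exists_mem
  refine ⟨ψ, hψ, fun M _ y => ?_⟩
  have : ψ.holds M y = fun x => P M (Fin.cons x y) := funext fun x => propext (H' M y x)
  rw [this]
  exact H M y

/-- Reduction by a formula with one more parameter. -/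
theorem reduces_of_sem {s s' : Side} {i i' : ℕ}
    (h : ∀ (k : ℕ), ∀ φ ∈ hat s i k, ∃ P : UPred (k + 1 + 1), Sem s' i' P ∧
      ∀ (M : Type) [TCModel M] (y : Fin k → M), p M (φ.holds M y) →
        (∀ z, p' M (fun x => P M (Fin.cons x (Fin.cons z y)))) ∧
          ((∀ z, c' M (fun x => P M (Fin.cons x (Fin.cons z y)))) → c M (φ.holds M y))) :
    Reduces (hat s i) (hat s' i') p c p' c' := by
  intro k φ hφ
  obtain ⟨P, hP, H⟩ := h k φ hφ
  obtain ⟨ψ, hψ, H'⟩ := hP.exists_mem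
  refine ⟨k + 1, Fin.succ, ψ, hψ, fun M _ => ?_⟩
  have e : ∀ y', ψ.holds M y' = fun x => P M (Fin.cons x y') :=
    fun y' => funext fun x => propext (H' M y' x)
  simp only [e]
  refine ⟨fun y' hp => ?_, fun y hp hc => (H M y hp).2 fun z => hc (Fin.cons z y) rfl⟩
  have := (H M _ hp).1 (y' 0)
  rwa [show (Fin.cons (y' 0) (y' ∘ Fin.succ) : Fin (k + 1) → M) = y' from
    Fin.cons_self_tail y'] at this

end Reductions

theorem IndFm.sem_subst {k N : ℕ} {s : Side} {i : ℕ} {φ : IndFm k} (h : φ ∈ hat s i k)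
    (f : TCFun N) (g : Fin k → TCFun N) :
    Sem s i (fun M _ v => φ.holds M (fun j => (g j).ev v) (f.ev v)) :=
  ((IndFm.sem_of_mem h).comp (Fin.cons f g)).congr fun _ _ _ => Iff.rfl

/-! ### The conditions on the induction variable -/

section Conditions

def hypInd : SetCond := fun _ _ P => P 0 ∧ ∀ x, P x → P (x + 1)
def hypPind : SetCond := fun _ _ P => P 0 ∧ ∀ x, P (half x) → P x
def hypLt : SetCond := fun _ _ P => ∀ x, (∀ u < x, P u) → P x
def hypLenLt : SetCond := fun _ _ P => ∀ x, (∀ u, len u < len x → P u) → P x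
def hypRes : SetCond := fun _ _ P => ∀ x, (∀ u ≤ len x, 0 < u → P (msp x u)) → P x
def concAll : SetCond := fun _ _ P => ∀ x, P x
def concLen : SetCond := fun _ _ P => ∀ x, P (len x)

variable {s : Side} {i : ℕ}

/-- Take φ(|x|): passing from ⌊x/2⌋ to a nonzero x adds 1 to the length. -/
theorem lind_to_pind : StrictlyReduces (hat s i) (hat s i) hypInd concLen hypPind concAll := by
  refine strictlyReduces_of_sem fun k φ hφ => ⟨_, φ.sem_subst hφ (.len' (.proj 0))
    fun j => .proj j.succ, fun M _ y hp => ?_⟩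
  simp only [hypPind, concAll, concLen, TCFun.ev_len', TCFun.ev_proj', Fin.cons_zero, Fin.cons_succ]
  refine ⟨⟨by rw [len_zero]; exact hp.1, fun x hx => ?_⟩, id⟩
  rcases eq_or_ne x 0 with rfl | h
  · rwa [half_zero] at hx
  · rw [len_half h]; exact hp.2 _ hx

/-- Take the value of φ at the initial segment of z with x digits, where z is a new parameter; at x
= |z| this is φ(z). -/
theorem pind_to_lind : Reduces (hat s i) (hat s i) hypPind concAll hypInd concLen := by
  refine reduces_of_sem fun k φ hφ => ⟨_, φ.sem_subst hφ
    (.msp' (.proj 1) (.len' (.proj 1) - .proj 0)) fun j => .proj j.succ.succ, fun M _ y hp => ?_⟩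
  simp only [hypInd, concAll, concLen, TCFun.ev_len', TCFun.ev_proj', Fin.cons_zero, Fin.cons_succ, TCFun.ev_msp',
    TCFun.ev_sub, Fin.cons_one]
  refine ⟨fun z => ⟨?_, fun x hx => ?_⟩, fun h z => ?_⟩
  · rw [tsub_zero, msp_len]; exact hp.1
  · rcases lt_or_ge x (len z) with h | h
    · refine hp.2 _ ?_
      rw [← msp_add_one, ← tsub_tsub, tsub_add_cancel_of_le]
      · exact hx
      · rw [← pos_iff_one_le]; exact tsub_pos_of_lt h
    -- From |z| on the segment is z itself, so the step is trivial.
    · rwa [tsub_eq_zero_of_le h, ← tsub_eq_zero_of_le (h.trans le_self_add : len z ≤ x + 1)] at hx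
  · have := h z z
    rwa [tsub_self, msp_zero] at this

theorem hypInd.hypLt {M : Type} [TCModel M] {P : M → Prop} (h : hypInd M P) : hypLt M P := by
  intro x hx
  rcases eq_zero_or_succ x with rfl | ⟨b, rfl⟩
  · exact h.1
  · exact h.2 b (hx b (lt_add_one_iff'.2 le_rfl))

theorem lind_to_lindlt : StrictlyReduces (hat s i) (hat s i) hypInd concLen hypLt concLen :=
  strictlyReduces_of_subset (fun _ => subset_rfl) fun _ _ _ h => ⟨h.hypLt, id⟩

theorem pind_to_pindres : StrictlyReduces (hat s i) (hat s i) hypPind concAll hypRes concAll := by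
  refine strictlyReduces_of_subset (fun _ => subset_rfl) fun M _ P h => ⟨fun x hx => ?_, id⟩
  rcases eq_or_ne x 0 with rfl | hx0
  · exact h.1
  · refine h.2 x ?_
    have := hx 1 (pos_iff_one_le.1 (pos_iff_ne_zero.2 (mt len_eq_zero.1 hx0))) one_pos
    rwa [← zero_add (1 : M), msp_add_one, msp_zero] at this

/-- Take φ(|x|): each u < |x| is the length of a proper initial segment of x, so restricted
induction already reaches all smaller lengths. -/
theorem lindlt_to_pindres : StrictlyReduces (hat s i) (hat s i) hypLt concLen hypRes concAll := by
  refine strictlyReduces_of_sem fun k φ hφ => ⟨_, φ.sem_subst hφ (.len' (.proj 0))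
    fun j => .proj j.succ, fun M _ y hp => ?_⟩
  simp only [hypRes, concAll, concLen, TCFun.ev_len', TCFun.ev_proj', Fin.cons_zero, Fin.cons_succ]
  refine ⟨fun x hx => hp _ fun u hu => ?_, id⟩
  have := hx (len x - u) tsub_le_self (tsub_pos_of_lt hu)
  rwa [len_msp, tsub_tsub_cancel_of_le hu.le] at this

/-- Take ∀u≤x φ(u), which is again Π; its inductive step is the order-induction hypothesis. -/
theorem indlt_to_ind :
    StrictlyReduces (hat .pi (i + 1)) (hat .pi (i + 1)) hypLt concAll hypInd concAll := by
  refine strictlyReduces_of_sem fun k φ hφ => ⟨_, (φ.sem_subst hφ (.proj 0)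
    fun j => .proj j.succ.succ).ball (.proj 0), fun M _ y hp => ?_⟩
  simp only [hypInd, concAll, TCFun.ev_proj', Fin.cons_zero, Fin.cons_succ]
  refine ⟨⟨fun u hu => hp u fun w hw => ?_, fun x hx u hu => hp u fun w hw => ?_⟩,
    fun h x => h x x le_rfl⟩
  · exact absurd (hw.trans_le hu) not_lt_zero
  · exact hx w (lt_add_one_iff'.1 (hw.trans_le hu))

/-- Take "φ(u) for all u with |u| ≤ |x|". Such u are below 2^|x|, which supplies the bound for the
quantifier. -/
theorem pindlt_to_pind :
    StrictlyReduces (hat .pi (i + 1)) (hat .pi (i + 1)) hypLenLt concAll hypPind concAll := by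
  refine strictlyReduces_of_sem fun k φ hφ => ⟨_, (Sem.imp (s := .pi) (Sem.ofOpen
    (.le' (.len' (.proj 0)) (.len' (.proj 1)))) (φ.sem_subst hφ (.proj 0)
    fun j => .proj j.succ.succ)).ball (.smash' 1 (.proj 0)), fun M _ y hp => ?_⟩
  simp only [hypPind, concAll, TCFun.ev_proj', Fin.cons_zero, Fin.cons_succ, TCFun.holds_le', TCFun.ev_len',
    TCFun.ev_smash', TCFun.ev_one, Fin.cons_one]
  have key : ∀ x, (∀ u ≤ smash 1 x, len u ≤ len x → φ.holds M y u) →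
      ∀ u, len u ≤ len x → φ.holds M y u :=
    fun x h u hu => h u (lt_pw_iff.2 hu).le hu
  refine ⟨⟨fun u _ hu => hp u fun w hw => ?_, fun x hx u _ hu => hp u fun w hw => ?_⟩,
    fun h x => key x (h x) x le_rfl⟩
  · rw [len_zero] at hu
    exact absurd (hw.trans_le hu) not_lt_zero
  · refine key _ hx w ?_
    have h1 := hw.trans_le hu
    have h0 : x ≠ 0 := by
      rintro rfl; rw [len_zero] at h1; exact not_lt_zero h1
    rw [len_half h0] at h1
    exact lt_add_one_iff'.1 h1

theorem hat_sigma_subset (k : ℕ) : hat .sigma i k ⊆ hat .pi (i + 1) k :=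
  fun _ h => IsStrict.next .pi h

/-! ### Minimization -/

theorem IndFm.exists_not {k : ℕ} {φ : IndFm k} (h : φ ∈ hat s i k) :
    ∃ ψ ∈ hat s.dual i k, ∀ (M : Type) [TCModel M] (y : Fin k → M),
      ψ.holds M y = fun x => ¬ φ.holds M y x := by
  obtain ⟨ψ, hψ, H⟩ := (IndFm.sem_of_mem h).not.exists_mem
  exact ⟨ψ, hψ, fun M _ y => funext fun x => propext (H M y x)⟩

theorem reducible_of_not {S S' : Scheme} {c c' : SetCond}
    (hS : Represents S (fun _ _ _ => True) c) (hS' : Represents S' (fun _ _ _ => True) c')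
    (h : ∀ (M : Type) [TCModel M] (P : M → Prop), c' M (fun x => ¬ P x) → c M P) :
    Reducible ((hat s i).rule S) ((hat s.dual i).rule S') ∧
      Reducible ((hat s i).ruleFree S) ((hat s.dual i).ruleFree S') := by
  rw [ruleFree_eq, ruleFree_eq]
  constructor
  · refine reducible_of hS hS' fun k φ hφ => ?_
    obtain ⟨ψ, hψ, H⟩ := IndFm.exists_not hφ
    exact ⟨k, ψ, hψ, fun M _ _ => ⟨fun _ => trivial, fun hc y => h M _ (H M y ▸ hc y)⟩⟩
  · refine reducible_of hS hS' fun k φ hφ => ?_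
    obtain ⟨ψ, hψ, H⟩ := IndFm.exists_not hφ.2
    exact ⟨k, ψ, ⟨hφ.1, hψ⟩, fun M _ _ => ⟨fun _ => trivial, fun hc y => h M _ (H M y ▸ hc y)⟩⟩

/-- A least element of φ is a point where the order-induction step for ¬φ fails, so the two schemes
are contrapositives. -/
theorem min_equiv_indlt :
    ((hat s i).rule MIN ≡ᵣ (hat s.dual i).rule INDlt) ∧
      ((hat s i).ruleFree MIN ≡ᵣ (hat s.dual i).ruleFree INDlt) := by
  have h1 := reducible_of_not (s := s) (i := i) represents_MIN represents_INDlt fun M _ P h hx => by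
    by_contra! hc
    obtain ⟨x, hx⟩ := hx
    exact h (fun x hx hP => by
      obtain ⟨u, hu, hu'⟩ := hc x hP
      exact hx u hu hu') x hx
  have h2 := reducible_of_not (s := s.dual) (i := i) represents_INDlt represents_MIN
    fun M _ P h hp x => by
      by_contra hx
      obtain ⟨x, hx, hx'⟩ := h ⟨x, hx⟩
      exact hx (hp x fun u hu => not_not.1 (hx' u hu))
  rw [Side.dual_dual] at h2
  exact ⟨⟨h1.1, h2.1⟩, ⟨h1.2, h2.2⟩⟩

theorem lmin_equiv_pindlt :
    ((hat s i).rule LMIN ≡ᵣ (hat s.dual i).rule PINDlt) ∧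
      ((hat s i).ruleFree LMIN ≡ᵣ (hat s.dual i).ruleFree PINDlt) := by
  have h1 := reducible_of_not (s := s) (i := i) represents_LMIN represents_PINDlt
    fun M _ P h hx => by
      by_contra! hc
      obtain ⟨x, hx⟩ := hx
      exact h (fun x hx hP => by
        obtain ⟨u, hu, hu'⟩ := hc x hP
        exact hx u hu hu') x hx
  have h2 := reducible_of_not (s := s.dual) (i := i) represents_PINDlt represents_LMIN
    fun M _ P h hp x => by
      by_contra hx
      obtain ⟨x, hx, hx'⟩ := h ⟨x, hx⟩
      exact hx (hp x fun u hu => not_not.1 (hx' u hu))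
  rw [Side.dual_dual] at h2
  exact ⟨⟨h1.1, h2.1⟩, ⟨h1.2, h2.2⟩⟩

/-- For the minimization rules: with z as a parameter, the existence premise is witnessed by z. If
moreover φ(z) holds, a minimal solution of the disjunction satisfies φ and is minimal for φ. -/
theorem exists_or_eq_param {k : ℕ} {φ : IndFm k} (h : φ ∈ hat s i k) :
    ∃ ψ ∈ hat s i (k + 1), ∀ (M : Type) [TCModel M] (y : Fin (k + 1) → M) (x : M),
      ψ.holds M y x ↔ φ.holds M (Fin.tail y) x ∨ x = y 0 := by
  obtain ⟨ψ, hψ, H⟩ := ((φ.sem_subst h (.proj 0) fun j => .proj j.succ.succ).or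
    (Sem.ofOpen (.eq' (.proj 0) (.proj 1)))).exists_mem (k := k + 1)
  refine ⟨ψ, hψ, fun M _ y x => ?_⟩
  rw [H]
  simp only [TCFun.ev_proj', Fin.cons_zero, Fin.cons_succ, TCFun.holds_eq', Fin.cons_one]
  rfl

theorem minR_equiv_min : (hat s i).rule MINR ≡ᵣ (hat s i).rule MIN := by
  constructor
  · refine reducible_of represents_MINR represents_MIN fun k φ hφ => ?_
    exact ⟨k, φ, hφ, fun M _ hp => ⟨fun _ => trivial, fun hc y => hc y (hp y)⟩⟩
  · refine reducible_of represents_MIN represents_MINR fun k φ hφ => ?_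
    obtain ⟨ψ, hψ, H⟩ := exists_or_eq_param hφ
    refine ⟨k + 1, ψ, hψ, fun M _ _ => ?_⟩
    simp only [H]
    refine ⟨fun y => ⟨y 0, Or.inr rfl⟩, fun hc y => ?_⟩
    rintro ⟨z, hz⟩
    obtain ⟨x, hx, hx'⟩ := hc (Fin.cons z y)
    simp only [Fin.tail_cons, Fin.cons_zero, not_or] at hx hx'
    refine ⟨x, ?_, fun u hu => (hx' u hu).1⟩
    rcases hx with hx | rfl
    · exact hx
    · exact hz

theorem lminR_equiv_lmin : (hat s i).rule LMINR ≡ᵣ (hat s i).rule LMIN := by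
  constructor
  · refine reducible_of represents_LMINR represents_LMIN fun k φ hφ => ?_
    exact ⟨k, φ, hφ, fun M _ hp => ⟨fun _ => trivial, fun hc y => hc y (hp y)⟩⟩
  · refine reducible_of represents_LMIN represents_LMINR fun k φ hφ => ?_
    obtain ⟨ψ, hψ, H⟩ := exists_or_eq_param hφ
    refine ⟨k + 1, ψ, hψ, fun M _ _ => ?_⟩
    simp only [H]
    refine ⟨fun y => ⟨y 0, Or.inr rfl⟩, fun hc y => ?_⟩
    rintro ⟨z, hz⟩
    obtain ⟨x, hx, hx'⟩ := hc (Fin.cons z y)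
    simp only [Fin.tail_cons, Fin.cons_zero, not_or] at hx hx'
    refine ⟨x, ?_, fun u hu => (hx' u hu).1⟩
    rcases hx with hx | rfl
    · exact hx
    · exact hz

end Conditions

/-! ### Collecting witnesses along the initial segments of a number -/

section Collection

variable {M : Type} [TCModel M] {b : M → M}

/-- The block of `w` that holds the witness for `x`. -/
def block (b : M → M) (w x : M) : M := low (msp w (len x * b x)) (b x)

/-- `w` codes witnesses for all initial segments of `x`. -/
def Collected (b : M → M) (T : M → M → Prop) (x w : M) : Prop :=
  len w ≤ (len x + 1) * b x ∧ ∀ j ≤ len x, T (msp x j) (block b w (msp x j))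

theorem msp_half (x : M) {u : M} (hu : IsLog u) : msp (half x) u = msp x (u + 1) := by
  have h1 : half x = msp x 1 := by rw [← zero_add (1 : M), msp_add_one, msp_zero]
  rw [h1, msp_msp x isLog_one hu, add_comm]

/-- A collection for ⌊x/2⌋ supplies witnesses for all proper initial segments of x; the restricted
hypothesis then gives a witness u for x, which is stored in a new top block. -/
theorem hypPind_collected (hb : ∀ x, IsLog (b x)) (hmono : ∀ x x', len x ≤ len x' → b x ≤ b x')
    {T : M → M → Prop} (hT : ∀ x u, T x u → len u ≤ b x) (h : hypRes M fun x => ∃ u, T x u) :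
    hypPind M fun x => ∃ w, Collected b T x w := by
  refine ⟨?_, fun x hx => ?_⟩
  · obtain ⟨u, hu⟩ := h 0 fun u hu hu' => absurd (hu'.trans_le (hu.trans len_zero.le)) (lt_irrefl _)
    refine ⟨u, ?_, fun j hj => ?_⟩
    · rw [len_zero, zero_add, one_mul]; exact hT _ _ hu
    · rw [len_zero, nonpos_iff_eq_zero] at hj
      rw [hj, msp_zero, block, len_zero, zero_mul, msp_zero, low_eq_self (hT _ _ hu)]
      exact hu
  rcases eq_or_ne x 0 with rfl | hx0
  · rwa [half_zero] at hx
  obtain ⟨w, hw, hw'⟩ := hx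
  have hlen := len_half hx0
  have hlog : ∀ {u : M}, u ≤ len x → IsLog u := fun hu => (isLog_len x).mono hu
  obtain ⟨u, hu⟩ := h x fun j hj hj0 => by
    obtain ⟨j', rfl⟩ := (eq_zero_or_succ j).resolve_left hj0.ne'
    have hj' : j' ≤ len (half x) := by rwa [hlen, add_le_add_iff_right] at hj
    have := hw' j' hj'
    rw [msp_half x (hlog (le_self_add.trans hj))] at this
    exact ⟨_, this⟩
  have hub := hT _ _ hu
  have hN : IsLog (len x * b x) := (isLog_len x).mul (hb x)
  have hwN : w < E (len x * b x) := by
    rw [lt_E_iff hN, hlen]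
    refine hw.trans ?_
    gcongr
    exact hmono _ _ (by rw [hlen]; exact le_self_add)
  -- The new block starts at |x|·b(x). Monotonicity of b ensures that w and all its old blocks end
  -- at or before this position.
  refine ⟨w + u * E (len x * b x), ?_, fun j hj => ?_⟩
  · rw [add_mul, one_mul, ← lt_E_iff (hN.add (hb x)), E_add hN (hb x)]
    calc w + u * E (len x * b x) < E (len x * b x) + u * E (len x * b x) := by gcongr
      _ = E (len x * b x) * (u + 1) := by ring
      _ ≤ _ := by gcongr; exact add_one_le_iff'.2 ((lt_E_iff (hb x)).2 hub)
  · rcases eq_zero_or_succ j with rfl | ⟨j', rfl⟩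
    · rw [msp_zero, block, add_comm, msp_mul_add u hN hwN, low_eq_self hub]
      exact hu
    · have hj' : j' ≤ len (half x) := by rwa [hlen, add_le_add_iff_right] at hj
      rw [← msp_half x (hlog (le_self_add.trans hj))]
      have hlt : len (msp (half x) j') ≤ len (half x) := by
        rw [len_msp]; exact tsub_le_self
      rw [block, low_low_msp_add u hN]
      · exact hw' j' hj'
      · rw [← add_one_mul, hlen]
        gcongr
        exact hmono _ _ (by rw [hlen]; exact hlt.trans le_self_add)

theorem Collected.exists {T : M → M → Prop} {x w : M} (h : Collected b T x w) : ∃ u, T x u := by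
  have := h.2 0 zero_le
  rw [msp_zero] at this
  exact ⟨_, this⟩

/-- The counterpart of collecting witnesses when a sharply bounded universal quantifier can be
absorbed by the class itself. -/
theorem hypPind_initial {P : M → Prop} (h : hypRes M P) :
    hypPind M fun x => ∀ u ≤ len x, P (msp x u) := by
  refine ⟨fun u hu => ?_, fun x hx u hu => ?_⟩
  · rw [len_zero, nonpos_iff_eq_zero] at hu
    rw [hu, msp_zero]
    exact h 0 fun u hu hu' => absurd (hu'.trans_le (hu.trans len_zero.le)) (lt_irrefl _)
  · rcases eq_or_ne x 0 with rfl | hx0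
    · rw [half_zero] at hx; exact hx u hu
    have hlen := len_half hx0
    have key : ∀ j ≤ len x, 0 < j → P (msp x j) := fun j hj hj0 => by
      obtain ⟨j', rfl⟩ := (eq_zero_or_succ j).resolve_left hj0.ne'
      rw [← msp_half x ((isLog_len x).mono (le_self_add.trans hj))]
      exact hx j' (by rwa [hlen, add_le_add_iff_right] at hj)
    rcases eq_or_ne u 0 with rfl | hu0
    · rw [msp_zero]; exact h x key
    · exact key u hu (pos_iff_ne_zero.2 hu0)

end Collection

/-! ### Reducing restricted order induction to polynomial induction -/

/-- A bound on the length of `t`, monotone in the length of the first argument. -/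
theorem exists_mono_bound {n : ℕ} (t : TCFun (n + 1)) : ∃ B : TCFun (n + 1),
    ∀ (M : Type) [TCModel M] (y : Fin n → M),
      (∀ x x', len x ≤ len x' → len (B.ev (Fin.cons x y)) ≤ len (B.ev (Fin.cons x' y))) ∧
      ∀ x u, u ≤ t.ev (Fin.cons x y) → len u ≤ len (B.ev (Fin.cons x y)) := by
  obtain ⟨B, hB⟩ := t.exists_lenBound
  refine ⟨.comp B ![.big .proj], fun M _ y => ⟨fun x x' h => ?_, fun x u hu => ?_⟩⟩
  · rw [TCFun.ev_comp_one, TCFun.ev_comp_one]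
    refine (hB M).1 _ _ (TCFun.len_big_mono _ _ _ _ fun j => ?_)
    refine Fin.cases ?_ (fun j => ?_) j
    · simpa using h
    · simp
  · rw [TCFun.ev_comp_one]
    refine (len_mono hu).trans ((hB M).2 _ _ fun j => ?_)
    have := TCFun.len_le_big .proj (Fin.cons x y : Fin (n + 1) → M) j
    rwa [TCFun.ev_proj'] at this

theorem pindres_to_pind_pi {s : Side} {i : ℕ} (hs : s = .pi ∨ i = 0) :
    StrictlyReduces (hat s i) (hat s i) hypRes concAll hypPind concAll := by
  refine strictlyReduces_of_sem fun k φ hφ => ?_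
  have h := φ.sem_subst hφ (.msp' (.proj 1) (.proj 0)) fun j => .proj (n := k + 2) j.succ.succ
  have h' : Sem s i (n := k + 1) fun M _ v => ∀ u ≤ len ((TCFun.proj 0).ev v),
      φ.holds M (fun j => (TCFun.proj (n := k + 2) j.succ.succ).ev
        (Fin.cons u v : Fin (k + 2) → M))
        ((TCFun.msp' (.proj 1) (.proj 0)).ev (Fin.cons u v : Fin (k + 2) → M)) := by
    rcases hs with rfl | rfl
    · exact h.sharp_ball (.proj 0)
    · exact sem_zero.2 (sem_zero.1 (Sem.sharp_ball (i := 0) (sem_zero.2 (sem_zero.1 h)) (.proj 0)))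
  refine ⟨_, h', fun M _ y hp => ?_⟩
  simp only [TCFun.ev_proj', TCFun.ev_msp', Fin.cons_zero, Fin.cons_one, Fin.cons_succ]
  exact ⟨hypPind_initial hp, fun h x => by simpa [msp_zero] using h x 0 zero_le⟩

/-- A sharply bounded universal quantifier in front of a Σ formula would raise its complexity.
Guessing all witnesses at once moves it inside, in front of a Π formula, where it is absorbed. -/
theorem pindres_to_pind_sigma {i : ℕ} :
    StrictlyReduces (hat .sigma (i + 1)) (hat .sigma (i + 1)) hypRes concAll hypPind concAll := by
  refine strictlyReduces_of_sem fun k φ hφ => ?_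
  obtain ⟨t, Q, hQ, hf⟩ := sem_sigma.1 (IndFm.sem_of_mem hφ)
  obtain ⟨B, hB⟩ := exists_mono_bound t
  let y : Fin k → TCFun (k + 3) := fun j => .proj j.succ.succ.succ
  let x : TCFun (k + 3) := .msp' (.proj 2) (.proj 0)
  let b : TCFun (k + 3) := .len' (.comp B (Fin.cons x y))
  let u : TCFun (k + 3) := .low' (.msp' (.proj 1) (.len' x * b)) b
  have h1 : Sem .pi i (n := k + 3) _ := (Sem.ofOpen (.le' u (.comp t (Fin.cons x y)))).and
    (hQ.comp (Fin.cons u (Fin.cons x y)))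
  have h2 := (Sem.ofOpen (.le' (.len' (.proj 0)) ((.len' (.proj 1) + 1) * .len' B.shift))).and
    (h1.sharp_ball (.proj 1))
  let T : ∀ (M : Type) [TCModel M] (_ : Fin k → M), M → M → Prop := fun M _ y x u =>
    u ≤ t.ev (Fin.cons x y) ∧ Q M (Fin.cons u (Fin.cons x y))
  -- The bound (2x+1) # B has length (|x|+1)·|B| + 1, one more than a collection can have. Using
  -- 2x+1 gives the factor |x|+1 also at x = 0.
  refine ⟨fun M _ v => ∃ w ≤ (TCFun.smash' ((1 + 1) * .proj 0 + 1) B).ev v,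
    Collected (fun x => len (B.ev (Fin.cons x (Fin.tail v)))) (T M (Fin.tail v)) (v 0) w,
    sem_sigma.2 ⟨.smash' ((1 + 1) * .proj 0 + 1) B, _, h2, fun M _ v => ?_⟩, fun M _ z hp => ?_⟩
  · refine exists_congr fun w => and_congr_right fun _ => ?_
    have ex : ∀ j, x.ev (Fin.cons j (Fin.cons w v) : Fin (k + 3) → M) = msp (v 0) j := by
      intro j; simp only [x, TCFun.ev_msp', TCFun.ev_proj']; rfl
    have e1 : ∀ j, (fun l => ((Fin.cons x y : Fin (k + 1) → TCFun (k + 3)) l).ev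
        (Fin.cons j (Fin.cons w v) : Fin (k + 3) → M)) = Fin.cons (msp (v 0) j) (Fin.tail v) := by
      intro j; funext l
      refine Fin.cases ?_ (fun l => ?_) l
      · exact ex j
      · simp only [Fin.cons_succ, y, TCFun.ev_proj']; rfl
    have eu : ∀ j, u.ev (Fin.cons j (Fin.cons w v) : Fin (k + 3) → M) =
        block (fun x => len (B.ev (Fin.cons x (Fin.tail v)))) w (msp (v 0) j) := by
      intro j
      simp only [u, b, TCFun.ev_low', TCFun.ev_msp', TCFun.ev_len', TCFun.ev_mul, ex,
        TCFun.ev_comp', e1, TCFun.ev_proj']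
      rfl
    have e2 : ∀ j, (fun l => ((Fin.cons u (Fin.cons x y) : Fin (k + 2) → TCFun (k + 3)) l).ev
        (Fin.cons j (Fin.cons w v) : Fin (k + 3) → M)) =
        Fin.cons (block (fun x => len (B.ev (Fin.cons x (Fin.tail v)))) w (msp (v 0) j))
          (Fin.cons (msp (v 0) j) (Fin.tail v)) := by
      intro j; funext l
      refine Fin.cases ?_ (fun l => ?_) l
      · exact eu j
      · exact congrFun (e1 j) l
    simp only [Collected, T, TCFun.holds_le', TCFun.ev_len', TCFun.ev_proj', TCFun.ev_mul,
      TCFun.ev_add, TCFun.ev_one, TCFun.ev_shift, Fin.tail_cons, Fin.cons_zero, Fin.cons_one,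
      TCFun.ev_comp', e1, eu, e2]
    rw [show (Fin.cons (v 0) (Fin.tail v) : Fin (k + 1) → M) = v from Fin.cons_self_tail v]
  · have hφ' : φ.holds M z = fun x => ∃ u, T M z x u := by
      funext x
      exact propext (hf M (Fin.cons x z))
    obtain ⟨hB1, hB2⟩ := hB M z
    rw [hφ'] at hp ⊢
    have key := hypPind_collected (b := fun x => len (B.ev (Fin.cons x z)))
      (fun x => isLog_len _) hB1 (fun x u hu => hB2 x u hu.1) hp
    have e : ∀ x : M, (∃ w ≤ (TCFun.smash' ((1 + 1) * .proj 0 + 1) B).ev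
        (Fin.cons x z : Fin (k + 1) → M),
        Collected (fun x => len (B.ev (Fin.cons x z))) (T M z) x w) ↔
        ∃ w, Collected (fun x => len (B.ev (Fin.cons x z))) (T M z) x w := by
      intro x
      refine ⟨fun ⟨w, _, h⟩ => ⟨w, h⟩, fun ⟨w, h⟩ => ⟨w, (lt_of_len_lt ?_).le, h⟩⟩
      simp only [TCFun.ev_smash', TCFun.ev_add, TCFun.ev_mul, TCFun.ev_one, TCFun.ev_proj',
        Fin.cons_zero, one_add_one_eq_two]
      rw [len_smash, len_two_mul_add_one, lt_add_one_iff']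
      exact h.1
    simp only [Fin.tail_cons, Fin.cons_zero, e]
    exact ⟨key, fun h x => (h x).elim fun w hw => hw.exists⟩

theorem pindres_to_pind {s : Side} {i : ℕ} :
    StrictlyReduces (hat s i) (hat s i) hypRes concAll hypPind concAll := by
  cases s with
  | pi => exact pindres_to_pind_pi (.inl rfl)
  | sigma =>
    cases i with
    | zero => exact pindres_to_pind_pi (.inr rfl)
    | succ i => exact pindres_to_pind_sigma

/-! ### Eliminating a universal quantifier by induction on codes of pairs -/

section Codes

variable {M : Type} [TCModel M] {b t : M → M}

/-- `w` is the canonical code of a pair `(x, u)` with `u ≤ t x`. -/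
def IsPairCode (b t : M → M) (w : M) : Prop :=
  codeQ w = b (codeX w) + 1 ∧ codeM w = len (codeX w) ∧ codeU w ≤ t (codeX w)

/-- The canonical code of a pair. -/
noncomputable def pairCode (b : M → M) (x u : M) : M := code (len x) x (b x + 1) u

variable (hb : ∀ x, IsLog (b x)) (ht : ∀ x u, u ≤ t x → len u ≤ b x)

include hb ht in
theorem pairCode_spec {x u : M} (hu : u ≤ t x) :
    x < E (len x) ∧ u < E (b x + 1) ∧ IsPairCode b t (pairCode b x u) ∧
      codeX (pairCode b x u) = x ∧ codeU (pairCode b x u) = u := by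
  have h1 : x < E (len x) := (lt_E_iff (isLog_len x)).2 le_rfl
  have h2 : u < E (b x + 1) := (lt_E_iff (hb x).add_one).2 ((ht x u hu).trans le_self_add)
  have hX := codeX_code (isLog_len x) (hb x).add_one h1 h2
  have hU := codeU_code (isLog_len x) (hb x).add_one h1 h2
  refine ⟨h1, h2, ⟨?_, ?_, ?_⟩, hX, hU⟩
  · rw [pairCode, hX]; exact codeQ_code (isLog_len x) (hb x).add_one h1 h2
  · rw [pairCode, hX]; exact codeM_code (isLog_len x) (hb x).add_one h1 h2
  · rw [pairCode, hX, hU]; exact hu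

-- If x' and x have the same length, their codes have the same layout and the first component
-- decides. Otherwise the code of the shorter one is shorter, whatever the second components are.
include hb ht in
theorem pairCode_lt (hmono : ∀ x x', len x ≤ len x' → b x ≤ b x') {x u x' u' : M} (hx : x' < x)
    (hu : u ≤ t x) (hu' : u' ≤ t x') :
    pairCode b x' u' < pairCode b x u ∧
      (len x' < len x → len (pairCode b x' u') < len (pairCode b x u)) := by
  obtain ⟨h1, h2, -⟩ := pairCode_spec hb ht hu
  obtain ⟨h1', h2', -⟩ := pairCode_spec hb ht hu'
  have hlen : len x' < len x → len (pairCode b x' u') < len (pairCode b x u) := fun h => by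
    rw [pairCode, pairCode, (code_spec (isLog_len x) (hb x).add_one h1 h2).1,
      (code_spec (isLog_len x') (hb x').add_one h1' h2').1]
    exact add_lt_add_left (add_lt_add_of_le_of_lt (add_le_add_left (hmono x' x h.le) 1)
      (mul_lt_mul_of_pos_left h two_pos)) 2
  refine ⟨?_, hlen⟩
  rcases (len_mono hx.le).eq_or_lt with h | h
  · have hbb : b x' = b x := le_antisymm (hmono _ _ h.le) (hmono _ _ h.ge)
    rw [hbb] at h2'
    rw [pairCode, pairCode, h, hbb, code, code]
    refine add_lt_add_right (add_lt_add_right ?_ _) _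
    calc x' * E (b x + 1) + u' < x' * E (b x + 1) + E (b x + 1) := by gcongr
      _ = (x' + 1) * E (b x + 1) := by ring
      _ ≤ x * E (b x + 1) := by gcongr; exact add_one_le_iff'.2 hx
      _ ≤ _ := le_self_add
  · exact lt_of_len_lt (hlen h)

/-- The second component is given b + 1 digits rather than b, so that its width is nonzero and
`eq_code` applies. -/
theorem IsPairCode.eq {w : M} (h : IsPairCode b t w) : w = pairCode b (codeX w) (codeU w) := by
  obtain ⟨h1, h2, -⟩ := h
  have hq : codeQ w ≠ 0 := by rw [h1]; simp
  have := (eq_code hq).2.2.2.2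
  rwa [h1, h2] at this

variable {P : M → Prop} {Q : M → M → Prop} (hP : ∀ x, P x ↔ ∀ u ≤ t x, Q x u)

-- If w codes (x+1, u), every code of a pair (x, u') lies below w; so the hypothesis at smaller
-- numbers yields Q(x, u') for all u' ≤ t(x), that is P(x), and P(x+1) follows.
include hb ht hP in
theorem hypLt_pairCode (hmono : ∀ x x', len x ≤ len x' → b x ≤ b x') (h : hypInd M P) :
    hypLt M fun w => IsPairCode b t w → Q (codeX w) (codeU w) := by
  intro w hw hc
  suffices hX : P (codeX w) from (hP _).1 hX _ hc.2.2
  rcases eq_zero_or_succ (codeX w) with h0 | ⟨x, hx⟩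
  · rw [h0]; exact h.1
  · rw [hx]
    refine h.2 x ((hP x).2 fun u hu => ?_)
    have hlt : x < codeX w := by rw [hx, lt_add_one_iff']
    obtain ⟨-, -, h1, h2, h3⟩ := pairCode_spec hb ht hu
    have hlt' := (pairCode_lt hb ht hmono hlt hc.2.2 hu).1
    rw [← hc.eq] at hlt'
    have := hw _ hlt' h1
    rwa [h2, h3] at this

-- The same argument with ⌊x/2⌋ in place of the predecessor, codes now being compared by length.
include hb ht hP in
theorem hypLenLt_pairCode (hmono : ∀ x x', len x ≤ len x' → b x ≤ b x') (h : hypPind M P) :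
    hypLenLt M fun w => IsPairCode b t w → Q (codeX w) (codeU w) := by
  intro w hw hc
  suffices hX : P (codeX w) from (hP _).1 hX _ hc.2.2
  rcases eq_or_ne (codeX w) 0 with h0 | h0
  · rw [h0]; exact h.1
  · refine h.2 _ ((hP _).2 fun u hu => ?_)
    have hlen : len (half (codeX w)) < len (codeX w) := by
      rw [len_half h0, lt_add_one_iff']
    obtain ⟨-, -, h1, h2, h3⟩ := pairCode_spec hb ht hu
    have hlt := (pairCode_lt hb ht hmono (lt_of_len_lt hlen) hc.2.2 hu).2 hlen
    rw [← hc.eq] at hlt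
    have := hw _ hlt h1
    rwa [h2, h3] at this

include hb ht hP in
theorem concAll_pairCode (h : ∀ w, IsPairCode b t w → Q (codeX w) (codeU w)) (x : M) : P x := by
  refine (hP x).2 fun u hu => ?_
  obtain ⟨-, -, h1, h2, h3⟩ := pairCode_spec hb ht hu
  have := h _ h1
  rwa [h2, h3] at this

end Codes

/-- Being a code is an open condition, so "if w is a code then the matrix holds" is only Σ at level
i: the outer universal quantifier has moved into the induction variable. -/
theorem exists_sem_pairCode {i k : ℕ} {φ : IndFm k} (hφ : φ ∈ hat .pi (i + 1) k) :
    ∃ P : UPred (k + 1), Sem .sigma i P ∧ ∀ (M : Type) [TCModel M] (y : Fin k → M),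
      ∃ (b t : M → M) (Q : M → M → Prop), (∀ x, IsLog (b x)) ∧ (∀ x u, u ≤ t x → len u ≤ b x) ∧
        (∀ x x', len x ≤ len x' → b x ≤ b x') ∧
        (∀ x, φ.holds M y x ↔ ∀ u ≤ t x, Q x u) ∧
        ∀ w, P M (Fin.cons w y) ↔ (IsPairCode b t w → Q (codeX w) (codeU w)) := by
  obtain ⟨t, Q, hQ, hf⟩ := sem_pi.1 (IndFm.sem_of_mem hφ)
  obtain ⟨B, hB⟩ := exists_mono_bound t
  let X : TCFun (k + 1) := .codeX' (.proj 0)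
  let U : TCFun (k + 1) := .codeU' (.proj 0)
  let xy : Fin (k + 1) → TCFun (k + 1) := Fin.cons X fun j => .proj j.succ
  refine ⟨_, Sem.imp (Sem.ofOpen (.eq' (.codeQ' (.proj 0)) (.len' (.comp B xy) + 1) *
    (.eq' (.codeM' (.proj 0)) (.len' X) * .le' U (.comp t xy)))) (hQ.comp (Fin.cons U xy)),
    fun M _ y => ⟨fun x => len (B.ev (Fin.cons x y)), fun x => t.ev (Fin.cons x y),
      fun x u => Q M (Fin.cons u (Fin.cons x y)), fun x => isLog_len _, (hB M y).2, (hB M y).1,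
      fun x => hf M (Fin.cons x y), fun w => ?_⟩⟩
  have e1 : (fun j => (xy j).ev (Fin.cons w y : Fin (k + 1) → M)) = Fin.cons (codeX w) y := by
    funext j
    refine Fin.cases ?_ (fun j => ?_) j <;> simp [xy, X]
  have e2 : (fun j => ((Fin.cons U xy : Fin (k + 2) → TCFun (k + 1)) j).ev
      (Fin.cons w y : Fin (k + 1) → M)) = Fin.cons (codeU w) (Fin.cons (codeX w) y) := by
    funext j
    refine Fin.cases ?_ (fun j => ?_) j
    · simp [U]
    · exact congrFun e1 j
  simp only [TCFun.holds_mul, TCFun.holds_eq', TCFun.holds_le', TCFun.ev_codeQ', TCFun.ev_codeM',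
    TCFun.ev_add, TCFun.ev_len', TCFun.ev_comp', TCFun.ev_one, TCFun.ev_proj', Fin.cons_zero,
    e1, e2, IsPairCode, X, U, TCFun.ev_codeX', TCFun.ev_codeU']

theorem ind_to_indlt_sigma {i : ℕ} :
    StrictlyReduces (hat .pi (i + 1)) (hat .sigma i) hypInd concAll hypLt concAll := by
  refine strictlyReduces_of_sem fun k φ hφ => ?_
  obtain ⟨P, hP, H⟩ := exists_sem_pairCode hφ
  refine ⟨P, hP, fun M _ y hp => ?_⟩
  obtain ⟨b, t, Q, hb, ht, hmono, h1, h2⟩ := H M y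
  simp only [h2]
  exact ⟨hypLt_pairCode hb ht h1 hmono hp, concAll_pairCode hb ht h1⟩

theorem pind_to_pindlt_sigma {i : ℕ} :
    StrictlyReduces (hat .pi (i + 1)) (hat .sigma i) hypPind concAll hypLenLt concAll := by
  refine strictlyReduces_of_sem fun k φ hφ => ?_
  obtain ⟨P, hP, H⟩ := exists_sem_pairCode hφ
  refine ⟨P, hP, fun M _ y hp => ?_⟩
  obtain ⟨b, t, Q, hb, ht, hmono, h1, h2⟩ := H M y
  simp only [h2]
  exact ⟨hypLenLt_pairCode hb ht h1 hmono hp, concAll_pairCode hb ht h1⟩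

/-! ### Rules with the base case in the conclusion -/

section BaseCase

variable {s : Side} {i : ℕ}

def hypStep : SetCond := fun _ _ P => ∀ x, P x → P (x + 1)
def hypHalf : SetCond := fun _ _ P => ∀ x, P (half x) → P x
def concFromZero : SetCond := fun _ _ P => P 0 → ∀ x, P x
def concLenFromZero : SetCond := fun _ _ P => P 0 → ∀ x, P (len x)

theorem ind_to_ind0 : StrictlyReduces (hat s i) (hat s i) hypInd concAll hypStep concFromZero :=
  strictlyReduces_of_subset (fun _ => subset_rfl) fun _ _ _ h => ⟨h.2, fun h' => h' h.1⟩

theorem pind_to_pind0 :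
    StrictlyReduces (hat s i) (hat s i) hypPind concAll hypHalf concFromZero :=
  strictlyReduces_of_subset (fun _ => subset_rfl) fun _ _ _ h => ⟨h.2, fun h' => h' h.1⟩

/-- For i > 0 the quantifier is the leading one, its bound being moved into R. For i = 0 the
variable z is a dummy. -/
theorem Sem.exists_witness {n : ℕ} {P : UPred n} (h : Sem .sigma i P) :
    ∃ R : UPred (n + 1), Sem .pi i R ∧
      ∀ (M : Type) [TCModel M] v, P M v ↔ ∃ z, R M (Fin.cons z v) := by
  cases i with
  | zero =>
    refine ⟨_, (sem_zero (s := .pi)).2 (sem_zero.1 (h.comp fun j => .proj j.succ)),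
      fun M _ v => ?_⟩
    simp
  | succ i =>
    obtain ⟨t, Q, hQ, hf⟩ := sem_sigma.1 h
    refine ⟨_, ((Sem.ofOpen (.le' (.proj 0) t.shift)).and hQ).same_succ, fun M _ v => ?_⟩
    simp [hf]

/-- The implication φ(0) → φ(x) is not Σ in general, but R(z) → φ(x) is, with a witness z for φ(0)
as parameter. -/
theorem exists_sem_of_witness {k : ℕ} {φ : IndFm k} (hφ : φ ∈ hat .sigma i k) :
    ∃ (P : UPred (k + 1 + 1)) (R : UPred (k + 1)), Sem .sigma i P ∧
      ∀ (M : Type) [TCModel M] (y : Fin k → M),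
        (∀ x z, P M (Fin.cons x (Fin.cons z y)) ↔ (R M (Fin.cons z y) → φ.holds M y x)) ∧
        (φ.holds M y 0 ↔ ∃ z, R M (Fin.cons z y)) := by
  obtain ⟨R, hR, hf⟩ := Sem.exists_witness (φ.sem_subst hφ (N := k) 0 .proj)
  refine ⟨_, R, Sem.imp (hR.comp fun j => .proj j.succ)
    (φ.sem_subst hφ (.proj 0) fun j => .proj j.succ.succ), fun M _ y => ⟨fun x z => ?_, ?_⟩⟩
  · simp only [TCFun.ev_proj', Fin.cons_succ, Fin.cons_zero]
  · rw [← hf M y]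
    simp only [TCFun.ev_proj', TCFun.ev_zero]

theorem ind0_to_ind :
    Reduces (hat .sigma i) (hat .sigma i) hypStep concFromZero hypInd concAll := by
  refine reduces_of_sem fun k φ hφ => ?_
  obtain ⟨P, R, hP, H⟩ := exists_sem_of_witness hφ
  refine ⟨P, hP, fun M _ y hp => ?_⟩
  obtain ⟨h1, h2⟩ := H M y
  simp only [h1]
  exact ⟨fun z => ⟨fun hz => h2.2 ⟨z, hz⟩, fun x hx hz => hp x (hx hz)⟩,
    fun h h0 x => (h2.1 h0).elim fun z hz => h z x hz⟩

theorem pind0_to_pind :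
    Reduces (hat .sigma i) (hat .sigma i) hypHalf concFromZero hypPind concAll := by
  refine reduces_of_sem fun k φ hφ => ?_
  obtain ⟨P, R, hP, H⟩ := exists_sem_of_witness hφ
  refine ⟨P, hP, fun M _ y hp => ?_⟩
  obtain ⟨h1, h2⟩ := H M y
  simp only [h1]
  exact ⟨fun z => ⟨fun hz => h2.2 ⟨z, hz⟩, fun x hx hz => hp x (hx hz)⟩,
    fun h h0 x => (h2.1 h0).elim fun z hz => h z x hz⟩

/-- Run the induction backwards: for ¬φ(z - x), with z as a parameter, the step is the
contrapositive of the given one, and x = z leads from ¬φ(z) to ¬φ(0). -/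
theorem ind0_dual :
    Reduces (hat s i) (hat s.dual i) hypStep concFromZero hypStep concFromZero := by
  refine reduces_of_sem fun k φ hφ => ⟨_, (φ.sem_subst hφ (.proj 1 - .proj 0)
    fun j => .proj j.succ.succ).not, fun M _ y hp => ?_⟩
  simp only [hypStep, concFromZero, TCFun.ev_sub, TCFun.ev_proj', Fin.cons_zero, Fin.cons_one,
    Fin.cons_succ]
  refine ⟨fun z x hx => ?_, fun h h0 x => ?_⟩
  · rcases lt_or_ge x z with hlt | hle
    · refine fun h' => hx ?_
      have := hp _ h'
      rwa [← tsub_tsub, tsub_add_cancel_of_le (pos_iff_one_le.1 (tsub_pos_of_lt hlt))] at this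
    -- For x ≥ z truncated subtraction leaves 0 at both ends of the step.
    · rwa [tsub_eq_zero_of_le (hle.trans le_self_add), ← tsub_eq_zero_of_le hle]
  · by_contra hx
    have := h x (by rwa [tsub_zero]) x
    rw [tsub_self] at this
    exact this h0

/-- The polynomial analogue uses ¬φ(⌊z/2^|x|⌋): each further digit of x strips one digit from z, and
x = z leaves 0. -/
theorem pind0_dual :
    Reduces (hat s i) (hat s.dual i) hypHalf concFromZero hypHalf concFromZero := by
  refine reduces_of_sem fun k φ hφ => ⟨_, (φ.sem_subst hφ (.msp' (.proj 1) (.len' (.proj 0)))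
    fun j => .proj j.succ.succ).not, fun M _ y hp => ?_⟩
  simp only [hypHalf, concFromZero, TCFun.ev_msp', TCFun.ev_len', TCFun.ev_proj', Fin.cons_zero,
    Fin.cons_one, Fin.cons_succ]
  refine ⟨fun z x hx => ?_, fun h h0 x => ?_⟩
  · rcases eq_or_ne x 0 with rfl | hx0
    · rwa [half_zero] at hx
    · refine fun h' => hx (hp _ ?_)
      rwa [← msp_add_one, ← len_half hx0]
  · by_contra hx
    have := h x (by rwa [len_zero, msp_zero]) x
    rw [msp_len] at this
    exact this h0

theorem lind0_to_pind0 :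
    StrictlyReduces (hat s i) (hat s i) hypStep concLenFromZero hypHalf concFromZero := by
  refine strictlyReduces_of_sem fun k φ hφ => ⟨_, φ.sem_subst hφ (.len' (.proj 0))
    fun j => .proj j.succ, fun M _ y hp => ?_⟩
  simp only [hypHalf, concFromZero, concLenFromZero, TCFun.ev_len', TCFun.ev_proj', Fin.cons_zero,
    Fin.cons_succ, len_zero]
  refine ⟨fun x hx => ?_, id⟩
  rcases eq_or_ne x 0 with rfl | h
  · rwa [half_zero] at hx
  · rw [len_half h]; exact hp _ hx

theorem pind0_to_lind0 :
    Reduces (hat s i) (hat s i) hypHalf concFromZero hypStep concLenFromZero := by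
  refine reduces_of_sem fun k φ hφ => ⟨_, φ.sem_subst hφ
    (.msp' (.proj 1) (.len' (.proj 1) - .proj 0)) fun j => .proj j.succ.succ, fun M _ y hp => ?_⟩
  simp only [hypStep, concFromZero, concLenFromZero, TCFun.ev_len', TCFun.ev_proj', Fin.cons_zero,
    Fin.cons_succ, TCFun.ev_msp', TCFun.ev_sub, Fin.cons_one]
  refine ⟨fun z x hx => ?_, fun h h0 z => ?_⟩
  · rcases lt_or_ge x (len z) with h | h
    · refine hp _ ?_
      rw [← msp_add_one, ← tsub_tsub, tsub_add_cancel_of_le]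
      · exact hx
      · rw [← pos_iff_one_le]; exact tsub_pos_of_lt h
    · rwa [tsub_eq_zero_of_le h, ← tsub_eq_zero_of_le (h.trans le_self_add : len z ≤ x + 1)] at hx
  · have := h z (by rwa [tsub_zero, msp_len]) z
    rwa [tsub_self, msp_zero] at this

end BaseCase

/-! ### Elimination of parameters -/

section Parameters

variable {M : Type} [TCModel M]

theorem codeU_zero : codeU (0 : M) = 0 := by
  simp [codeU, drop, low]

/-- A component of width 0 is a remainder modulo 1. Hence a nonzero second component suffices for w
to be a genuine code. -/
theorem codeQ_ne_zero {w : M} (h : codeU w ≠ 0) : codeQ w ≠ 0 := by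
  intro h0
  apply h
  rw [codeU, h0, low_eq _ 0, msp_zero, E_zero, mul_one, tsub_self]

/-- If w+1 has second component u+1, then w codes the same parameter with u. Otherwise the second
component of w+1 is 0 and the base case for its parameter applies; no relation to w is needed. -/
theorem hypInd_code {P : M → M → Prop} (h : ∀ y, hypInd M (P y)) :
    hypInd M fun w => P (codeX w) (codeU w) := by
  refine ⟨by beta_reduce; rw [codeU_zero]; exact (h _).1, fun w hw => ?_⟩
  rcases eq_zero_or_succ (codeU (w + 1)) with h0 | ⟨u, hu⟩
  · rw [h0]; exact (h _).1
  · obtain ⟨hm, hq, hX, hU, he⟩ := eq_code (codeQ_ne_zero (w := w + 1) (by rw [hu]; simp))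
    generalize codeX (w + 1) = X at *
    generalize codeM (w + 1) = m at *
    generalize codeQ (w + 1) = q at *
    rw [hu] at hU he ⊢
    have hU' : u < E q := lt_trans (lt_add_one_iff'.2 le_rfl) hU
    have hw' : w = code m X q u := by
      have : code m X q (u + 1) = code m X q u + 1 := by simp only [code, add_assoc]
      rw [this] at he
      exact add_right_cancel he
    rw [hw', codeX_code hm hq hX hU', codeU_code hm hq hX hU'] at hw
    exact (h X).2 u hw

/-- Halving a code with nonzero second component u keeps the parameter, halves u and shortens its
width q by one digit. This is why leading zeros of u are allowed. -/
theorem hypPind_code {P : M → M → Prop} (h : ∀ y, hypPind M (P y)) :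
    hypPind M fun w => P (codeX w) (codeU w) := by
  refine ⟨by beta_reduce; rw [codeU_zero]; exact (h _).1, fun w hw => ?_⟩
  rcases eq_or_ne (codeU w) 0 with h0 | h0
  · rw [h0]; exact (h _).1
  · obtain ⟨hm, hq, hX, hU, he⟩ := eq_code (codeQ_ne_zero h0)
    obtain ⟨q, hq'⟩ := (eq_zero_or_succ (codeQ w)).resolve_left (codeQ_ne_zero h0)
    generalize codeX w = X at *
    generalize codeM w = m at *
    generalize codeU w = u at *
    rw [hq'] at hq hU he
    have hq0 : IsLog q := hq.mono le_self_add
    have hU' : half u < E q := by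
      rw [E_add_one hq0] at hU
      exact lt_of_mul_lt_mul_left ((two_mul_half_le u).trans_lt hU) zero_le
    have h2 : code m X (q + 1) (2 * half u) = 2 * code m X q (half u) := by
      have e1 : E (q + 1 + 2 * m + 1) = 2 * E (q + 2 * m + 1) := by
        rw [← E_add_one ((hq0.add (isLog_two.mul hm)).add_one)]; congr 1; ring
      have e2 : E (q + 1 + m) = 2 * E (q + m) := by
        rw [← E_add_one (hq0.add hm)]; congr 1; ring
      rw [code, code, e1, e2, E_add_one hq0]; ring
    have hw' : half w = code m X q (half u) := by
      rcases half_spec u with hu | hu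
      · rw [he]
        conv_lhs => rw [hu]
        rw [h2, half_two_mul]
      · have : code m X (q + 1) (2 * half u + 1) = 2 * code m X q (half u) + 1 := by
          rw [← h2]; simp only [code, add_assoc]
        rw [he]
        conv_lhs => rw [hu]
        rw [this, half_two_mul_add_one]
    rw [hw', codeX_code hm hq0 hX hU', codeU_code hm hq0 hX hU'] at hw
    exact (h X).2 u hw

theorem forall_of_forall_code {P : M → M → Prop} (h : ∀ w, P (codeX w) (codeU w)) (y x : M) :
    P y x := by
  have h1 : y < E (len y) := (lt_E_iff (isLog_len y)).2 le_rfl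
  have h2 : x < E (len x) := (lt_E_iff (isLog_len x)).2 le_rfl
  have := h (code (len y) y (len x) x)
  rwa [codeX_code (isLog_len y) (isLog_len x) h1 h2,
    codeU_code (isLog_len y) (isLog_len x) h1 h2] at this

end Parameters

/-- Parameters are absorbed one at a time. Since the parameter changes with w, the premises are
needed for all parameter values at once, which a rule provides. -/
theorem exists_parameter_free {s : Side} {i : ℕ} {p : SetCond}
    (hp : ∀ (M : Type) [TCModel M] (P : M → M → Prop), (∀ y, p M (P y)) →
      p M fun w => P (codeX w) (codeU w)) :
    ∀ (k : ℕ), ∀ φ ∈ hat s i k, ∃ ψ ∈ hat s i 0, ∀ (M : Type) [TCModel M],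
      ((∀ y, p M (φ.holds M y)) → ∀ y, p M (ψ.holds M y)) ∧
        ((∀ y, concAll M (ψ.holds M y)) → ∀ y, concAll M (φ.holds M y)) := by
  intro k
  induction k with
  | zero => exact fun φ hφ => ⟨φ, hφ, fun M _ => ⟨id, id⟩⟩
  | succ k ih =>
    intro φ hφ
    obtain ⟨χ, hχ, H⟩ := (φ.sem_subst hφ (.codeU' (.proj 0))
      (Fin.cons (.codeX' (.proj 0)) fun j => .proj j.succ)).exists_mem (k := k)
    obtain ⟨ψ, hψ, H'⟩ := ih χ hχ
    refine ⟨ψ, hψ, fun M _ => ?_⟩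
    have e : ∀ y, χ.holds M y = fun w => φ.holds M (Fin.cons (codeX w) y) (codeU w) := by
      intro y; funext w
      rw [H]
      refine propext (iff_of_eq (congrArg₂ _ ?_ ?_))
      · funext j
        refine Fin.cases ?_ (fun j => ?_) j <;> simp
      · simp
    refine ⟨fun h y => (H' M).1 (fun y => ?_) y, fun h y x => ?_⟩
    · rw [e]
      exact hp M (fun z => φ.holds M (Fin.cons z y)) fun z => h _
    · have := forall_of_forall_code (P := fun z => φ.holds M (Fin.cons z (Fin.tail y)))
        (fun w => by
          have := (H' M).2 h (Fin.tail y) w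
          rwa [e] at this) (y 0) x
      rwa [Fin.cons_self_tail] at this

theorem reducible_free {s : Side} {i : ℕ} {S : Scheme} {p : SetCond} (hS : Represents S p concAll)
    (hp : ∀ (M : Type) [TCModel M] (P : M → M → Prop), (∀ y, p M (P y)) →
      p M fun w => P (codeX w) (codeU w)) :
    Reducible ((hat s i).rule S) ((hat s i).ruleFree S) := by
  rw [ruleFree_eq]
  refine reducible_of hS hS fun k φ hφ => ?_
  obtain ⟨ψ, hψ, H⟩ := exists_parameter_free hp k φ hφ
  exact ⟨0, ψ, ⟨rfl, hψ⟩, fun M _ h => ⟨(H M).1 h, (H M).2⟩⟩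

theorem ruleFree_subset (Γ : FmClass) (S : Scheme) : Reducible (Γ.ruleFree S) (Γ.rule S) := by
  intro T _ σ hσ
  refine Theory.models_sentence_iff.2 fun M => ?_
  have hM := M.is_model
  have : M ⊨ (T ∪ {τ | ∃ Δ : List LTC.Sentence, (Δ, τ) ∈ Γ.ruleFree S ∧ ∀ δ ∈ Δ, T ⊨ᵇ δ}) := by
    refine hM.mono (Set.union_subset_union_right _ ?_)
    rintro τ ⟨Δ, ⟨φ, hφ, h⟩, hΔ⟩
    exact ⟨Δ, ⟨0, φ, hφ, h⟩, hΔ⟩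
  exact hσ.realize_sentence M

/-! ### Absoluteness of bounded sentences -/

section Standard

variable {M N : Type} [TCModel M] [TCModel N]

/-- The elements `a` and `b` are equal to the same numeral. -/
def SameNumeral (a : M) (b : N) : Prop := ∃ n : ℕ, a = n ∧ b = n

/-- Numerals form an initial segment of every model, so quantifiers bounded by numerals range over
the same numbers everywhere. -/
theorem exists_eq_natCast {a : M} : ∀ {n : ℕ}, a ≤ n → ∃ m : ℕ, a = m
  | 0, h => ⟨0, by simpa using h⟩
  | n + 1, h => by
    rcases h.eq_or_lt with h | h
    · exact ⟨n + 1, h⟩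
    · rw [Nat.cast_add, Nat.cast_one, lt_add_one_iff'] at h
      exact exists_eq_natCast h

theorem half_natCast (n : ℕ) : half (n : M) = (n / 2 : ℕ) := by
  symm
  rw [eq_half_iff]
  rcases Nat.even_or_odd' n with ⟨m, rfl | rfl⟩
  · left; rw [Nat.mul_div_cancel_left m two_pos]; push_cast; rfl
  · right; rw [show (2 * m + 1) / 2 = m by omega]; push_cast; rfl

theorem msp_natCast (n k : ℕ) : msp (n : M) k = (n / 2 ^ k : ℕ) := by
  induction k with
  | zero => simp [msp_zero]
  | succ k ih =>
    rw [Nat.cast_add, Nat.cast_one, msp_add_one, ih, half_natCast, Nat.div_div_eq_div_mul, pow_succ]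

theorem sameNumeral_len (n : ℕ) : SameNumeral (len (n : M)) (len (n : N)) := by
  induction n using Nat.strong_induction_on with
  | _ n ih =>
    rcases Nat.eq_zero_or_pos n with rfl | hn
    · exact ⟨0, by simp [len_zero], by simp [len_zero]⟩
    · obtain ⟨m, h1, h2⟩ := ih (n / 2) (by omega)
      refine ⟨m + 1, ?_, ?_⟩
      · rw [len_half (by exact_mod_cast hn.ne'), half_natCast, h1]; push_cast; rfl
      · rw [len_half (by exact_mod_cast hn.ne'), half_natCast, h2]; push_cast; rfl

theorem sameNumeral_pw (n : ℕ) : SameNumeral (pw (n : M)) (pw (n : N)) := by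
  induction n using Nat.strong_induction_on with
  | _ n ih =>
    rcases Nat.eq_zero_or_pos n with rfl | hn
    · exact ⟨1, by simp [pw_zero], by simp [pw_zero]⟩
    · obtain ⟨m, h1, h2⟩ := ih (n / 2) (by omega)
      refine ⟨2 * m, ?_, ?_⟩
      · rw [pw_half (by exact_mod_cast hn.ne'), half_natCast, h1]; push_cast; rfl
      · rw [pw_half (by exact_mod_cast hn.ne'), half_natCast, h2]; push_cast; rfl

theorem smash_half {a : M} (h : a ≠ 0) (c : M) : smash a c = smash (half a) c * pw c := by
  rw [pw, ← smash_mul_of_len]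
  rw [len_one]; exact len_half h

theorem sameNumeral_smash (n k : ℕ) :
    SameNumeral (smash (n : M) k) (smash (n : N) k) := by
  obtain ⟨l, hl1, hl2⟩ := sameNumeral_pw (M := M) (N := N) k
  induction n using Nat.strong_induction_on with
  | _ n ih =>
    rcases Nat.eq_zero_or_pos n with rfl | hn
    · exact ⟨1, by simp [zero_smash], by simp [zero_smash]⟩
    · obtain ⟨m, h1, h2⟩ := ih (n / 2) (by omega)
      refine ⟨m * l, ?_, ?_⟩
      · rw [smash_half (by exact_mod_cast hn.ne'), half_natCast, h1, hl1]; push_cast; rfl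
      · rw [smash_half (by exact_mod_cast hn.ne'), half_natCast, h2, hl2]; push_cast; rfl

theorem sub_natCast (n k : ℕ) : (n : M) - (k : M) = (n - k : ℕ) := by
  rcases le_total n k with h | h
  · rw [Nat.sub_eq_zero_of_le h, Nat.cast_zero, tsub_eq_zero_of_le (by exact_mod_cast h)]
  · obtain ⟨d, rfl⟩ := Nat.exists_eq_add_of_le h
    rw [Nat.add_sub_cancel_left]; push_cast; rw [add_tsub_cancel_left]

theorem odd_natCast_iff (w j : ℕ) :
    msp (w : M) j = 2 * half (msp (w : M) j) + 1 ↔ w.testBit j = true := by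
  rw [msp_natCast, half_natCast, Nat.testBit_eq_decide_div_mod_eq, decide_eq_true_iff]
  norm_cast
  generalize w / 2 ^ j = q
  omega

/-- The length bound forces both values to be numerals, and their digits agree: below |a| they are
prescribed by h, above they vanish. -/
theorem sameNumeral_bits {n : ℕ} {h : TCFun (n + 1)} (v : Fin (n + 1) → M) (w : Fin (n + 1) → N)
    (hv : ∀ j, SameNumeral (v j) (w j))
    (ih : ∀ (v : Fin (n + 1) → M) (w : Fin (n + 1) → N), (∀ j, SameNumeral (v j) (w j)) →
      SameNumeral (h.ev v) (h.ev w)) : SameNumeral ((TCFun.bits h).ev v) ((TCFun.bits h).ev w) := by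
  obtain ⟨a, ha, ha'⟩ := hv 0
  obtain ⟨e, he, he'⟩ := sameNumeral_pw (M := M) (N := N) a
  obtain ⟨l, hl, hl'⟩ := sameNumeral_len (M := M) (N := N) a
  rw [← Fin.cons_self_tail v, ← Fin.cons_self_tail w, ha, ha']
  obtain ⟨h1, h2⟩ := ev_bits h (a : M) (Fin.tail v)
  obtain ⟨h1', h2'⟩ := ev_bits h (a : N) (Fin.tail w)
  have hb : ∃ m : ℕ, (TCFun.bits h).ev (Fin.cons (a : M) (Fin.tail v)) = m :=
    exists_eq_natCast (he ▸ (lt_pw_iff.2 h1).le)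
  have hb' : ∃ m : ℕ, (TCFun.bits h).ev (Fin.cons (a : N) (Fin.tail w)) = m :=
    exists_eq_natCast (he' ▸ (lt_pw_iff.2 h1').le)
  obtain ⟨m, hm⟩ := hb
  obtain ⟨m', hm'⟩ := hb'
  rw [hm] at h1 h2
  rw [hm'] at h1' h2'
  rw [hl] at h1 h2
  rw [hl'] at h1' h2'
  refine ⟨m, hm, hm'.trans (congrArg _ (Nat.eq_of_testBit_eq fun j => ?_))⟩
  rcases lt_or_ge j l with hj | hj
  · have k1 := h2 j (by exact_mod_cast not_le.2 hj)
    have k2 := h2' j (by exact_mod_cast not_le.2 hj)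
    rw [two_eq, succ_eq, odd_natCast_iff] at k1 k2
    obtain ⟨c, hc, hc'⟩ := ih (Fin.cons (j : M) (Fin.tail v)) (Fin.cons (j : N) (Fin.tail w))
      (Fin.cases ⟨j, rfl, rfl⟩ fun j => hv j.succ)
    rw [hc, Nat.cast_ne_zero] at k1
    rw [hc', Nat.cast_ne_zero] at k2
    exact Bool.eq_iff_iff.2 (k2.trans k1.symm)
  · have k1 : msp (m : M) j = 0 := msp_eq_zero (h1.trans (by exact_mod_cast hj))
    have k2 : msp (m' : N) j = 0 := msp_eq_zero (h1'.trans (by exact_mod_cast hj))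
    rw [msp_natCast, Nat.cast_eq_zero] at k1 k2
    rw [Nat.testBit_eq_decide_div_mod_eq, Nat.testBit_eq_decide_div_mod_eq, k1, k2]

theorem sameNumeral_search {n : ℕ} {h : TCFun (n + 1)} (v : Fin (n + 1) → M)
    (w : Fin (n + 1) → N) (hv : ∀ j, SameNumeral (v j) (w j))
    (ih : ∀ (v : Fin (n + 1) → M) (w : Fin (n + 1) → N), (∀ j, SameNumeral (v j) (w j)) →
      SameNumeral (h.ev v) (h.ev w)) :
    SameNumeral ((TCFun.search h).ev v) ((TCFun.search h).ev w) := by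
  obtain ⟨a, ha, ha'⟩ := hv 0
  obtain ⟨l, hl, hl'⟩ := sameNumeral_len (M := M) (N := N) a
  rw [← Fin.cons_self_tail v, ← Fin.cons_self_tail w, ha, ha']
  obtain ⟨h1, h2, h3⟩ := ev_search h (a : M) (Fin.tail v)
  obtain ⟨h1', h2', h3'⟩ := ev_search h (a : N) (Fin.tail w)
  rw [hl] at h1 h2
  rw [hl'] at h1' h2'
  obtain ⟨m, hm⟩ := exists_eq_natCast h1
  obtain ⟨m', hm'⟩ := exists_eq_natCast h1'
  rw [hm] at h1 h2 h3
  rw [hm'] at h1' h2' h3'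
  have key : ∀ j : ℕ, h.ev (Fin.cons (j : M) (Fin.tail v)) = 0 ↔
      h.ev (Fin.cons (j : N) (Fin.tail w)) = 0 := by
    intro j
    obtain ⟨c, hc, hc'⟩ := ih (Fin.cons (j : M) (Fin.tail v)) (Fin.cons (j : N) (Fin.tail w))
      (Fin.cases ⟨j, rfl, rfl⟩ fun j => hv j.succ)
    rw [hc, hc', Nat.cast_eq_zero, Nat.cast_eq_zero]
  refine ⟨m, hm, hm'.trans (congrArg _ ?_)⟩
  norm_cast at h1 h1' h2 h2'
  rcases lt_trichotomy m m' with hlt | heq | hgt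
  · exact absurd ((key m).2 (h3' m (by exact_mod_cast not_le.2 hlt))) (h2 (by omega))
  · exact heq.symm
  · exact absurd ((key m').1 (h3 m' (by exact_mod_cast not_le.2 hgt))) (h2' (by omega))

theorem sameNumeral_ev {n : ℕ} (f : TCFun n) (v : Fin n → M) (w : Fin n → N)
    (hv : ∀ j, SameNumeral (v j) (w j)) : SameNumeral (f.ev v) (f.ev w) := by
  induction f with
  | zero =>
    rw [Subsingleton.elim v (![] : Fin 0 → M), Subsingleton.elim w (![] : Fin 0 → N)]
    exact ⟨0, Nat.cast_zero.symm, Nat.cast_zero.symm⟩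
  | succ =>
    obtain ⟨a, ha, ha'⟩ := hv 0
    rw [vec_one v, vec_one w, ha, ha']
    change SameNumeral (succ _) (succ _)
    rw [succ_eq, succ_eq]
    exact ⟨a + 1, by push_cast; rfl, by push_cast; rfl⟩
  | add =>
    obtain ⟨a, ha, ha'⟩ := hv 0
    obtain ⟨b, hb, hb'⟩ := hv 1
    rw [vec_two v, vec_two w, ha, ha', hb, hb']
    exact ⟨a + b, by push_cast; rfl, by push_cast; rfl⟩
  | mul =>
    obtain ⟨a, ha, ha'⟩ := hv 0
    obtain ⟨b, hb, hb'⟩ := hv 1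
    rw [vec_two v, vec_two w, ha, ha', hb, hb']
    exact ⟨a * b, by push_cast; rfl, by push_cast; rfl⟩
  | half =>
    obtain ⟨a, ha, ha'⟩ := hv 0
    rw [vec_one v, vec_one w, ha, ha']
    exact ⟨a / 2, half_natCast a, half_natCast a⟩
  | len =>
    obtain ⟨a, ha, ha'⟩ := hv 0
    rw [vec_one v, vec_one w, ha, ha']
    exact sameNumeral_len a
  | smash =>
    obtain ⟨a, ha, ha'⟩ := hv 0
    obtain ⟨b, hb, hb'⟩ := hv 1
    rw [vec_two v, vec_two w, ha, ha', hb, hb']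
    exact sameNumeral_smash a b
  | sub =>
    obtain ⟨a, ha, ha'⟩ := hv 0
    obtain ⟨b, hb, hb'⟩ := hv 1
    rw [vec_two v, vec_two w, ha, ha', hb, hb']
    exact ⟨a - b, sub_natCast a b, sub_natCast a b⟩
  | msp =>
    obtain ⟨a, ha, ha'⟩ := hv 0
    obtain ⟨b, hb, hb'⟩ := hv 1
    rw [vec_two v, vec_two w, ha, ha', hb, hb']
    exact ⟨a / 2 ^ b, msp_natCast a b, msp_natCast a b⟩
  | proj i => rw [ev_proj, ev_proj]; exact hv i
  | comp f g ihf ihg =>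
    rw [ev_comp, ev_comp]
    exact ihf _ _ fun j => ihg j _ _ hv
  | bits h ih => exact sameNumeral_bits v w hv ih
  | search h ih => exact sameNumeral_search v w hv ih

/-- Bounds evaluate to the same numeral in both models, hence so do all witnesses below them; the Π
case follows by negation. -/
theorem Sem.absolute {s : Side} {i n : ℕ} {P : UPred n} (h : Sem s i P) (v : Fin n → M)
    (w : Fin n → N) (hv : ∀ j, SameNumeral (v j) (w j)) : P M v ↔ P N w := by
  induction i generalizing s n with
  | zero =>
    obtain ⟨f, hf⟩ := sem_zero.1 h
    obtain ⟨m, hm, hm'⟩ := sameNumeral_ev f v w hv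
    rw [hf, hf, TCFun.Holds, TCFun.Holds, hm, hm', Nat.cast_ne_zero, Nat.cast_ne_zero]
  | succ i ih =>
    have key : ∀ {P : UPred n}, Sem .sigma (i + 1) P → (P M v ↔ P N w) := by
      intro P h
      obtain ⟨t, Q, hQ, hf⟩ := sem_sigma.1 h
      obtain ⟨m, hm, hm'⟩ := sameNumeral_ev t v w hv
      rw [hf, hf, hm, hm']
      constructor
      · rintro ⟨u, hu, hQu⟩
        obtain ⟨j, rfl⟩ := exists_eq_natCast hu
        exact ⟨j, by exact_mod_cast hu, (ih hQ (Fin.cons (j : M) v) (Fin.cons (j : N) w)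
          (Fin.cases ⟨j, rfl, rfl⟩ hv)).1 hQu⟩
      · rintro ⟨u, hu, hQu⟩
        obtain ⟨j, rfl⟩ := exists_eq_natCast hu
        exact ⟨j, by exact_mod_cast hu, (ih hQ (Fin.cons (j : M) v) (Fin.cons (j : N) w)
          (Fin.cases ⟨j, rfl, rfl⟩ hv)).2 hQu⟩
    cases s with
    | sigma => exact key h
    | pi => exact not_iff_not.1 (key h.not)

end Standard

/-- Without parameters φ(0) has the same truth value in all models. If it is true, it supplies the
missing base premise; if it is false, the conclusion is vacuous. -/
theorem reducible_free_base {s : Side} {i : ℕ} {S S' : Scheme} {p p' c : SetCond}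
    (hS : Represents S p fun M _ P => P 0 → c M P) (hS' : Represents S' p' c)
    (hp : ∀ (M : Type) [TCModel M] (P : M → Prop), P 0 → p M P → p' M P)
    (hT : ∀ (M : Type) [TCModel M], p' M fun _ => True) :
    Reducible ((hat s i).ruleFree S) ((hat s i).rule S') := by
  rw [ruleFree_eq]
  refine reducible_of hS hS' ?_
  rintro k φ ⟨rfl, hφ⟩
  have habs : ∀ (M N : Type) [TCModel M] [TCModel N] (y : Fin 0 → M) (z : Fin 0 → N),
      φ.holds M y 0 → φ.holds N z 0 := by
    intro M N _ _ y z
    have := (IndFm.sem_of_mem hφ).absolute (Fin.cons (0 : M) y) (Fin.cons (0 : N) z)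
      (Fin.cases ⟨0, by simp, by simp⟩ fun j => j.elim0)
    exact this.1
  by_cases h : ∃ (M : Type) (_ : TCModel M) (y : Fin 0 → M), φ.holds M y 0
  · obtain ⟨M, _, y, hy⟩ := h
    exact ⟨0, φ, hφ, fun N _ hN =>
      ⟨fun z => hp N _ (habs M N y z hy) (hN z), fun hc z _ => hc z⟩⟩
  · push Not at h
    -- Some instance of the target rule must still be named, so an always true formula is used.
    obtain ⟨ψ, hψ, H⟩ := (Sem.ofOpen (s := s) (i := i) (n := 1) 1).exists_mem (k := 0)
    refine ⟨0, ψ, hψ, fun M _ _ => ⟨fun y => ?_, fun _ y h0 => absurd h0 (h M _ y)⟩⟩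
    have : ψ.holds M y = fun _ => True := by
      funext x
      rw [H]
      simp [TCFun.Holds]
    rw [this]
    exact hT M

end BoundedArithmetic

/-! ### Assembling the equivalences -/

open BoundedArithmetic in
theorem proposition4p2 (i : ℕ) (s : Side) :
    -- rules without parameters, and with the base case in the conclusion
    (((hat s i).ruleFree INDR ≡ᵣ (hat s i).rule INDR) ∧
      ((hat s i).ruleFree IND0R ≡ᵣ (hat s i).rule INDR) ∧
      ((hat s i).ruleFree PINDR ≡ᵣ (hat s i).rule PINDR) ∧
      ((hat s i).ruleFree PIND0R ≡ᵣ (hat s i).rule PINDR)) ∧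
    -- length induction
    (((hat s i).rule LIND ≡ᵣ (hat s i).rule PIND) ∧
      ((hat s i).rule LINDlt ≡ᵣ (hat s i).rule PIND) ∧
      ((hat s i).rule LINDR ≡ᵣ (hat s i).rule PINDR) ∧
      ((hat s i).rule LINDltR ≡ᵣ (hat s i).rule PINDR)) ∧
    -- order induction
    (∀ Γ : FmClass, Γ = hat .sigma i ∨ Γ = hat .pi (i + 1) →
      (Γ.rule INDlt ≡ᵣ (hat .pi (i + 1)).rule IND) ∧
      (Γ.ruleFree INDlt ≡ᵣ (hat .pi (i + 1)).ruleFree IND) ∧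
      (Γ.rule INDltR ≡ᵣ (hat .pi (i + 1)).rule INDR) ∧
      (Γ.ruleFree INDltR ≡ᵣ (hat .pi (i + 1)).ruleFree INDR) ∧
      (Γ.rule PINDlt ≡ᵣ (hat .pi (i + 1)).rule PIND) ∧
      (Γ.ruleFree PINDlt ≡ᵣ (hat .pi (i + 1)).ruleFree PIND) ∧
      (Γ.rule PINDltR ≡ᵣ (hat .pi (i + 1)).rule PINDR) ∧
      (Γ.ruleFree PINDltR ≡ᵣ (hat .pi (i + 1)).ruleFree PINDR)) ∧
    -- restricted order polynomial induction
    (((hat s i).rule PINDres ≡ᵣ (hat s i).rule PIND) ∧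
      ((hat s i).ruleFree PINDres ≡ᵣ (hat s i).ruleFree PIND) ∧
      ((hat s i).rule PINDresR ≡ᵣ (hat s i).rule PINDR) ∧
      ((hat s i).ruleFree PINDresR ≡ᵣ (hat s i).ruleFree PINDR)) ∧
    -- rules with parameters and with the base case in the conclusion
    (((hat s i).rule IND0R ≡ᵣ (hat .sigma i).rule INDR) ∧
      ((hat s i).rule PIND0R ≡ᵣ (hat .sigma i).rule PINDR) ∧
      ((hat s i).rule LIND0R ≡ᵣ (hat .sigma i).rule PINDR)) ∧
    -- minimization schemes
    (((hat s i).rule MIN ≡ᵣ (hat s.dual i).rule INDlt) ∧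
      ((hat s i).ruleFree MIN ≡ᵣ (hat s.dual i).ruleFree INDlt) ∧
      ((hat s i).rule LMIN ≡ᵣ (hat s.dual i).rule PINDlt) ∧
      ((hat s i).ruleFree LMIN ≡ᵣ (hat s.dual i).ruleFree PINDlt)) ∧
    -- minimization rules
    (((hat s i).rule MINR ≡ᵣ (hat s i).rule MIN) ∧
      ((hat s i).rule LMINR ≡ᵣ (hat s i).rule LMIN)) := by
  have refl : ∀ R : Rule, Reducible R R := fun _ _ _ => subset_rfl
  -- For rules that do not distinguish the two sides, everything may be moved to Σ, where witnesses
  -- for the base case are available.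
  have dual : ∀ (S : Scheme), (∀ s : Side, Reducible ((hat s i).rule S) ((hat s.dual i).rule S)) →
      Reducible ((hat s i).rule S) ((hat .sigma i).rule S) ∧
        Reducible ((hat .sigma i).rule S) ((hat s i).rule S) := by
    intro S h
    cases s with
    | sigma => exact ⟨refl _, refl _⟩
    | pi => exact ⟨h .pi, h .sigma⟩
  have i1 := reducible_free (s := s) (i := i) represents_INDR fun M _ P => hypInd_code
  have i2 := reducible_free (s := s) (i := i) represents_PINDR fun M _ P => hypPind_code
  have i3 := (ind_to_ind0 (s := s) (i := i)).rules represents_INDR represents_IND0R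
  have i4 := (pind_to_pind0 (s := s) (i := i)).rules represents_PINDR represents_PIND0R
  have i5 := reducible_free_base (s := s) (i := i) represents_IND0R represents_INDR
    (fun M _ P h0 h => ⟨h0, h⟩) fun M _ => ⟨trivial, fun _ _ => trivial⟩
  have i6 := reducible_free_base (s := s) (i := i) represents_PIND0R represents_PINDR
    (fun M _ P h0 h => ⟨h0, h⟩) fun M _ => ⟨trivial, fun _ _ => trivial⟩
  refine ⟨⟨⟨ruleFree_subset _ _, i1⟩, ⟨i5, i1.trans i3.2⟩, ⟨ruleFree_subset _ _, i2⟩,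
    ⟨i6, i2.trans i4.2⟩⟩, ?_, ?_, ?_, ?_, ?_, minR_equiv_min, lminR_equiv_lmin⟩
  · have l1 := pind_to_lind (s := s) (i := i)
    have l2 := lind_to_lindlt (s := s) (i := i)
    -- Order induction on lengths is reduced by passing through restricted induction, so the
    -- collection of witnesses is used here too.
    have l3 := (lindlt_to_pindres (s := s) (i := i)).trans pindres_to_pind
    have l4 := lind_to_pind (s := s) (i := i)
    exact ⟨⟨(l4.schemes represents_LIND represents_PIND).1,
        l1.schemes represents_PIND represents_LIND⟩,
      ⟨(l3.schemes represents_LINDlt represents_PIND).1,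
        (l1.schemes represents_PIND represents_LIND).trans
          (l2.schemes represents_LIND represents_LINDlt).1⟩,
      ⟨(l4.rules represents_LINDR represents_PINDR).1,
        l1.rules represents_PINDR represents_LINDR⟩,
      ⟨(l3.rules represents_LINDltR represents_PINDR).1,
        (l1.rules represents_PINDR represents_LINDR).trans
          (l2.rules represents_LINDR represents_LINDltR).1⟩⟩
  · intro Γ hΓ
    have o1 : StrictlyReduces Γ (hat .pi (i + 1)) hypLt concAll hypInd concAll ∧
        StrictlyReduces (hat .pi (i + 1)) Γ hypInd concAll hypLt concAll ∧
        StrictlyReduces Γ (hat .pi (i + 1)) hypLenLt concAll hypPind concAll ∧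
        StrictlyReduces (hat .pi (i + 1)) Γ hypPind concAll hypLenLt concAll := by
      rcases hΓ with rfl | rfl
      · exact ⟨(strictlyReduces_of_subset hat_sigma_subset fun _ _ _ h => ⟨h, id⟩).trans
            indlt_to_ind, ind_to_indlt_sigma,
          (strictlyReduces_of_subset hat_sigma_subset fun _ _ _ h => ⟨h, id⟩).trans
            pindlt_to_pind, pind_to_pindlt_sigma⟩
      · exact ⟨indlt_to_ind, ind_to_indlt_sigma.trans
            (strictlyReduces_of_subset hat_sigma_subset fun _ _ _ h => ⟨h, id⟩),
          pindlt_to_pind, pind_to_pindlt_sigma.trans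
            (strictlyReduces_of_subset hat_sigma_subset fun _ _ _ h => ⟨h, id⟩)⟩
    obtain ⟨o1, o2, o3, o4⟩ := o1
    have a1 := o1.schemes represents_INDlt represents_IND
    have a2 := o2.schemes represents_IND represents_INDlt
    have a3 := o1.rules represents_INDltR represents_INDR
    have a4 := o2.rules represents_INDR represents_INDltR
    have b1 := o3.schemes represents_PINDlt represents_PIND
    have b2 := o4.schemes represents_PIND represents_PINDlt
    have b3 := o3.rules represents_PINDltR represents_PINDR
    have b4 := o4.rules represents_PINDR represents_PINDltR
    exact ⟨⟨a1.1, a2.1⟩, ⟨a1.2, a2.2⟩, ⟨a3.1, a4.1⟩, ⟨a3.2, a4.2⟩,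
      ⟨b1.1, b2.1⟩, ⟨b1.2, b2.2⟩, ⟨b3.1, b4.1⟩, ⟨b3.2, b4.2⟩⟩
  · have r1 := pindres_to_pind (s := s) (i := i)
    have r2 := pind_to_pindres (s := s) (i := i)
    have a1 := r1.schemes represents_PINDres represents_PIND
    have a2 := r2.schemes represents_PIND represents_PINDres
    have a3 := r1.rules represents_PINDresR represents_PINDR
    have a4 := r2.rules represents_PINDR represents_PINDresR
    exact ⟨⟨a1.1, a2.1⟩, ⟨a1.2, a2.2⟩, ⟨a3.1, a4.1⟩, ⟨a3.2, a4.2⟩⟩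
  · have d1 := dual IND0R fun s => ind0_dual.rules represents_IND0R represents_IND0R
    have d2 := dual PIND0R fun s => pind0_dual.rules represents_PIND0R represents_PIND0R
    have e1 := (ind0_to_ind (i := i)).rules represents_IND0R represents_INDR
    have e2 := (pind0_to_pind (i := i)).rules represents_PIND0R represents_PINDR
    have e3 := (ind_to_ind0 (s := .sigma) (i := i)).rules represents_INDR represents_IND0R
    have e4 := (pind_to_pind0 (s := .sigma) (i := i)).rules represents_PINDR represents_PIND0R
    have e5 := (lind0_to_pind0 (s := s) (i := i)).rules represents_LIND0R represents_PIND0R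
    have e6 := (pind0_to_lind0 (s := s) (i := i)).rules represents_PIND0R represents_LIND0R
    exact ⟨⟨d1.1.trans e1, e3.1.trans d1.2⟩, ⟨d2.1.trans e2, e4.1.trans d2.2⟩,
      ⟨(e5.1.trans d2.1).trans e2, (e4.1.trans d2.2).trans e6⟩⟩
  · exact ⟨min_equiv_indlt.1, min_equiv_indlt.2, lmin_equiv_pindlt.1, lmin_equiv_pindlt.2⟩
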